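/- Let $\mathbf H$ be the quaternions and $\mathbf O$ the Cayley octonions, and let $\mathbf K=\mathbf H$ or $\mathbf K=\mathbf O$. *The space $X_{\mathbf H}=SL_3(\mathbf H)/SU_3(\mathbf H)$.* With $J=\begin{pmatrix}0&-I\\ I&0\end{pmatrix}\in M_6(\mathbf C)$, the $3\times3$ quaternionic matrices are identified with $\{M\in M_6(\mathbf C): JMJ^{-1}=\overline M\}$ (a real $3\times 3$ matrix $N$ with $\mathrm{diag}(N,N)$), $G=SL_3(\mathbf H)$ consists of those with $\det M=1$, and $X_{\mathbf H}$ is the set of positive definite Hermitian $M\in SL_3(\mathbf H)$. The group $G$ acts by $g(x)=(gx^2g^*)^{1/2}$, and $d(x,y)=\log\|x^{-1}y\|+\log\|y^{-1}x\|$ with $\|\cdot\|$ the operator norm on $\mathbf H^3=\mathbf C^6$. *The space $X_{\mathbf O}=E_{6(-26)}/F_{4(-52)}$.* Let $\mathcal J$ be the real vector space of Hermitian $3\times 3$ matrices over $\mathbf O$, with product $M\star N=\frac12(MN+NM)$ and Freudenthal determinant $$\det\begin{pmatrix}\xi_1&x_3&\overline{x_2}\\ \overline{x_3}&\xi_2&x_1\\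 x_2&\overline{x_1}&\xi_3\end{pmatrix}=\xi_1\xi_2\xi_3-\sum_{i}\xi_i|x_i|^2+2\,\Re(x_1x_2x_3).$$ Then $G=E_{6(-26)}=\{g\in GL(\mathcal J):\det\circ g=\det\}$ and $F_{4(-52)}=\{g\in E_{6(-26)}:g(I)=I\}$. An $M\in\mathcal J$ is positive if some $k\in F_{4(-52)}$ maps it to a diagonal matrix with positive entries, and $X_{\mathbf O}$ is the set of positive $M\in\mathcal J$ with $\det M=1$. The group $G$ acts by $g\circ M=\sqrt{g(M\star M)}$, where $\sqrt P$ is the $Y\in X_{\mathbf O}$ with $Y\star Y=P$. If $M=g\circ I$ and $N=g\circ D$ with $g\in G$ and $D\in X_{\mathbf O}$ diagonal with entries $d_1,d_2,d_3$, then $d(M,N)=\log\max_i d_i+\log\max_i d_i^{-1}$. *Terminology.* For $t\in\mathbf R$, a pair $(x,y)$ of points of $X_{\mathbf K}$ is of shape $(t,0)$ if there is $g\in G$ with $g(x)=I$ and $g(y)=e^{-t/3}\,\mathrm{diag}(e^t,1,1)$. A triple $(x,y,z)$ is an equilateral triangle if for some $t\in\mathbf R$ there is $g\in G$ with $g(x)=I$,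 $g(y)=e^{-t/3}\,\mathrm{diag}(e^t,1,1)$ and $g(z)=e^{-2t/3}\,\mathrm{diag}(e^t,e^t,1)$. A sequence $x_1\dots x_n$ is a $\delta$-path if $d(x_1,x_2)+\dots+d(x_{n-1},x_n)\le d(x_1,x_n)+\delta$. A triple $x,y,z$ is $\delta$-retractable if there is $u\in X_{\mathbf K}$ such that $xuy$, $yuz$ and $zux$ are $\delta$-paths. **Lemma.** For every $\delta_0>0$ there exists $\delta>0$ such that: (1) for all $x,y,z\in X_{\mathbf K}$ there is an equilateral triangle $(x',y',z')$ in $X_{\mathbf K}$ such that $xx'y'y$, $yy'z'z$ and $zz'x'x$ are $\delta$-paths; (2) for all $s,t\in\mathbf R$ of the same sign (that is, $st\ge 0$) and all $z,v,w,y\in X_{\mathbf K}$ such that $d(v,w)<\delta_0$, $(v,z)$ is of shape $(t,0)$ and $(w,y)$ is of shape $(s,0)$, the triple $z,v,y$ is $\delta$-retractable. -/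

import Mathlib

open scoped ComplexOrder

noncomputable section

/-! ## The octonions -/

/-- The Cayley octonions `a + b ℓ`, obtained from the quaternions by Cayley-Dickson doubling. -/
@[ext]
structure Octonion where
  fst : Quaternion ℝ
  snd : Quaternion ℝ

namespace Octonion

instance : Zero Octonion := ⟨⟨0, 0⟩⟩
instance : One Octonion := ⟨⟨1, 0⟩⟩
instance : Add Octonion := ⟨fun x y => ⟨x.fst + y.fst, x.snd + y.snd⟩⟩
instance : Neg Octonion := ⟨fun x => ⟨-x.fst, -x.snd⟩⟩
instance : Sub Octonion := ⟨fun x y => ⟨x.fst - y.fst, x.snd - y.snd⟩⟩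
instance : SMul ℕ Octonion := ⟨fun n x => ⟨n • x.fst, n • x.snd⟩⟩
instance : SMul ℤ Octonion := ⟨fun n x => ⟨n • x.fst, n • x.snd⟩⟩
instance : SMul ℝ Octonion := ⟨fun r x => ⟨r • x.fst, r • x.snd⟩⟩

/-- `(a + bℓ)(c + dℓ) = (ac - d̄b) + (da + bc̄)ℓ`. -/
instance : Mul Octonion :=
  ⟨fun x y => ⟨x.fst * y.fst - star y.snd * x.snd, y.snd * x.fst + x.snd * star y.fst⟩⟩

/-- Octonionic conjugation. -/
instance : Star Octonion := ⟨fun x => ⟨star x.fst, -x.snd⟩⟩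

@[simp] theorem zero_fst : (0 : Octonion).fst = 0 := rfl
@[simp] theorem zero_snd : (0 : Octonion).snd = 0 := rfl
@[simp] theorem one_fst : (1 : Octonion).fst = 1 := rfl
@[simp] theorem one_snd : (1 : Octonion).snd = 0 := rfl
@[simp] theorem add_fst (x y : Octonion) : (x + y).fst = x.fst + y.fst := rfl
@[simp] theorem add_snd (x y : Octonion) : (x + y).snd = x.snd + y.snd := rfl
@[simp] theorem neg_fst (x : Octonion) : (-x).fst = -x.fst := rfl
@[simp] theorem neg_snd (x : Octonion) : (-x).snd = -x.snd := rfl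
@[simp] theorem sub_fst (x y : Octonion) : (x - y).fst = x.fst - y.fst := rfl
@[simp] theorem sub_snd (x y : Octonion) : (x - y).snd = x.snd - y.snd := rfl
@[simp] theorem smul_fst (r : ℝ) (x : Octonion) : (r • x).fst = r • x.fst := rfl
@[simp] theorem smul_snd (r : ℝ) (x : Octonion) : (r • x).snd = r • x.snd := rfl
@[simp] theorem star_fst (x : Octonion) : (star x).fst = star x.fst := rfl
@[simp] theorem star_snd (x : Octonion) : (star x).snd = -x.snd := rfl
@[simp] theorem mul_fst (x y : Octonion) :
    (x * y).fst = x.fst * y.fst - star y.snd * x.snd := rfl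
@[simp] theorem mul_snd (x y : Octonion) :
    (x * y).snd = y.snd * x.fst + x.snd * star y.fst := rfl

theorem toProd_injective :
    Function.Injective (fun x : Octonion => (x.fst, x.snd)) := by
  intro x y h
  exact Octonion.ext (congrArg Prod.fst h) (congrArg Prod.snd h)

instance : AddCommGroup Octonion :=
  toProd_injective.addCommGroup _ rfl (fun _ _ => rfl) (fun _ => rfl) (fun _ _ => rfl)
    (fun _ _ => rfl) (fun _ _ => rfl)

instance : Module ℝ Octonion :=
  toProd_injective.module ℝ
    { toFun := fun x : Octonion => (x.fst, x.snd), map_zero' := rfl, map_add' := fun _ _ => rfl }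
    (fun _ _ => rfl)

instance : NonAssocRing Octonion :=
  { (inferInstance : AddCommGroup Octonion) with
    mul := (· * ·)
    one := 1
    left_distrib := fun x y z => by
      ext1 <;> simp [mul_add, add_mul] <;> abel
    right_distrib := fun x y z => by
      ext1 <;> simp [mul_add, add_mul] <;> abel
    zero_mul := fun x => by ext1 <;> simp
    mul_zero := fun x => by ext1 <;> simp
    one_mul := fun x => by ext1 <;> simp
    mul_one := fun x => by ext1 <;> simp }

instance : StarRing Octonion where
  star_involutive x := by ext1 <;> simp
  star_mul x y := by ext1 <;> simp
  star_add x y := by ext1 <;> simp; abel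

/-- The inclusion of the real numbers. -/
def ofReal (r : ℝ) : Octonion := ⟨(r : Quaternion ℝ), 0⟩

/-- The real part. -/
def re (x : Octonion) : ℝ := x.fst.re

/-- The squared norm `|x|² = x x̄`. -/
def normSq (x : Octonion) : ℝ := re (x * star x)

end Octonion

/-! ## The exceptional Jordan algebra and `X_O = E₆₍₋₂₆₎ / F₄₍₋₅₂₎` -/

/-- The exceptional Jordan algebra: Hermitian `3 × 3` octonionic matrices. -/
def Albert : Submodule ℝ (Matrix (Fin 3) (Fin 3) Octonion) where
  carrier := {M | M.conjTranspose = M}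
  add_mem' := by
    intro M N hM hN
    change Matrix.conjTranspose _ = _ at hM hN
    change Matrix.conjTranspose _ = _
    rw [Matrix.conjTranspose_add, hM, hN]
  zero_mem' := Matrix.conjTranspose_zero
  smul_mem' := by
    intro r M hM
    change Matrix.conjTranspose _ = _ at hM
    change Matrix.conjTranspose _ = _
    nth_rewrite 2 [← hM]
    refine Matrix.ext fun i j => ?_
    apply Octonion.ext <;> simp [Matrix.conjTranspose_apply]

namespace Albert

/-- The Jordan multiplication `M ⋆ N = (MN + NM) / 2`. -/
def jmul (M N : Albert) : Albert :=
  ⟨(1 / 2 : ℝ) • (M.1 * N.1 + N.1 * M.1), Albert.smul_mem _ (by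
    have hM : M.1.conjTranspose = M.1 := M.2
    have hN : N.1.conjTranspose = N.1 := N.2
    change (M.1 * N.1 + N.1 * M.1).conjTranspose = _
    rw [Matrix.conjTranspose_add, Matrix.conjTranspose_mul, Matrix.conjTranspose_mul, hM, hN,
      add_comm])⟩

/-- The real diagonal matrix with entries `a`. -/
def diag (a : Fin 3 → ℝ) : Albert :=
  ⟨Matrix.diagonal fun i => Octonion.ofReal (a i), by
    change Matrix.conjTranspose _ = _
    rw [Matrix.diagonal_conjTranspose]
    congr 1
    funext i
    apply Octonion.ext <;> simp [Octonion.ofReal]⟩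

/-- Freudenthal's determinant
`ξ₁ξ₂ξ₃ - ∑ᵢ ξᵢ|xᵢ|² + 2 Re(x₁x₂x₃)` of the matrix with rows
`(ξ₁, x₃, x̄₂)`, `(x̄₃, ξ₂, x₁)`, `(x₂, x̄₁, ξ₃)`. -/
def det (M : Albert) : ℝ :=
  let ξ₁ := (M.1 0 0).re
  let ξ₂ := (M.1 1 1).re
  let ξ₃ := (M.1 2 2).re
  let x₁ := M.1 1 2
  let x₂ := M.1 2 0
  let x₃ := M.1 0 1
  ξ₁ * ξ₂ * ξ₃ - (ξ₁ * x₁.normSq + ξ₂ * x₂.normSq + ξ₃ * x₃.normSq)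
    + 2 * (x₁ * x₂ * x₃).re

end Albert

/-- `E₆₍₋₂₆₎`: the linear automorphisms of the exceptional Jordan algebra that preserve the
determinant. -/
def E6 : Subgroup (Albert ≃ₗ[ℝ] Albert) where
  carrier := {g | ∀ M, Albert.det (g M) = Albert.det M}
  mul_mem' := by
    intro g h hg hh M
    exact (hg (h M)).trans (hh M)
  one_mem' := fun _ => rfl
  inv_mem' := by
    intro g hg M
    have h := hg (g⁻¹ M)
    have e : g (g⁻¹ M) = M := g.apply_symm_apply M
    rw [e] at h
    exact h.symm

/-- `F₄₍₋₅₂₎`: the elements of `E₆₍₋₂₆₎` that fix the identity matrix. -/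
def F4 : Set (Albert ≃ₗ[ℝ] Albert) :=
  {g | g ∈ E6 ∧ g (Albert.diag 1) = Albert.diag 1}

/-- Positivity: some element of `F₄₍₋₅₂₎` diagonalizes `M`, with positive diagonal entries. -/
def Albert.Positive (M : Albert) : Prop :=
  ∃ k ∈ F4, ∃ a : Fin 3 → ℝ, (∀ i, 0 < a i) ∧ k M = Albert.diag a

/-- The model of `E₆₍₋₂₆₎ / F₄₍₋₅₂₎`: positive matrices of determinant one. -/
def XO : Type := {M : Albert // Albert.det M = 1 ∧ Albert.Positive M}

/-- `ActsO g M N` says that `g ∘ M = N` for the action `g ∘ M = √(g(M²))`: here `√P` is the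
element `N` of `XO` with `N ⋆ N = P`. -/
def ActsO (g : E6) (M N : XO) : Prop :=
  Albert.jmul N.1 N.1 = g.1 (Albert.jmul M.1 M.1)

/-- `D` is the diagonal matrix with entries `a`. -/
def IsDiagO (D : XO) (a : Fin 3 → ℝ) : Prop := D.1 = Albert.diag a

/-- The distance on `XO`: if `M = g ∘ I` and `N = g ∘ D` with `D` diagonal, then
`d(M, N) = log ‖D‖ + log ‖D⁻¹‖`, where `‖·‖` is the largest diagonal entry. Such `g` and `D`
exist, and `D` is unique up to permutation of its entries, so the infimum below is that of a
one-point set. -/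
def distO (M N : XO) : ℝ :=
  sInf {r | ∃ (g : E6) (I D : XO) (a : Fin 3 → ℝ), IsDiagO I 1 ∧ IsDiagO D a ∧
    ActsO g I M ∧ ActsO g D N ∧ r = Real.log (⨆ i, a i) + Real.log (⨆ i, (a i)⁻¹)}

/-! ## `X_H = SL₃(H) / SU₃(H)` -/

/-- `SL₃(H)`: the complex `6 × 6` matrices `M` of determinant one with `J M J⁻¹ = M̄`, where
`J` has blocks `0, -I, I, 0`. (The condition `J M J⁻¹ = M̄` describes the image of the `3 × 3`
quaternionic matrices.) -/
def SL3H : Set (Matrix (Fin 3 ⊕ Fin 3) (Fin 3 ⊕ Fin 3) ℂ) :=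
  {M | Matrix.J (Fin 3) ℂ * M * (Matrix.J (Fin 3) ℂ)⁻¹ = M.map star ∧ M.det = 1}

/-- The model of `SL₃(H) / SU₃(H)`: positive Hermitian matrices in `SL₃(H)`. -/
def XH : Type := {M : Matrix (Fin 3 ⊕ Fin 3) (Fin 3 ⊕ Fin 3) ℂ // M ∈ SL3H ∧ M.PosDef}

/-- `ActsH g x y` says that `g(x) = y` for the action `g(x) = (g x² g*)^{1/2}`, where the root is
the positive one. -/
def ActsH (g : SL3H) (x y : XH) : Prop :=
  y.1 * y.1 = g.1 * (x.1 * x.1) * g.1.conjTranspose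

/-- `D` is the real diagonal `3 × 3` matrix with entries `a`. -/
def IsDiagH (D : XH) (a : Fin 3 → ℝ) : Prop :=
  D.1 = Matrix.fromBlocks (Matrix.diagonal fun i => (a i : ℂ)) 0 0
    (Matrix.diagonal fun i => (a i : ℂ))

/-- The operator norm for the Euclidean norm on `H³ = ℂ⁶`. -/
def opNorm (M : Matrix (Fin 3 ⊕ Fin 3) (Fin 3 ⊕ Fin 3) ℂ) : ℝ :=
  ‖Matrix.toEuclideanCLM (𝕜 := ℂ) M‖

/-- `d(x, y) = log ‖x⁻¹y‖ + log ‖y⁻¹x‖`. -/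
def distH (x y : XH) : ℝ :=
  Real.log (opNorm (x.1⁻¹ * y.1)) + Real.log (opNorm (y.1⁻¹ * x.1))

/-! ## Shapes, equilateral triangles and `δ`-paths -/

/-- The two division algebras: quaternions and octonions. -/
inductive DivAlg
  | H
  | O

/-- The group `SL₃(H)` or `E₆₍₋₂₆₎`. -/
def GroupK : DivAlg → Type
  | .H => SL3H
  | .O => E6

/-- The symmetric space `X_H` or `X_O`. -/
def SpaceK : DivAlg → Type
  | .H => XH
  | .O => XO

/-- `Acts g x y` says that `g(x) = y`. -/
def Acts : {K : DivAlg} → GroupK K → SpaceK K → SpaceK K → Prop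
  | .H => ActsH
  | .O => ActsO

/-- `D` is the diagonal matrix with entries `a`. -/
def IsDiag : {K : DivAlg} → SpaceK K → (Fin 3 → ℝ) → Prop
  | .H => IsDiagH
  | .O => IsDiagO

/-- The distance on `X_K`. -/
def distK : {K : DivAlg} → SpaceK K → SpaceK K → ℝ
  | .H => distH
  | .O => distO

/-- `(x, y)` is of shape `(t, 0)`. -/
def HasShape {K : DivAlg} (t : ℝ) (x y : SpaceK K) : Prop :=
  ∃ (g : GroupK K) (p q : SpaceK K), Acts g x p ∧ Acts g y q ∧ IsDiag p 1 ∧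
    IsDiag q (Real.exp (-t / 3) • ![Real.exp t, 1, 1])

/-- `(x, y, z)` is an equilateral triangle of oriented size `t`. -/
def IsEquilateral {K : DivAlg} (t : ℝ) (x y z : SpaceK K) : Prop :=
  ∃ (g : GroupK K) (p q r : SpaceK K), Acts g x p ∧ Acts g y q ∧ Acts g z r ∧ IsDiag p 1 ∧
    IsDiag q (Real.exp (-t / 3) • ![Real.exp t, 1, 1]) ∧
    IsDiag r (Real.exp (-2 * t / 3) • ![Real.exp t, Real.exp t, 1])

/-- The sequence `p 0, …, p n` is a `δ`-path. -/
def IsDeltaPath {K : DivAlg} (δ : ℝ) {n : ℕ} (p : Fin (n + 1) → SpaceK K) : Prop :=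
  ∑ i : Fin n, distK (p i.castSucc) (p i.succ) ≤ distK (p 0) (p (Fin.last n)) + δ

/-- The triple `x, y, z` is `δ`-retractable. -/
def IsRetractable {K : DivAlg} (δ : ℝ) (x y z : SpaceK K) : Prop :=
  ∃ u : SpaceK K, IsDeltaPath δ ![x, u, y] ∧ IsDeltaPath δ ![y, u, z] ∧ IsDeltaPath δ ![z, u, x]

end

/-!
A point `x` of `X_K` is replaced by the positive definite matrix `P = x²` of determinant one, on
which `G` acts linearly, preserving the order of the cone. Let `λ(x, y)` be the logarithm of the
least `c` with `y² ≤ c x²`. It satisfies the triangle inequality and `d(x, y)` is the mean of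
`λ(x, y)` and `λ(y, x)`. A path from `y` to `z` through `x` thus has two excesses, one for each
direction, and its length exceeds `d(y, z)` by their mean.

For suitable coefficients, normalizing `P + a Q + b R` to determinant one moves the vertex `P` of a
triangle towards the two others until one of the two excesses at that vertex is bounded, up to
`log 3` along geodesics. Doing so at the three vertices leaves either a triangle of bounded
diameter, or one whose small excesses all belong to the same orientation. In the latter case
`P ≤ Q ≤ R ≤ τ P` after rescaling, all three steps being nearly optimal, and diagonalizing first
`Q` and then `R` shows that the triangle is equilateral up to a bounded factor.

For the second claim, a pair of shape `(t, 0)` with `t ≥ 0` lies on a ray `1 + (τ - 1) e` in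
direction of a primitive idempotent `e`, or of its complement when `t ≤ 0`. Comparing the two rays
at `v` and `w` through an element of `G` shows that the two excesses at `v` differ by at most
`log 6` and a multiple of `d(v, w)`, so one retraction at `v` makes both of them bounded.
-/

noncomputable section

open scoped InnerProductSpace Quaternion

/-! ## Hermitian matrices over a symmetric composition algebra -/

/-- A Euclidean symmetric composition algebra. The quaternions and the octonions carry this
structure for the product `star (x * y)`, which makes the cubic norm of a Hermitian `3 × 3` matrix
cyclically symmetric and spares the conjugations in it. -/
class SymmetricComposition (A : Type*) [NormedAddCommGroup A] [InnerProductSpace ℝ A] where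
  mul : A →ₗ[ℝ] A →ₗ[ℝ] A
  inner_mul : ∀ x y z, ⟪mul x y, z⟫_ℝ = ⟪x, mul y z⟫_ℝ
  mul_mul_cancel_left : ∀ x y, mul (mul x y) x = ‖x‖ ^ 2 • y
  mul_mul_cancel_right : ∀ x y, mul x (mul y x) = ‖x‖ ^ 2 • y

namespace SymmetricComposition

variable {A : Type*} [NormedAddCommGroup A] [InnerProductSpace ℝ A] [SymmetricComposition A]

theorem inner_mul_rotate (x y z : A) : ⟪mul x y, z⟫_ℝ = ⟪mul y z, x⟫_ℝ := by
  rw [inner_mul, real_inner_comm]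

theorem inner_mul_mul_left (u x y : A) : ⟪mul u x, mul u y⟫_ℝ = ‖u‖ ^ 2 * ⟪x, y⟫_ℝ := by
  rw [inner_mul_rotate, inner_mul_rotate, mul_mul_cancel_left, real_inner_smul_left,
    real_inner_comm]

theorem inner_mul_mul_right (u x y : A) : ⟪mul x u, mul y u⟫_ℝ = ‖u‖ ^ 2 * ⟪x, y⟫_ℝ := by
  rw [inner_mul, mul_mul_cancel_right, real_inner_smul_right]

theorem norm_mul_sq (x y : A) : ‖mul x y‖ ^ 2 = ‖x‖ ^ 2 * ‖y‖ ^ 2 := by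
  rw [← real_inner_self_eq_norm_sq, inner_mul_mul_left, real_inner_self_eq_norm_sq]

theorem mul_mul_add_mul_mul (x y z : A) :
    mul x (mul y z) + mul z (mul y x) = (2 * ⟪x, z⟫_ℝ) • y := by
  have h := mul_mul_cancel_right (x + z) y
  simp only [map_add, LinearMap.add_apply, mul_mul_cancel_right, norm_add_sq_real, add_smul] at h
  rw [← sub_eq_zero] at h ⊢
  rw [← h]
  abel

theorem inner_mul_mul_mul (x u y z : A) :
    ⟪mul x (mul z u), mul u y⟫_ℝ =
      2 * ⟪x, u⟫_ℝ * ⟪mul u y, z⟫_ℝ - ‖u‖ ^ 2 * ⟪mul x y, z⟫_ℝ := by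
  rw [eq_sub_of_add_eq (mul_mul_add_mul_mul x z u), inner_sub_left, real_inner_smul_left,
    inner_mul_mul_left, real_inner_comm z, inner_mul_rotate z x y]

end SymmetricComposition

open SymmetricComposition

/-- Hermitian `3 × 3` matrices over `A`: the diagonal entries, and as `off i` the entry in row
`i + 1` and column `i + 2`, where the indices are taken modulo `3`. -/
@[ext]
structure Herm3 (A : Type*) where
  diag : Fin 3 → ℝ
  off : Fin 3 → A

namespace Herm3

theorem toProd_injective {A : Type*} :
    Function.Injective fun X : Herm3 A => (X.diag, X.off) :=
  fun _ _ h => Herm3.ext (congrArg Prod.fst h) (congrArg Prod.snd h)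

section AddCommGroup

variable {A : Type*} [AddCommGroup A]

instance : Zero (Herm3 A) := ⟨⟨0, 0⟩⟩
instance : Add (Herm3 A) := ⟨fun X Y => ⟨X.diag + Y.diag, X.off + Y.off⟩⟩
instance : Neg (Herm3 A) := ⟨fun X => ⟨-X.diag, -X.off⟩⟩
instance : Sub (Herm3 A) := ⟨fun X Y => ⟨X.diag - Y.diag, X.off - Y.off⟩⟩
instance : SMul ℕ (Herm3 A) := ⟨fun n X => ⟨n • X.diag, n • X.off⟩⟩
instance : SMul ℤ (Herm3 A) := ⟨fun n X => ⟨n • X.diag, n • X.off⟩⟩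

@[simp] theorem zero_diag : (0 : Herm3 A).diag = 0 := rfl
@[simp] theorem zero_off : (0 : Herm3 A).off = 0 := rfl
@[simp] theorem add_diag (X Y : Herm3 A) : (X + Y).diag = X.diag + Y.diag := rfl
@[simp] theorem add_off (X Y : Herm3 A) : (X + Y).off = X.off + Y.off := rfl
@[simp] theorem sub_diag (X Y : Herm3 A) : (X - Y).diag = X.diag - Y.diag := rfl
@[simp] theorem sub_off (X Y : Herm3 A) : (X - Y).off = X.off - Y.off := rfl

instance : AddCommGroup (Herm3 A) :=
  toProd_injective.addCommGroup _ rfl (fun _ _ => rfl) (fun _ => rfl) (fun _ _ => rfl)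
    (fun _ _ => rfl) (fun _ _ => rfl)

/-- The diagonal matrix with the given real entries. -/
def diagonal (b : Fin 3 → ℝ) : Herm3 A := ⟨b, 0⟩

@[simp] theorem diagonal_diag (b : Fin 3 → ℝ) : (diagonal b : Herm3 A).diag = b := rfl
@[simp] theorem diagonal_off (b : Fin 3 → ℝ) : (diagonal b : Herm3 A).off = 0 := rfl

theorem diagonal_add_diagonal (b c : Fin 3 → ℝ) :
    (diagonal b : Herm3 A) + diagonal c = diagonal (b + c) := by
  ext i <;> simp

end AddCommGroup

section Module

variable {A : Type*} [AddCommGroup A] [Module ℝ A]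

instance : SMul ℝ (Herm3 A) := ⟨fun r X => ⟨r • X.diag, r • X.off⟩⟩

@[simp] theorem smul_diag (r : ℝ) (X : Herm3 A) : (r • X).diag = r • X.diag := rfl
@[simp] theorem smul_off (r : ℝ) (X : Herm3 A) : (r • X).off = r • X.off := rfl

instance : Module ℝ (Herm3 A) :=
  toProd_injective.module ℝ
    { toFun := fun X : Herm3 A => (X.diag, X.off), map_zero' := rfl, map_add' := fun _ _ => rfl }
    (fun _ _ => rfl)

theorem smul_diagonal (c : ℝ) (b : Fin 3 → ℝ) :
    c • (diagonal b : Herm3 A) = diagonal (c • b) := by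
  ext i <;> simp

/-- The trace. -/
def trace : Herm3 A →ₗ[ℝ] ℝ where
  toFun X := ∑ i, X.diag i
  map_add' X Y := by simp [Finset.sum_add_distrib]
  map_smul' r X := by simp [Finset.mul_sum]

theorem trace_apply (X : Herm3 A) : trace X = ∑ i, X.diag i := rfl

end Module

section TraceForm

variable {A : Type*} [NormedAddCommGroup A] [InnerProductSpace ℝ A]

/-- The trace form `(X, Y) ↦ tr (XY + YX) / 2`. -/
def traceForm : LinearMap.BilinForm ℝ (Herm3 A) :=
  LinearMap.mk₂ ℝ (fun X Y => ∑ i, (X.diag i * Y.diag i + 2 * ⟪X.off i, Y.off i⟫_ℝ))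
    (fun X Y Z => by
      simp only [add_diag, add_off, Pi.add_apply, inner_add_left, ← Finset.sum_add_distrib]
      congr! 1; ring)
    (fun r X Z => by
      simp only [smul_diag, smul_off, Pi.smul_apply, real_inner_smul_left, smul_eq_mul,
        Finset.mul_sum]
      congr! 1; ring)
    (fun X Y Z => by
      simp only [add_diag, add_off, Pi.add_apply, inner_add_right, ← Finset.sum_add_distrib]
      congr! 1; ring)
    (fun r X Z => by
      simp only [smul_diag, smul_off, Pi.smul_apply, real_inner_smul_right, smul_eq_mul,
        Finset.mul_sum]
      congr! 1; ring)

theorem traceForm_apply (X Y : Herm3 A) :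
    traceForm X Y = ∑ i, (X.diag i * Y.diag i + 2 * ⟪X.off i, Y.off i⟫_ℝ) := rfl

theorem traceForm_comm (X Y : Herm3 A) : traceForm X Y = traceForm Y X := by
  simp only [traceForm_apply, real_inner_comm, mul_comm]

theorem traceForm_diagonal_left (b : Fin 3 → ℝ) (X : Herm3 A) :
    traceForm (diagonal b) X = ∑ i, b i * X.diag i := by
  simp [traceForm_apply]

theorem traceForm_diagonal_right (X : Herm3 A) (b : Fin 3 → ℝ) :
    traceForm X (diagonal b) = ∑ i, X.diag i * b i := by
  simp [traceForm_apply]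

theorem traceForm_one_left (X : Herm3 A) : traceForm (diagonal 1) X = trace X := by
  simp [traceForm_diagonal_left, trace_apply]

theorem traceForm_single_right (X : Herm3 A) (i : Fin 3) :
    traceForm X (diagonal (Pi.single i 1)) = X.diag i := by
  simp [traceForm_diagonal_right, Pi.single_apply]

theorem eq_zero_of_traceForm_self_eq_zero {X : Herm3 A} (h : traceForm X X = 0) : X = 0 := by
  have nonneg (i : Fin 3) : 0 ≤ X.diag i * X.diag i + 2 * ⟪X.off i, X.off i⟫_ℝ :=
    add_nonneg (mul_self_nonneg _) (mul_nonneg zero_le_two real_inner_self_nonneg)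
  rw [traceForm_apply, Finset.sum_eq_zero_iff_of_nonneg fun i _ => nonneg i] at h
  have entries (i : Fin 3) : X.diag i = 0 ∧ X.off i = 0 := by
    have := h i (Finset.mem_univ i)
    rw [add_eq_zero_iff_of_nonneg (mul_self_nonneg _)
      (mul_nonneg zero_le_two real_inner_self_nonneg)] at this
    exact ⟨mul_self_eq_zero.1 this.1, by simpa using this.2⟩
  ext i
  exacts [(entries i).1, (entries i).2]

/-- The rank one matrix `w w*` for a vector `w` whose coordinates `i + 1` and `i + 2` are `1` and
`star v`, and whose other coordinate vanishes. -/
def rankOneBlock (i : Fin 3) (v : A) : Herm3 A :=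
  ⟨Pi.single (i + 1) 1 + Pi.single (i + 2) (‖v‖ ^ 2), Pi.single i v⟩

theorem traceForm_rankOneBlock (X : Herm3 A) (i : Fin 3) (v : A) :
    traceForm X (rankOneBlock i v) =
      X.diag (i + 1) + X.diag (i + 2) * ‖v‖ ^ 2 + 2 * ⟪X.off i, v⟫_ℝ := by
  fin_cases i <;> simp [rankOneBlock, traceForm_apply, Fin.sum_univ_three] <;> ring

end TraceForm

section Det

variable {A : Type*} [NormedAddCommGroup A] [InnerProductSpace ℝ A] [SymmetricComposition A]

/-- Freudenthal's determinant. -/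
def det (X : Herm3 A) : ℝ :=
  ∏ i, X.diag i - ∑ i, X.diag i * ‖X.off i‖ ^ 2 + 2 * ⟪mul (X.off 0) (X.off 1), X.off 2⟫_ℝ

/-- The adjoint matrix, a quadratic map that serves as the derivative of `det`. -/
def adjugate (X : Herm3 A) : Herm3 A :=
  ⟨fun i => X.diag (i + 1) * X.diag (i + 2) - ‖X.off i‖ ^ 2,
    fun i => mul (X.off (i + 1)) (X.off (i + 2)) - X.diag i • X.off i⟩

theorem det_diagonal (b : Fin 3 → ℝ) : det (diagonal b : Herm3 A) = ∏ i, b i := by simp [det]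

theorem det_smul (c : ℝ) (X : Herm3 A) : det (c • X) = c ^ 3 * det X := by
  simp only [det, smul_diag, smul_off, Pi.smul_apply, map_smul, LinearMap.smul_apply,
    real_inner_smul_left, real_inner_smul_right, smul_eq_mul, norm_smul, mul_pow,
    Real.norm_eq_abs, sq_abs, Fin.prod_univ_three, Fin.sum_univ_three]
  ring

theorem adjugate_smul (c : ℝ) (X : Herm3 A) : adjugate (c • X) = c ^ 2 • adjugate X := by
  ext i
  · simp only [adjugate, smul_diag, smul_off, Pi.smul_apply, smul_eq_mul, norm_smul, mul_pow,
      Real.norm_eq_abs, sq_abs]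
    ring
  · simp only [adjugate, smul_diag, smul_off, Pi.smul_apply, smul_eq_mul, map_smul,
      LinearMap.smul_apply]
    module

theorem adjugate_one : adjugate (diagonal 1 : Herm3 A) = diagonal 1 := by
  ext i <;> simp [adjugate]

theorem det_add_add_det_sub (Y N : Herm3 A) :
    det (Y + N) + det (Y - N) = 2 * det Y + 2 * traceForm Y (adjugate N) := by
  simp only [det, traceForm_apply, adjugate, add_diag, add_off, sub_diag, sub_off, Pi.add_apply,
    Pi.sub_apply, norm_add_sq_real, norm_sub_sq_real, map_add, map_sub, LinearMap.add_apply,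
    LinearMap.sub_apply, inner_add_left, inner_add_right, inner_sub_left, inner_sub_right,
    real_inner_smul_right, Fin.prod_univ_three, Fin.sum_univ_three, Fin.isValue, Fin.reduceAdd,
    zero_add]
  rw [real_inner_comm (mul (N.off 1) (N.off 2)), real_inner_comm (mul (N.off 2) (N.off 0)),
    real_inner_comm (mul (N.off 0) (N.off 1)), ← inner_mul_rotate (Y.off 0),
    inner_mul_rotate (N.off 2)]
  ring

theorem traceForm_self (X : Herm3 A) : traceForm X X = trace X ^ 2 - 2 * trace (adjugate X) := by
  simp only [traceForm_apply, trace_apply, adjugate, real_inner_self_eq_norm_sq,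
    Fin.sum_univ_three, Fin.isValue, Fin.reduceAdd, zero_add]
  ring

theorem det_add_one_add_det_sub_one (X : Herm3 A) :
    det (X + diagonal 1) + det (X - diagonal 1) = 2 * det X + 2 * trace X := by
  rw [det_add_add_det_sub, adjugate_one, traceForm_comm, traceForm_one_left]

theorem det_one_add_add_det_one_sub (X : Herm3 A) :
    det (diagonal 1 + X) + det (diagonal 1 - X) = 2 + 2 * trace (adjugate X) := by
  rw [det_add_add_det_sub, traceForm_one_left, det_diagonal]
  simp

/-- The matrices of rank at most one with nonnegative diagonal. -/
def RankOne (N : Herm3 A) : Prop := adjugate N = 0 ∧ 0 ≤ trace N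

theorem adjugate_eq_zero_iff {N : Herm3 A} :
    adjugate N = 0 ↔ (∀ i, N.diag (i + 1) * N.diag (i + 2) = ‖N.off i‖ ^ 2) ∧
      ∀ i, mul (N.off (i + 1)) (N.off (i + 2)) = N.diag i • N.off i := by
  simp [Herm3.ext_iff, adjugate, funext_iff, sub_eq_zero]

theorem RankOne.diag_mul_diag {N : Herm3 A} (h : RankOne N) (i : Fin 3) :
    N.diag (i + 1) * N.diag (i + 2) = ‖N.off i‖ ^ 2 :=
  (adjugate_eq_zero_iff.1 h.1).1 i

theorem RankOne.diag_nonneg {N : Herm3 A} (h : RankOne N) (i : Fin 3) : 0 ≤ N.diag i := by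
  have tr := h.2
  have m (j : Fin 3) : 0 ≤ N.diag (j + 1) * N.diag (j + 2) := h.diag_mul_diag j ▸ sq_nonneg _
  have m0 := m 0
  have m1 := m 1
  have m2 := m 2
  simp only [trace_apply, Fin.sum_univ_three, Fin.isValue, Fin.reduceAdd, zero_add] at tr m0 m1 m2
  by_contra! hi
  fin_cases i <;> simp only [Fin.zero_eta, Fin.mk_one, Fin.reduceFinMk] at hi <;> nlinarith

theorem RankOne.smul {N : Herm3 A} (h : RankOne N) {c : ℝ} (hc : 0 ≤ c) : RankOne (c • N) :=
  ⟨by simp [adjugate_smul, h.1], by rw [map_smul]; exact smul_nonneg hc h.2⟩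

theorem rankOne_single (i : Fin 3) : RankOne (diagonal (Pi.single i 1) : Herm3 A) := by
  constructor
  · rw [adjugate_eq_zero_iff]
    refine ⟨fun j => ?_, fun j => ?_⟩
    · fin_cases i <;> fin_cases j <;> simp
    · simp
  · simp [trace_apply, Pi.single_apply]

theorem rankOne_rankOneBlock (i : Fin 3) (v : A) : RankOne (rankOneBlock i v) := by
  constructor
  · rw [adjugate_eq_zero_iff]
    refine ⟨fun j => ?_, fun j => ?_⟩ <;> fin_cases i <;> fin_cases j <;> simp [rankOneBlock]
  · have tr : trace (rankOneBlock i v) = 1 + ‖v‖ ^ 2 := by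
      simp [rankOneBlock, trace_apply, Finset.sum_add_distrib, Pi.single_apply]
    rw [tr]
    positivity

end Det

end Herm3

namespace Herm3

section Cyc

variable {A : Type*} [AddCommGroup A] [Module ℝ A]

/-- The cyclic permutation of the coordinates. -/
def cyc : Herm3 A ≃ₗ[ℝ] Herm3 A where
  toFun X := ⟨fun i => X.diag (i + 1), fun i => X.off (i + 1)⟩
  map_add' _ _ := rfl
  map_smul' _ _ := rfl
  invFun X := ⟨fun i => X.diag (i + 2), fun i => X.off (i + 2)⟩
  left_inv X := by ext i <;> fin_cases i <;> rfl
  right_inv X := by ext i <;> fin_cases i <;> rfl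

@[simp] theorem cyc_diag (X : Herm3 A) (i : Fin 3) : (cyc X).diag i = X.diag (i + 1) := rfl
@[simp] theorem cyc_off (X : Herm3 A) (i : Fin 3) : (cyc X).off i = X.off (i + 1) := rfl

theorem cyc_diagonal (b : Fin 3 → ℝ) :
    cyc (diagonal b : Herm3 A) = diagonal fun i => b (i + 1) := rfl

/-- Conjugation by the diagonal matrix with entries `a`. -/
def dil (a : Fin 3 → ℝ) (ha : ∀ i, a i ≠ 0) : Herm3 A ≃ₗ[ℝ] Herm3 A where
  toFun X := ⟨fun i => a i ^ 2 * X.diag i, fun i => (a (i + 1) * a (i + 2)) • X.off i⟩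
  map_add' X Y := by ext i <;> simp [mul_add]
  map_smul' r X := by
    ext i
    · simp [mul_left_comm]
    · simp [smul_comm r]
  invFun X := ⟨fun i => a⁻¹ i ^ 2 * X.diag i, fun i => (a⁻¹ (i + 1) * a⁻¹ (i + 2)) • X.off i⟩
  left_inv X := by
    ext i
    · simp [ha]
    · simp [smul_smul, mul_mul_mul_comm, ha]
  right_inv X := by
    ext i
    · simp [ha]
    · simp [smul_smul, mul_mul_mul_comm, ha]

@[simp] theorem dil_diag (a : Fin 3 → ℝ) (ha : ∀ i, a i ≠ 0) (X : Herm3 A) (i : Fin 3) :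
    (dil a ha X).diag i = a i ^ 2 * X.diag i := rfl
@[simp] theorem dil_off (a : Fin 3 → ℝ) (ha : ∀ i, a i ≠ 0) (X : Herm3 A) (i : Fin 3) :
    (dil a ha X).off i = (a (i + 1) * a (i + 2)) • X.off i := rfl

theorem dil_inv (a : Fin 3 → ℝ) (ha : ∀ i, a i ≠ 0) :
    (dil a ha : Herm3 A ≃ₗ[ℝ] Herm3 A)⁻¹ = dil a⁻¹ fun i => inv_ne_zero (ha i) :=
  LinearEquiv.ext fun _ => rfl

theorem dil_diagonal (a : Fin 3 → ℝ) (ha : ∀ i, a i ≠ 0) (b : Fin 3 → ℝ) :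
    dil a ha (diagonal b : Herm3 A) = diagonal (a ^ 2 * b) := by
  ext i <;> simp

end Cyc

theorem traceForm_dil {A : Type*} [NormedAddCommGroup A] [InnerProductSpace ℝ A] (a : Fin 3 → ℝ)
    (ha : ∀ i, a i ≠ 0) (X Y : Herm3 A) :
    traceForm (dil a ha X) Y = traceForm X (dil a ha Y) := by
  simp only [traceForm_apply, dil_diag, dil_off, real_inner_smul_left, real_inner_smul_right]
  congr! 1
  ring

variable {A : Type*} [NormedAddCommGroup A] [InnerProductSpace ℝ A] [SymmetricComposition A]

theorem det_cyc (X : Herm3 A) : det (cyc X) = det X := by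
  simp only [det, cyc_diag, cyc_off, Fin.prod_univ_three, Fin.sum_univ_three, Fin.isValue,
    Fin.reduceAdd, zero_add]
  rw [← inner_mul_rotate]
  ring

theorem det_dil (a : Fin 3 → ℝ) (ha : ∀ i, a i ≠ 0) (X : Herm3 A) :
    det (dil a ha X) = (∏ i, a i) ^ 2 * det X := by
  simp only [det, dil_diag, dil_off, norm_smul, map_smul, LinearMap.smul_apply,
    real_inner_smul_left, real_inner_smul_right, mul_pow, Real.norm_eq_abs, sq_abs,
    Fin.prod_univ_three, Fin.sum_univ_three, Fin.isValue, Fin.reduceAdd, zero_add]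
  ring

theorem adjugate_dil (a : Fin 3 → ℝ) (ha : ∀ i, a i ≠ 0) (X : Herm3 A) :
    adjugate (dil a ha X) = dil (fun i => a (i + 1) * a (i + 2))
      (fun i => mul_ne_zero (ha (i + 1)) (ha (i + 2))) (adjugate X) := by
  ext i
  · simp only [adjugate, dil_diag, dil_off, norm_smul, mul_pow, Real.norm_eq_abs, sq_abs]
    ring
  · fin_cases i <;>
    · simp only [adjugate, dil_diag, dil_off, map_smul, LinearMap.smul_apply, Fin.zero_eta,
        Fin.mk_one, Fin.reduceFinMk, Fin.isValue, Fin.reduceAdd, zero_add]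
      module

theorem RankOne.dil {N : Herm3 A} (h : RankOne N) (a : Fin 3 → ℝ) (ha : ∀ i, a i ≠ 0) :
    RankOne (dil a ha N) := by
  refine ⟨by rw [adjugate_dil, h.1, map_zero], ?_⟩
  rw [trace_apply]
  exact Finset.sum_nonneg fun i _ => mul_nonneg (sq_nonneg _) (h.diag_nonneg i)

section Rot

/-- Conjugation by the rotation with angle `(c, s)` and axis `u` in the last two coordinates. -/
def rotFun (u : A) (c s : ℝ) (X : Herm3 A) : Herm3 A where
  diag := ![X.diag 0,
    c ^ 2 * X.diag 1 + 2 * c * s * ⟪u, X.off 0⟫_ℝ + s ^ 2 * X.diag 2,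
    s ^ 2 * X.diag 1 - 2 * c * s * ⟪u, X.off 0⟫_ℝ + c ^ 2 * X.diag 2]
  off := ![X.off 0 + (c * s * (X.diag 2 - X.diag 1) - 2 * s ^ 2 * ⟪u, X.off 0⟫_ℝ) • u,
    c • X.off 1 - s • mul (X.off 2) u, c • X.off 2 + s • mul u (X.off 1)]

theorem rotFun_rotFun_neg {u : A} {c s : ℝ} (hu : ‖u‖ = 1) (h : c ^ 2 + s ^ 2 = 1)
    (X : Herm3 A) : rotFun u c s (rotFun u c (-s) X) = X := by
  ext i
  · fin_cases i
    · rfl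
    · simp only [rotFun, inner_add_right, real_inner_smul_right, real_inner_self_eq_norm_sq, hu,
        Fin.mk_one, Matrix.cons_val_one, Matrix.cons_val_zero, Matrix.cons_val]
      grind
    · simp only [rotFun, inner_add_right, real_inner_smul_right, real_inner_self_eq_norm_sq, hu,
        Fin.reduceFinMk, Matrix.cons_val_one, Matrix.cons_val_zero, Matrix.cons_val]
      grind
  · have split (v : A) : v = (c ^ 2 + s ^ 2) • v := by rw [h, one_smul]
    fin_cases i
    · simp only [rotFun, inner_add_right, real_inner_smul_right, real_inner_self_eq_norm_sq, hu,
        Fin.zero_eta, Matrix.cons_val_one, Matrix.cons_val_zero, Matrix.cons_val]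
      rw [add_assoc, ← add_smul, add_eq_left, smul_eq_zero]
      left
      grind
    · simp only [rotFun, map_add, map_sub, map_smul, LinearMap.add_apply, LinearMap.smul_apply,
        mul_mul_cancel_left, hu, Fin.mk_one, Matrix.cons_val_one, Matrix.cons_val]
      conv_rhs => rw [split (X.off 1)]
      module
    · simp only [rotFun, map_add, map_sub, map_smul, LinearMap.add_apply, LinearMap.smul_apply,
        mul_mul_cancel_right, hu, Fin.reduceFinMk, Matrix.cons_val_one, Matrix.cons_val]
      conv_rhs => rw [split (X.off 2)]
      module

/-- `rotFun` as a linear automorphism. -/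
def rot (u : A) (c s : ℝ) (hu : ‖u‖ = 1) (h : c ^ 2 + s ^ 2 = 1) : Herm3 A ≃ₗ[ℝ] Herm3 A where
  toFun := rotFun u c s
  map_add' X Y := by
    ext i
    · fin_cases i <;> simp [rotFun, inner_add_right] <;> ring
    · fin_cases i <;> simp [rotFun, inner_add_right] <;> module
  map_smul' r X := by
    ext i
    · fin_cases i <;> simp [rotFun, real_inner_smul_right] <;> ring
    · fin_cases i <;> simp [rotFun, real_inner_smul_right] <;> module
  invFun := rotFun u c (-s)
  left_inv X := by
    simpa only [neg_neg] using rotFun_rotFun_neg (s := -s) hu (by rwa [neg_sq]) X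
  right_inv X := rotFun_rotFun_neg hu h X

theorem rot_apply (u : A) (c s : ℝ) (hu : ‖u‖ = 1) (h : c ^ 2 + s ^ 2 = 1) (X : Herm3 A) :
    rot u c s hu h X = rotFun u c s X := rfl

theorem det_rot (u : A) (c s : ℝ) (hu : ‖u‖ = 1) (h : c ^ 2 + s ^ 2 = 1) (X : Herm3 A) :
    det (rot u c s hu h X) = det X := by
  have e1 : ⟪X.off 1, mul (X.off 2) u⟫_ℝ = ⟪mul u (X.off 1), X.off 2⟫_ℝ := by
    rw [real_inner_comm, inner_mul_rotate]
  have e2 : ⟪mul (X.off 0) (mul (X.off 2) u), X.off 2⟫_ℝ = ‖X.off 2‖ ^ 2 * ⟪u, X.off 0⟫_ℝ := by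
    rw [inner_mul_rotate, mul_mul_cancel_left, real_inner_smul_left]
  have e3 : ⟪mul u (mul (X.off 2) u), X.off 2⟫_ℝ = ‖X.off 2‖ ^ 2 := by
    rw [inner_mul_rotate, mul_mul_cancel_left, real_inner_smul_left, real_inner_self_eq_norm_sq, hu]
    ring
  rw [rot_apply]
  simp only [det, rotFun, Matrix.cons_val_zero, Matrix.cons_val_one, Matrix.cons_val,
    norm_add_sq_real, norm_sub_sq_real, map_add, map_sub, map_smul, LinearMap.add_apply,
    LinearMap.smul_apply, inner_add_left, inner_add_right, inner_sub_left, real_inner_smul_left,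
    real_inner_smul_right, norm_smul, mul_pow, Real.norm_eq_abs, sq_abs, norm_mul_sq, hu,
    inner_mul_mul_right, inner_mul_mul_mul, e1, e2, e3, real_inner_self_eq_norm_sq,
    real_inner_comm u (X.off 0), real_inner_comm (mul u (X.off 1)) (X.off 2),
    Fin.prod_univ_three, Fin.sum_univ_three]
  grind

end Rot
end Herm3

/-! ## The order and the spectral theorem -/

namespace Herm3

section Groups

variable (A : Type*) [NormedAddCommGroup A] [InnerProductSpace ℝ A] [SymmetricComposition A]

/-- The linear automorphisms that preserve the determinant: `SL₃(H)/{±1}`, respectively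
`E₆₍₋₂₆₎`. -/
def detGroup : Subgroup (Herm3 A ≃ₗ[ℝ] Herm3 A) where
  carrier := {g | ∀ X, det (g X) = det X}
  mul_mem' hg hh X := (hg _).trans (hh X)
  one_mem' _ := rfl
  inv_mem' {g} hg X := by
    rw [← hg (g⁻¹ X)]
    exact congrArg det (g.apply_symm_apply X)

/-- The isotropy group of the identity matrix in `detGroup`, a compact group: `SU₃(H)/{±1}`,
respectively `F₄₍₋₅₂₎`. -/
def unitGroup : Subgroup (Herm3 A ≃ₗ[ℝ] Herm3 A) :=
  detGroup A ⊓ MulAction.stabilizer _ (diagonal 1 : Herm3 A)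

/-- The group generated by the rotations and the cyclic permutation of the coordinates. -/
def rotGroup : Subgroup (Herm3 A ≃ₗ[ℝ] Herm3 A) :=
  Subgroup.closure ({cyc} ∪ {g | ∃ u c s hu h, g = rot u c s hu h})

variable {A}

theorem cyc_mem_rotGroup : (cyc : Herm3 A ≃ₗ[ℝ] Herm3 A) ∈ rotGroup A :=
  Subgroup.subset_closure (Or.inl rfl)

theorem rot_mem_rotGroup (u : A) (c s : ℝ) (hu : ‖u‖ = 1) (h : c ^ 2 + s ^ 2 = 1) :
    rot u c s hu h ∈ rotGroup A :=
  Subgroup.subset_closure (Or.inr ⟨u, c, s, hu, h, rfl⟩)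

theorem rot_diagonal {b : Fin 3 → ℝ} (hb : b 1 = b 2) (u : A) (c s : ℝ) (hu : ‖u‖ = 1)
    (h : c ^ 2 + s ^ 2 = 1) : rot u c s hu h (diagonal b) = diagonal b := by
  have h' : s ^ 2 + c ^ 2 = 1 := by rwa [add_comm]
  ext i <;> fin_cases i <;> simp [rot_apply, rotFun, hb, ← add_mul, h, h']

theorem rotGroup_le_unitGroup : rotGroup A ≤ unitGroup A := by
  rw [rotGroup, Subgroup.closure_le]
  rintro g (rfl | ⟨u, c, s, hu, h, rfl⟩)
  · exact ⟨det_cyc, cyc_diagonal 1⟩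
  · exact ⟨det_rot u c s hu h, rot_diagonal rfl u c s hu h⟩

variable {g : Herm3 A ≃ₗ[ℝ] Herm3 A}

theorem map_one_of_mem_unitGroup (hg : g ∈ unitGroup A) : g (diagonal 1) = diagonal 1 := hg.2

theorem trace_map (hg : g ∈ unitGroup A) (X : Herm3 A) : trace (g X) = trace X := by
  have h := det_add_one_add_det_sub_one (g X)
  rw [← map_one_of_mem_unitGroup hg, ← map_add, ← map_sub, hg.1, hg.1, hg.1,
    det_add_one_add_det_sub_one] at h
  linarith

theorem trace_adjugate_map (hg : g ∈ unitGroup A) (X : Herm3 A) :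
    trace (adjugate (g X)) = trace (adjugate X) := by
  have h := det_one_add_add_det_one_sub (g X)
  rw [← map_one_of_mem_unitGroup hg, ← map_add, ← map_sub, hg.1, hg.1,
    det_one_add_add_det_one_sub] at h
  linarith

theorem traceForm_map_map (hg : g ∈ unitGroup A) (X Y : Herm3 A) :
    traceForm (g X) (g Y) = traceForm X Y := by
  have self (Z : Herm3 A) : traceForm (g Z) (g Z) = traceForm Z Z := by
    rw [traceForm_self, traceForm_self, trace_map hg, trace_adjugate_map hg]
  have h := self (X + Y)
  simp only [map_add, LinearMap.add_apply, self] at h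
  linarith [traceForm_comm X Y, traceForm_comm (g X) (g Y)]

theorem adjugate_map (hg : g ∈ unitGroup A) (X : Herm3 A) :
    adjugate (g X) = g (adjugate X) := by
  have pairing (Y : Herm3 A) : traceForm (g Y) (adjugate (g X) - g (adjugate X)) = 0 := by
    have h := det_add_add_det_sub (g Y) (g X)
    rw [← map_add, ← map_sub, hg.1, hg.1, hg.1, det_add_add_det_sub] at h
    rw [map_sub, traceForm_map_map hg]
    linarith
  obtain ⟨Y, hY⟩ := g.surjective (adjugate (g X) - g (adjugate X))
  rw [← sub_eq_zero]
  exact eq_zero_of_traceForm_self_eq_zero (hY ▸ pairing Y)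

theorem RankOne.map {N : Herm3 A} (h : RankOne N) (hg : g ∈ unitGroup A) : RankOne (g N) :=
  ⟨by rw [adjugate_map hg, h.1, map_zero], by rw [trace_map hg]; exact h.2⟩

end Groups

section Order

variable {A : Type*} [NormedAddCommGroup A] [InnerProductSpace ℝ A] [SymmetricComposition A]

/-- The order of the cone dual to the rank one elements, which is the cone of positive
semidefinite matrices. -/
instance : Preorder (Herm3 A) where
  le X Y := ∀ N, RankOne N → traceForm X N ≤ traceForm Y N
  le_refl _ _ _ := le_rfl
  le_trans _ _ _ h h' N hN := (h N hN).trans (h' N hN)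

theorem le_def {X Y : Herm3 A} : X ≤ Y ↔ ∀ N, RankOne N → traceForm X N ≤ traceForm Y N := Iff.rfl

theorem nonneg_iff {X : Herm3 A} : 0 ≤ X ↔ ∀ N, RankOne N → 0 ≤ traceForm X N := by
  simp [le_def]

instance : IsOrderedAddMonoid (Herm3 A) where
  add_le_add_left X Y h Z N hN := by
    simpa only [map_add, LinearMap.add_apply, add_le_add_iff_right] using h N hN

instance : PosSMulMono ℝ (Herm3 A) where
  smul_le_smul_of_nonneg_left c hc X Y h N hN := by
    simpa only [map_smul, LinearMap.smul_apply] using smul_le_smul_of_nonneg_left (h N hN) hc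

instance : SMulPosMono ℝ (Herm3 A) where
  smul_le_smul_of_nonneg_right X hX c d h := by
    rw [← sub_nonneg, ← sub_smul]
    exact smul_nonneg (sub_nonneg.2 h) hX

instance : PosSMulReflectLE ℝ (Herm3 A) where
  le_of_smul_le_smul_left c hc X Y h := by
    simpa only [inv_smul_smul₀ hc.ne'] using smul_le_smul_of_nonneg_left h (inv_nonneg.2 hc.le)

theorem diag_le_diag {X Y : Herm3 A} (h : X ≤ Y) (i : Fin 3) : X.diag i ≤ Y.diag i := by
  simpa only [traceForm_single_right] using h _ (rankOne_single i)

theorem diag_nonneg {X : Herm3 A} (h : 0 ≤ X) (i : Fin 3) : 0 ≤ X.diag i := diag_le_diag h i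

theorem diagonal_le_diagonal_iff {b c : Fin 3 → ℝ} :
    (diagonal b : Herm3 A) ≤ diagonal c ↔ b ≤ c := by
  refine ⟨fun h i => diag_le_diag h i, fun h N hN => ?_⟩
  rw [traceForm_diagonal_left, traceForm_diagonal_left]
  exact Finset.sum_le_sum fun i _ => mul_le_mul_of_nonneg_right (h i) (hN.diag_nonneg i)

theorem norm_off_sq_le {X : Herm3 A} (h : 0 ≤ X) (i : Fin 3) :
    ‖X.off i‖ ^ 2 ≤ X.diag (i + 1) * X.diag (i + 2) := by
  obtain hX | hX := eq_or_ne (X.off i) 0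
  · simpa [hX] using mul_nonneg (diag_nonneg h (i + 1)) (diag_nonneg h (i + 2))
  have block (t : ℝ) : 0 ≤ X.diag (i + 2) * ‖X.off i‖ ^ 2 * (t * t) + 2 * ‖X.off i‖ ^ 2 * t +
      X.diag (i + 1) := by
    have := nonneg_iff.1 h _ (rankOne_rankOneBlock i (t • X.off i))
    rw [traceForm_rankOneBlock, norm_smul, mul_pow, Real.norm_eq_abs, sq_abs,
      real_inner_smul_right, real_inner_self_eq_norm_sq] at this
    linarith
  have hd := discrim_le_zero block
  rw [discrim] at hd
  refine le_of_mul_le_mul_right ?_ (by positivity : 0 < ‖X.off i‖ ^ 2)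
  linarith

variable (A) in
/-- The linear automorphisms of the order. -/
def orderGroup : Subgroup (Herm3 A ≃ₗ[ℝ] Herm3 A) where
  carrier := {g | ∀ X Y, g X ≤ g Y ↔ X ≤ Y}
  mul_mem' hg hh X Y := (hg _ _).trans (hh X Y)
  one_mem' _ _ := Iff.rfl
  inv_mem' {g} hg X Y := by
    rw [← hg]
    exact iff_of_eq (congrArg₂ _ (g.apply_symm_apply X) (g.apply_symm_apply Y))

theorem mem_orderGroup_of_monotone {g : Herm3 A ≃ₗ[ℝ] Herm3 A} (h : Monotone g)
    (h' : Monotone ⇑g⁻¹) : g ∈ orderGroup A :=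
  fun X Y => ⟨fun hXY => by simpa using h' hXY, fun hXY => h hXY⟩

theorem unitGroup_le_orderGroup : unitGroup A ≤ orderGroup A := by
  have mono {g : Herm3 A ≃ₗ[ℝ] Herm3 A} (hg : g ∈ unitGroup A) : Monotone g := by
    intro X Y h N hN
    rw [← g.apply_symm_apply N, traceForm_map_map hg, traceForm_map_map hg]
    exact h _ (hN.map (inv_mem hg))
  exact fun g hg => mem_orderGroup_of_monotone (mono hg) (mono (inv_mem hg))

theorem dil_mem_orderGroup (a : Fin 3 → ℝ) (ha : ∀ i, a i ≠ 0) : dil a ha ∈ orderGroup A := by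
  have mono (a : Fin 3 → ℝ) (ha : ∀ i, a i ≠ 0) : Monotone (dil a ha : Herm3 A → Herm3 A) := by
    intro X Y h N hN
    rw [traceForm_dil, traceForm_dil]
    exact h _ (hN.dil a ha)
  exact mem_orderGroup_of_monotone (mono a ha) (dil_inv (A := A) a ha ▸ mono _ _)

end Order

section Spectral

theorem exists_eq_norm_smul {A : Type*} [NormedAddCommGroup A] [NormedSpace ℝ A] [Nontrivial A]
    (x : A) : ∃ u : A, ‖u‖ = 1 ∧ x = ‖x‖ • u := by
  obtain rfl | hx := eq_or_ne x 0
  · obtain ⟨u, hu⟩ := exists_norm_eq A zero_le_one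
    exact ⟨u, hu, by simp⟩
  · exact ⟨‖x‖⁻¹ • x, by simp [norm_smul, hx], by simp [smul_smul, hx]⟩

/-- With `d` half the difference of the diagonal entries of a symmetric `2 × 2` matrix and `r` its
other entry, `(c, s)` is the rotation that diagonalizes it. -/
theorem exists_rotation_angle (r d : ℝ) :
    ∃ c s : ℝ, c ^ 2 + s ^ 2 = 1 ∧ r * (c ^ 2 - s ^ 2) + 2 * c * s * d = 0 ∧
      0 ≤ 2 * c * s * r - (c ^ 2 - s ^ 2) * d := by
  set R := ‖(⟨-d, r⟩ : ℂ)‖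
  set φ := Complex.arg ⟨-d, r⟩
  have hd : R * Real.cos φ = -d := Complex.norm_mul_cos_arg _
  have hr : R * Real.sin φ = r := Complex.norm_mul_sin_arg _
  have cos_half : Real.cos (φ / 2) ^ 2 - Real.sin (φ / 2) ^ 2 = Real.cos φ := by
    rw [← Real.cos_two_mul', mul_div_cancel₀ _ two_ne_zero]
  have sin_half : 2 * Real.cos (φ / 2) * Real.sin (φ / 2) = Real.sin φ := by
    rw [mul_right_comm, ← Real.sin_two_mul, mul_div_cancel₀ _ two_ne_zero]
  refine ⟨Real.cos (φ / 2), Real.sin (φ / 2), Real.cos_sq_add_sin_sq _, ?_, ?_⟩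
  · rw [cos_half, sin_half]
    linear_combination -Real.cos φ * hr + Real.sin φ * hd
  · have key : Real.sin φ * r - Real.cos φ * d = R := by
      linear_combination -Real.sin φ * hr - Real.cos φ * hd + R * Real.sin_sq_add_cos_sq φ
    rw [cos_half, sin_half, key]
    exact norm_nonneg _

variable {A : Type*} [NormedAddCommGroup A] [InnerProductSpace ℝ A] [SymmetricComposition A]

theorem exists_rot_off_zero_eq_zero [Nontrivial A] (X : Herm3 A) :
    ∃ (u : A) (c s : ℝ) (hu : ‖u‖ = 1) (h : c ^ 2 + s ^ 2 = 1),
      (rot u c s hu h X).off 0 = 0 ∧ (rot u c s hu h X).diag 2 ≤ (rot u c s hu h X).diag 1 := by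
  obtain ⟨u, hu, hx⟩ := exists_eq_norm_smul (X.off 0)
  obtain ⟨c, s, h, h1, h2⟩ := exists_rotation_angle ‖X.off 0‖ ((X.diag 2 - X.diag 1) / 2)
  have hp : ⟪u, X.off 0⟫_ℝ = ‖X.off 0‖ := by
    conv_lhs => rw [hx, real_inner_smul_right, real_inner_self_eq_norm_sq, hu]
    ring
  refine ⟨u, c, s, hu, h, ?_, ?_⟩
  · simp only [rot_apply, rotFun, hp, Matrix.cons_val_zero]
    nth_rewrite 1 [hx]
    rw [← add_smul, smul_eq_zero]
    left
    linear_combination h1 - ‖X.off 0‖ * h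
  · simp only [rot_apply, rotFun, hp, Matrix.cons_val_one, Matrix.cons_val]
    linarith

theorem rot_off_one_eq_zero {X : Herm3 A} (h1 : X.off 1 = 0) (h2 : X.off 2 = 0) (u : A) (c s : ℝ)
    (hu : ‖u‖ = 1) (h : c ^ 2 + s ^ 2 = 1) : (rot u c s hu h X).off 1 = 0 := by
  simp [rot_apply, rotFun, h1, h2]

theorem rot_off_two_eq_zero {X : Herm3 A} (h1 : X.off 1 = 0) (h2 : X.off 2 = 0) (u : A) (c s : ℝ)
    (hu : ‖u‖ = 1) (h : c ^ 2 + s ^ 2 = 1) : (rot u c s hu h X).off 2 = 0 := by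
  simp [rot_apply, rotFun, h1, h2]

theorem rot_diag_zero (u : A) (c s : ℝ) (hu : ‖u‖ = 1) (h : c ^ 2 + s ^ 2 = 1) (X : Herm3 A) :
    (rot u c s hu h X).diag 0 = X.diag 0 := rfl

theorem RankOne.exists_rot_diag_two_eq_zero [Nontrivial A] {N : Herm3 A} (hN : RankOne N) :
    ∃ k ∈ rotGroup A, (k N).diag 0 = N.diag 0 ∧ (k N).diag 2 = 0 := by
  obtain ⟨u, c, s, hu, h, hoff, hle⟩ := exists_rot_off_zero_eq_zero N
  have hk := rot_mem_rotGroup u c s hu h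
  have hkN := hN.map (rotGroup_le_unitGroup hk)
  have minor := hkN.diag_mul_diag 0
  simp only [hoff, norm_zero, Fin.isValue, zero_add] at minor
  exact ⟨_, hk, rfl, by nlinarith [hkN.diag_nonneg 2]⟩

theorem RankOne.eq_diagonal_single {N : Herm3 A} (hN : RankOne N) (h1 : N.diag 1 = 0)
    (h2 : N.diag 2 = 0) : N = diagonal (Pi.single 0 (trace N)) := by
  have off (i : Fin 3) : N.off i = 0 := by
    have minor := hN.diag_mul_diag i
    fin_cases i <;> simpa [h1, h2, eq_comm (a := (0 : ℝ))] using minor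
  ext i
  · fin_cases i <;> simp [h1, h2, trace_apply, Fin.sum_univ_three]
  · exact off i

theorem RankOne.exists_map_eq_diagonal_single [Nontrivial A] {N : Herm3 A} (hN : RankOne N) :
    ∃ k ∈ rotGroup A, k N = diagonal (Pi.single 0 (trace N)) := by
  have hc := cyc_mem_rotGroup (A := A)
  obtain ⟨k, hk, -, hk2⟩ := hN.exists_rot_diag_two_eq_zero
  obtain ⟨k', hk', hk0', hk2'⟩ := (hN.map
    (rotGroup_le_unitGroup (mul_mem hc (mul_mem hc hk)))).exists_rot_diag_two_eq_zero
  have mem : cyc * (k' * (cyc * (cyc * k))) ∈ rotGroup A :=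
    mul_mem hc (mul_mem hk' (mul_mem hc (mul_mem hc hk)))
  refine ⟨_, mem, ?_⟩
  rw [← trace_map (rotGroup_le_unitGroup mem) N]
  exact (hN.map (rotGroup_le_unitGroup mem)).eq_diagonal_single hk2' (hk0'.trans hk2)

theorem continuous_mul : Continuous fun p : A × A => mul p.1 p.2 :=
  (LinearMap.mkContinuous₂ (mul : A →ₗ[ℝ] A →ₗ[ℝ] A) 1 fun x y => by
    rw [one_mul]
    exact le_of_sq_le_sq (by rw [norm_mul_sq, mul_pow]) (by positivity)).continuous₂

theorem isClosed_rankOne :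
    IsClosed {p : (Fin 3 → ℝ) × (Fin 3 → A) | RankOne (⟨p.1, p.2⟩ : Herm3 A)} := by
  have hmul (i j : Fin 3) : Continuous fun p : (Fin 3 → ℝ) × (Fin 3 → A) => mul (p.2 i) (p.2 j) :=
    continuous_mul.comp (f := fun p : (Fin 3 → ℝ) × (Fin 3 → A) => (p.2 i, p.2 j)) (by fun_prop)
  simp only [RankOne, adjugate_eq_zero_iff, trace_apply, Set.ofPred_and, Set.ofPred_forall]
  refine IsClosed.inter (IsClosed.inter ?_ ?_) (isClosed_le (by fun_prop) (by fun_prop))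
  · exact isClosed_iInter fun i => isClosed_eq (by fun_prop) (by fun_prop)
  · exact isClosed_iInter fun i => isClosed_eq (hmul _ _) (by fun_prop)

theorem RankOne.norm_off_le {N : Herm3 A} (hN : RankOne N) (i : Fin 3) : ‖N.off i‖ ≤ trace N := by
  refine le_of_sq_le_sq ?_ hN.2
  have sq_trace : traceForm N N = trace N ^ 2 := by rw [traceForm_self, hN.1]; simp
  rw [← sq_trace, traceForm_apply]
  refine le_trans ?_ (Finset.single_le_sum (fun j _ => ?_) (Finset.mem_univ i))
  · rw [real_inner_self_eq_norm_sq]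
    linarith [mul_self_nonneg (N.diag i), sq_nonneg ‖N.off i‖]
  · exact add_nonneg (mul_self_nonneg _) (mul_nonneg zero_le_two real_inner_self_nonneg)

theorem isCompact_rankOne [FiniteDimensional ℝ A] :
    IsCompact {p : (Fin 3 → ℝ) × (Fin 3 → A) |
      RankOne (⟨p.1, p.2⟩ : Herm3 A) ∧ trace (⟨p.1, p.2⟩ : Herm3 A) = 1} := by
  refine Metric.isCompact_of_isClosed_isBounded ?_ ?_
  · exact isClosed_rankOne.inter (isClosed_eq (by simp only [trace_apply]; fun_prop)
      continuous_const)
  · refine (Metric.isBounded_closedBall (x := 0) (r := 1)).subset ?_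
    rintro ⟨d, o⟩ ⟨hN, tr⟩
    rw [mem_closedBall_zero_iff, Prod.norm_def, max_le_iff, pi_norm_le_iff_of_nonneg zero_le_one,
      pi_norm_le_iff_of_nonneg zero_le_one]
    refine ⟨fun i => ?_, fun i => tr ▸ hN.norm_off_le i⟩
    rw [Real.norm_of_nonneg (hN.diag_nonneg i), ← tr]
    exact Finset.single_le_sum (fun j _ => hN.diag_nonneg j) (Finset.mem_univ i)

variable [Nontrivial A] [FiniteDimensional ℝ A]

/-- The rank one element of trace one at which the trace form against `M` is maximal is moved to
the first diagonal idempotent. -/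
theorem exists_map_le_smul_one (M : Herm3 A) :
    ∃ k ∈ rotGroup A, k M ≤ (k M).diag 0 • diagonal 1 := by
  obtain ⟨⟨d, o⟩, ⟨hN, h1⟩, hmax⟩ := isCompact_rankOne (A := A).exists_isMaxOn
    ⟨⟨Pi.single 0 1, 0⟩, rankOne_single 0, by simp [trace_apply]⟩
    (f := fun p => traceForm M ⟨p.1, p.2⟩) (by simp only [traceForm_apply]; fun_prop)
  obtain ⟨k, hk, hkN⟩ := hN.exists_map_eq_diagonal_single
  have hku := rotGroup_le_unitGroup hk
  have max_eq : traceForm M ⟨d, o⟩ = (k M).diag 0 := by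
    rw [← traceForm_map_map hku, hkN, h1, traceForm_single_right]
  refine ⟨k, hk, fun N' hN' => ?_⟩
  rw [map_smul, LinearMap.smul_apply, traceForm_one_left, smul_eq_mul]
  obtain h0 | hpos := hN'.2.eq_or_lt
  · have : N' = 0 := eq_zero_of_traceForm_self_eq_zero (by rw [traceForm_self, ← h0, hN'.1]; simp)
    simp [this]
  have le_max (P : Herm3 A) (hP : RankOne P) (tr : trace P = 1) :
      traceForm (k M) P ≤ (k M).diag 0 := by
    rw [← max_eq, ← k.apply_symm_apply P, traceForm_map_map hku]
    exact hmax (show ((k.symm P).diag, (k.symm P).off) ∈ _ from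
      ⟨hP.map (inv_mem hku), (trace_map (inv_mem hku) P).trans tr⟩)
  have := le_max ((trace N')⁻¹ • N') (hN'.smul (inv_nonneg.2 hN'.2)) (by simp [hpos.ne'])
  rwa [map_smul, smul_eq_mul, inv_mul_le_iff₀ hpos, mul_comm] at this

theorem exists_map_eq_diagonal (M : Herm3 A) :
    ∃ k ∈ rotGroup A, ∃ b : Fin 3 → ℝ, b 1 ≤ b 0 ∧ b 2 ≤ b 1 ∧ k M = diagonal b := by
  obtain ⟨k, hk, hle⟩ := exists_map_le_smul_one M
  have minor := norm_off_sq_le (sub_nonneg.2 hle)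
  have off1 : (k M).off 1 = 0 := by simpa using minor 1
  have off2 : (k M).off 2 = 0 := by simpa using minor 2
  obtain ⟨u, c, s, hu, h, off0, h21⟩ := exists_rot_off_zero_eq_zero (k M)
  have hrot := rot_mem_rotGroup u c s hu h
  have hle' := (unitGroup_le_orderGroup (rotGroup_le_unitGroup hrot) _ _).2 hle
  rw [map_smul, map_one_of_mem_unitGroup (rotGroup_le_unitGroup hrot)] at hle'
  refine ⟨_, mul_mem hrot hk, (rot u c s hu h (k M)).diag, ?_, h21, ?_⟩
  · simpa [rot_diag_zero] using diag_le_diag hle' 1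
  · ext i
    · rfl
    · fin_cases i
      exacts [off0, rot_off_one_eq_zero off1 off2 u c s hu h,
        rot_off_two_eq_zero off1 off2 u c s hu h]

end Spectral

end Herm3

namespace Herm3

section Block

variable {A : Type*} [AddCommGroup A]

/-- The upper left entry, as a matrix. -/
def corner (X : Herm3 A) : Herm3 A := diagonal (Pi.single 0 (X.diag 0))

/-- The lower right `2 × 2` block, as a matrix. -/
def block (X : Herm3 A) : Herm3 A := ⟨![0, X.diag 1, X.diag 2], ![X.off 0, 0, 0]⟩

theorem block_diagonal (b : Fin 3 → ℝ) :
    block (diagonal b : Herm3 A) = diagonal ![0, b 1, b 2] := by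
  ext i <;> fin_cases i <;> simp [block]

theorem block_zero : block (0 : Herm3 A) = 0 := by
  ext i <;> fin_cases i <;> simp [block]

end Block

theorem traceForm_block {A : Type*} [NormedAddCommGroup A] [InnerProductSpace ℝ A]
    (X Y : Herm3 A) : traceForm (block X) Y = traceForm X (block Y) := by
  simp [traceForm_apply, block, Fin.sum_univ_three]

section Pinching

variable {A : Type*} [NormedAddCommGroup A] [InnerProductSpace ℝ A] [SymmetricComposition A]

theorem map_le_one_iff {g : Herm3 A ≃ₗ[ℝ] Herm3 A} (hg : g ∈ unitGroup A) {X : Herm3 A} {c : ℝ} :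
    g X ≤ c • diagonal 1 ↔ X ≤ c • diagonal 1 := by
  rw [← unitGroup_le_orderGroup hg X, map_smul, map_one_of_mem_unitGroup hg]

theorem one_le_map_iff {g : Herm3 A ≃ₗ[ℝ] Herm3 A} (hg : g ∈ unitGroup A) {X : Herm3 A} {c : ℝ} :
    c • diagonal 1 ≤ g X ↔ c • diagonal 1 ≤ X := by
  rw [← unitGroup_le_orderGroup hg _ X, map_smul, map_one_of_mem_unitGroup hg]

theorem map_nonneg_iff {g : Herm3 A ≃ₗ[ℝ] Herm3 A} (hg : g ∈ orderGroup A) {X : Herm3 A} :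
    0 ≤ g X ↔ 0 ≤ X := by
  rw [← hg 0 X, map_zero]

theorem diagonal_nonneg_iff {b : Fin 3 → ℝ} : 0 ≤ (diagonal b : Herm3 A) ↔ 0 ≤ b :=
  diagonal_le_diagonal_iff (b := 0)

theorem diagonal_le_smul_one_iff {b : Fin 3 → ℝ} {c : ℝ} :
    (diagonal b : Herm3 A) ≤ c • diagonal 1 ↔ ∀ i, b i ≤ c := by
  simp [smul_diagonal, diagonal_le_diagonal_iff, Pi.le_def]

theorem smul_one_le_diagonal_iff {b : Fin 3 → ℝ} {c : ℝ} :
    c • diagonal 1 ≤ (diagonal b : Herm3 A) ↔ ∀ i, c ≤ b i := by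
  simp [smul_diagonal, diagonal_le_diagonal_iff, Pi.le_def]

theorem RankOne.block {N : Herm3 A} (h : RankOne N) : RankOne (block N) := by
  have minor := h.diag_mul_diag 0
  refine ⟨adjugate_eq_zero_iff.2 ⟨fun i => ?_, fun i => ?_⟩, ?_⟩
  · fin_cases i
    · simpa [Herm3.block] using minor
    · simp [Herm3.block]
    · simp [Herm3.block]
  · fin_cases i <;> simp [Herm3.block]
  · simpa [trace_apply, Herm3.block, Fin.sum_univ_three] using
      add_nonneg (h.diag_nonneg 1) (h.diag_nonneg 2)

theorem block_mono {X Y : Herm3 A} (h : X ≤ Y) : block X ≤ block Y := by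
  intro N hN
  rw [traceForm_block, traceForm_block]
  exact h _ hN.block

theorem block_nonneg {X : Herm3 A} (h : 0 ≤ X) : 0 ≤ block X :=
  block_zero (A := A) ▸ block_mono h

theorem dil_nonneg {X : Herm3 A} (h : 0 ≤ X) (a : Fin 3 → ℝ) (ha : ∀ i, a i ≠ 0) :
    0 ≤ dil a ha X :=
  (map_nonneg_iff (dil_mem_orderGroup a ha)).2 h

theorem block_le {X : Herm3 A} (h : 0 ≤ X) : block X ≤ (2 : ℝ) • (X + corner X) := by
  rw [← sub_nonneg]
  convert dil_nonneg h ![2, 1, 1] (by simp [Fin.forall_fin_succ]) using 1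
  ext i
  · fin_cases i <;> simp [block, corner] <;> ring
  · fin_cases i <;> simp [block, corner]; module

theorem corner_le {X : Herm3 A} (h : 0 ≤ X) : corner X ≤ (2 : ℝ) • (X + block X) := by
  rw [← sub_nonneg]
  convert dil_nonneg h ![1, 2, 2] (by simp [Fin.forall_fin_succ]) using 1
  ext i
  · fin_cases i <;> simp [block, corner, Matrix.vecHead, Matrix.vecTail] <;> ring
  · fin_cases i <;> simp [block, corner, Matrix.vecHead, Matrix.vecTail]; module

theorem le_pinch {X : Herm3 A} (h : 0 ≤ X) : X ≤ (2 : ℝ) • (corner X + block X) := by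
  rw [← sub_nonneg]
  convert dil_nonneg h ![-1, 1, 1] (by simp [Fin.forall_fin_succ]) using 1
  ext i
  · fin_cases i <;> simp [block, corner, Matrix.vecHead, Matrix.vecTail] <;> ring
  · fin_cases i <;> simp [block, corner]; module

theorem inv_smul_block_le {X : Herm3 A} {C : ℝ} (hC : 1 < C) (h : C⁻¹ • corner X ≤ X) :
    C⁻¹ • block X ≤ X := by
  have pos : 0 < 1 - C⁻¹ := sub_pos.2 (inv_lt_one_of_one_lt₀ hC)
  have sq : √(1 - C⁻¹) ^ 2 = 1 - C⁻¹ := Real.sq_sqrt pos.le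
  have ne : √(1 - C⁻¹) ≠ 0 := (Real.sqrt_pos.2 pos).ne'
  rw [← sub_nonneg] at h ⊢
  convert dil_nonneg h ![(√(1 - C⁻¹))⁻¹, √(1 - C⁻¹), √(1 - C⁻¹)]
    (by simp [Fin.forall_fin_succ, ne]) using 1
  ext i
  · fin_cases i
    · have : (1 - C⁻¹)⁻¹ * (X.diag 0 - C⁻¹ * X.diag 0) = X.diag 0 := by
        rw [← one_sub_mul, inv_mul_cancel_left₀ pos.ne']
      simpa [block, corner, sq, mul_sub, mul_left_comm] using this.symm
    · simp [block, corner, sq, sub_mul]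
    · simp [block, corner, sq, sub_mul]
  · fin_cases i
    · simp [block, corner, ← pow_two, sq, sub_smul]
    · simp [block, corner, ne]
    · simp [block, corner, ne]

end Pinching

section PosDef

variable {A : Type*} [NormedAddCommGroup A] [InnerProductSpace ℝ A] [SymmetricComposition A]

/-- Positive definiteness. -/
def PosDef (X : Herm3 A) : Prop := ∃ ε : ℝ, 0 < ε ∧ ε • diagonal 1 ≤ X

theorem PosDef.diag_pos {X : Herm3 A} (h : PosDef X) (i : Fin 3) : 0 < X.diag i := by
  obtain ⟨ε, hε, h⟩ := h
  exact hε.trans_le (by simpa using diag_le_diag h i)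

theorem posDef_diagonal_iff {b : Fin 3 → ℝ} : PosDef (diagonal b : Herm3 A) ↔ ∀ i, 0 < b i := by
  refine ⟨PosDef.diag_pos, fun hb => ?_⟩
  obtain ⟨i, hi⟩ := Finite.exists_min b
  exact ⟨b i, hb i, smul_one_le_diagonal_iff.2 hi⟩

theorem posDef_one : PosDef (diagonal 1 : Herm3 A) := posDef_diagonal_iff.2 fun _ => one_pos

theorem PosDef.nonneg {X : Herm3 A} (h : PosDef X) : 0 ≤ X := by
  obtain ⟨ε, hε, h⟩ := h
  exact (smul_nonneg hε.le ((diagonal_nonneg_iff (A := A)).2 zero_le_one)).trans h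

theorem PosDef.mono {X Y : Herm3 A} (h : PosDef X) (h' : X ≤ Y) : PosDef Y :=
  h.imp fun _ ⟨hε, h⟩ => ⟨hε, h.trans h'⟩

theorem PosDef.smul {X : Herm3 A} (h : PosDef X) {c : ℝ} (hc : 0 < c) : PosDef (c • X) := by
  obtain ⟨ε, hε, h⟩ := h
  exact ⟨c * ε, mul_pos hc hε, by
    simpa only [mul_smul] using smul_le_smul_of_nonneg_left h hc.le⟩

theorem posDef_map_iff {g : Herm3 A ≃ₗ[ℝ] Herm3 A} (hg : g ∈ unitGroup A) {X : Herm3 A} :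
    PosDef (g X) ↔ PosDef X := by
  simp only [PosDef, one_le_map_iff hg]

variable (A) in
/-- The group generated by the rotations, the cyclic permutation and the conjugations by diagonal
matrices of determinant one. -/
def genGroup : Subgroup (Herm3 A ≃ₗ[ℝ] Herm3 A) :=
  rotGroup A ⊔ Subgroup.closure {g | ∃ a ha, ∏ i, a i = 1 ∧ g = dil a ha}

theorem rotGroup_le_genGroup : rotGroup A ≤ genGroup A := le_sup_left

theorem dil_mem_genGroup {a : Fin 3 → ℝ} (ha : ∀ i, a i ≠ 0) (h : ∏ i, a i = 1) :
    dil a ha ∈ genGroup A :=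
  SetLike.le_def.1 le_sup_right (Subgroup.subset_closure ⟨a, ha, h, rfl⟩)

theorem genGroup_le_orderGroup : genGroup A ≤ orderGroup A := by
  refine sup_le (rotGroup_le_unitGroup.trans unitGroup_le_orderGroup)
    ((Subgroup.closure_le _).2 ?_)
  rintro _ ⟨a, ha, -, rfl⟩
  exact dil_mem_orderGroup a ha

theorem genGroup_le_detGroup : genGroup A ≤ detGroup A := by
  refine sup_le (rotGroup_le_unitGroup.trans inf_le_left) ((Subgroup.closure_le _).2 ?_)
  rintro _ ⟨a, ha, h, rfl⟩ X
  rw [det_dil, h, one_pow, one_mul]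

variable [Nontrivial A] [FiniteDimensional ℝ A]

theorem RankOne.nonneg {N : Herm3 A} (h : RankOne N) : 0 ≤ N := by
  obtain ⟨k, hk, b, -, -, hb⟩ := exists_map_eq_diagonal N
  have hku := rotGroup_le_unitGroup hk
  rw [← map_nonneg_iff (unitGroup_le_orderGroup hku), hb, diagonal_nonneg_iff]
  exact (hb ▸ h.map hku).diag_nonneg

theorem traceForm_le_traceForm {X Y Z : Herm3 A} (h : X ≤ Y) (hZ : 0 ≤ Z) :
    traceForm X Z ≤ traceForm Y Z := by
  obtain ⟨k, hk, b, -, -, hb⟩ := exists_map_eq_diagonal Z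
  have hku := rotGroup_le_unitGroup hk
  have hko := unitGroup_le_orderGroup hku
  have b_nonneg : 0 ≤ b := by rwa [← map_nonneg_iff hko, hb, diagonal_nonneg_iff] at hZ
  rw [← traceForm_map_map hku X, ← traceForm_map_map hku Y, hb, traceForm_diagonal_right,
    traceForm_diagonal_right]
  have hXY := (hko X Y).2 h
  gcongr with i
  exacts [b_nonneg i, diag_le_diag hXY i]

theorem traceForm_nonneg {X Z : Herm3 A} (hX : 0 ≤ X) (hZ : 0 ≤ Z) : 0 ≤ traceForm X Z := by
  simpa using traceForm_le_traceForm hX hZ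

theorem le_trace_smul_one {X : Herm3 A} (h : 0 ≤ X) : X ≤ trace X • diagonal 1 := by
  obtain ⟨k, hk, b, -, -, hb⟩ := exists_map_eq_diagonal X
  have hku := rotGroup_le_unitGroup hk
  rw [← map_nonneg_iff (unitGroup_le_orderGroup hku), hb, diagonal_nonneg_iff] at h
  rw [← map_le_one_iff hku, ← trace_map hku, hb, diagonal_le_smul_one_iff]
  exact fun i => Finset.single_le_sum (f := b) (fun j _ => h j) (Finset.mem_univ i)

theorem posDef_of_det_ne_zero {X : Herm3 A} (h : 0 ≤ X) (hd : det X ≠ 0) : PosDef X := by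
  obtain ⟨k, hk, b, -, -, hb⟩ := exists_map_eq_diagonal X
  have hku := rotGroup_le_unitGroup hk
  rw [← map_nonneg_iff (unitGroup_le_orderGroup hku), hb, diagonal_nonneg_iff] at h
  rw [← hku.1, hb, det_diagonal, Finset.prod_ne_zero_iff] at hd
  rw [← posDef_map_iff hku, hb, posDef_diagonal_iff]
  exact fun i => (h i).lt_of_ne' (hd i (Finset.mem_univ i))

theorem PosDef.det_pos {P : Herm3 A} (h : PosDef P) : 0 < det P := by
  obtain ⟨k, hk, b, -, -, hb⟩ := exists_map_eq_diagonal P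
  have hku := rotGroup_le_unitGroup hk
  rw [← posDef_map_iff hku, hb, posDef_diagonal_iff] at h
  rw [← hku.1, hb, det_diagonal]
  exact Finset.prod_pos fun i _ => h i

theorem exists_map_eq_one {P : Herm3 A} (h : PosDef P) (h1 : det P = 1) :
    ∃ g ∈ genGroup A, g P = diagonal 1 := by
  obtain ⟨k, hk, b, -, -, hb⟩ := exists_map_eq_diagonal P
  have hku := rotGroup_le_unitGroup hk
  rw [← posDef_map_iff hku, hb, posDef_diagonal_iff] at h
  rw [← hku.1, hb, det_diagonal] at h1
  have ha (i : Fin 3) : (√(b i))⁻¹ ≠ 0 := inv_ne_zero (Real.sqrt_pos.2 (h i)).ne'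
  have prod_eq : ∏ i, (√(b i))⁻¹ = 1 := by
    rw [Finset.prod_inv_distrib, ← Real.sqrt_prod _ fun i _ => (h i).le, h1]
    simp
  refine ⟨dil _ ha * k, mul_mem (dil_mem_genGroup ha prod_eq) (rotGroup_le_genGroup hk), ?_⟩
  rw [LinearEquiv.mul_apply, hb, dil_diagonal]
  congr 1
  ext i
  simp [Real.sq_sqrt (h i).le, (h i).ne']

theorem exists_map_eq_one_diagonal {P : Herm3 A} (h : PosDef P) (h1 : det P = 1) (Q : Herm3 A) :
    ∃ g ∈ genGroup A, ∃ b : Fin 3 → ℝ, b 1 ≤ b 0 ∧ b 2 ≤ b 1 ∧ g P = diagonal 1 ∧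
      g Q = diagonal b := by
  obtain ⟨g, hg, hP⟩ := exists_map_eq_one h h1
  obtain ⟨k, hk, b, hb1, hb2, hb⟩ := exists_map_eq_diagonal (g Q)
  refine ⟨k * g, mul_mem (rotGroup_le_genGroup hk) hg, b, hb1, hb2, ?_, hb⟩
  rw [LinearEquiv.mul_apply, hP, map_one_of_mem_unitGroup (rotGroup_le_unitGroup hk)]

theorem PosDef.exists_det_smul_eq_one {P : Herm3 A} (h : PosDef P) :
    ∃ c : ℝ, 0 < c ∧ det (c • P) = 1 := by
  refine ⟨(det P) ^ (-(3 : ℝ)⁻¹), Real.rpow_pos_of_pos h.det_pos _, ?_⟩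
  have cube : (det P ^ (3 : ℝ)⁻¹) ^ 3 = det P := by
    exact_mod_cast Real.rpow_inv_natCast_pow h.det_pos.le three_ne_zero
  rw [det_smul, Real.rpow_neg h.det_pos.le, inv_pow, cube, inv_mul_cancel₀ h.det_pos.ne']

end PosDef

section Ratio

variable {A : Type*} [NormedAddCommGroup A] [InnerProductSpace ℝ A] [SymmetricComposition A]

/-- The least `c` with `Q ≤ c P`: the largest eigenvalue of `P⁻¹ Q`. -/
def ratio (P Q : Herm3 A) : ℝ := sInf {c | Q ≤ c • P}

theorem ratio_map {g : Herm3 A ≃ₗ[ℝ] Herm3 A} (hg : g ∈ orderGroup A) (P Q : Herm3 A) :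
    ratio (g P) (g Q) = ratio P Q := by
  simp only [ratio, ← map_smul, hg _ _]

variable [Nontrivial A] [FiniteDimensional ℝ A] {P Q R : Herm3 A}

theorem isLeast_ratio (hP : PosDef P) (Q : Herm3 A) : IsLeast {c | Q ≤ c • P} (ratio P Q) := by
  obtain ⟨c₀, hc₀, h1⟩ := hP.exists_det_smul_eq_one
  obtain ⟨g, hg, b, hb1, hb2, hgP, hgQ⟩ := exists_map_eq_one_diagonal (hP.smul hc₀) h1 Q
  have le_iff (c : ℝ) : Q ≤ c • P ↔ c₀ * b 0 ≤ c := by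
    rw [← div_mul_cancel₀ c hc₀.ne', mul_smul, ← genGroup_le_orderGroup hg, map_smul, hgP, hgQ,
      diagonal_le_smul_one_iff, mul_comm, mul_le_mul_iff_left₀ hc₀]
    refine ⟨fun h => h 0, fun h i => ?_⟩
    fin_cases i
    exacts [h, hb1.trans h, (hb2.trans hb1).trans h]
  have isLeast : IsLeast {c | Q ≤ c • P} (c₀ * b 0) := by
    simp only [le_iff]
    exact isLeast_Ici
  rwa [ratio, isLeast.csInf_eq]

theorem PosDef.le_ratio_smul (hP : PosDef P) (Q : Herm3 A) : Q ≤ ratio P Q • P :=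
  (isLeast_ratio hP Q).1

theorem PosDef.ratio_le (hP : PosDef P) {c : ℝ} (h : Q ≤ c • P) : ratio P Q ≤ c :=
  (isLeast_ratio hP Q).2 h

theorem ratio_le_iff (hP : PosDef P) {c : ℝ} : ratio P Q ≤ c ↔ Q ≤ c • P :=
  ⟨fun h => (hP.le_ratio_smul Q).trans (smul_le_smul_of_nonneg_right h hP.nonneg), hP.ratio_le⟩

theorem ratio_pos (hP : PosDef P) (hQ : PosDef Q) : 0 < ratio P Q :=
  pos_of_mul_pos_left ((hQ.diag_pos 0).trans_le (diag_le_diag (hP.le_ratio_smul Q) 0))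
    (hP.diag_pos 0).le

theorem ratio_triangle (hP : PosDef P) (hQ : PosDef Q) (hR : PosDef R) :
    ratio P R ≤ ratio P Q * ratio Q R := by
  refine hP.ratio_le ((hQ.le_ratio_smul R).trans ?_)
  rw [mul_comm, mul_smul]
  exact smul_le_smul_of_nonneg_left (hP.le_ratio_smul Q) (ratio_pos hQ hR).le

theorem ratio_smul_right (hP : PosDef P) (Q : Herm3 A) {c : ℝ} (hc : 0 < c) :
    ratio P (c • Q) = c * ratio P Q := by
  refine eq_of_forall_ge_iff fun t => ?_
  rw [ratio_le_iff hP, ← le_div_iff₀' hc, ratio_le_iff hP, div_eq_inv_mul, mul_smul,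
    le_inv_smul_iff_of_pos hc]

theorem ratio_smul_left (hP : PosDef P) (Q : Herm3 A) {c : ℝ} (hc : 0 < c) :
    ratio (c • P) Q = c⁻¹ * ratio P Q := by
  refine eq_of_forall_ge_iff fun t => ?_
  rw [ratio_le_iff (hP.smul hc), inv_mul_le_iff₀ hc, ratio_le_iff hP, smul_smul, mul_comm]

theorem ratio_diagonal {b c : Fin 3 → ℝ} (hb : ∀ i, 0 < b i) (i : Fin 3)
    (h : ∀ j, c j / b j ≤ c i / b i) :
    ratio (diagonal b : Herm3 A) (diagonal c) = c i / b i := by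
  refine eq_of_forall_ge_iff fun t => ?_
  rw [ratio_le_iff (posDef_diagonal_iff.2 hb), smul_diagonal, diagonal_le_diagonal_iff]
  exact ⟨fun ht => (div_le_iff₀ (hb i)).2 (ht i),
    fun ht j => (div_le_iff₀ (hb j)).1 ((h j).trans ht)⟩

theorem ratio_one_diagonal {b : Fin 3 → ℝ} (i : Fin 3) (h : ∀ j, b j ≤ b i) :
    ratio (diagonal 1 : Herm3 A) (diagonal b) = b i := by
  simpa using ratio_diagonal (A := A) (b := 1) (c := b) (fun _ => one_pos) i (by simpa using h)

theorem PosDef.exists_rankOne_traceForm_eq (hP : PosDef P) :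
    ∃ N : Herm3 A, RankOne N ∧ trace N = 1 ∧ traceForm P N = (ratio P (diagonal 1))⁻¹ := by
  obtain ⟨k, hk, b, hb1, hb2, hb⟩ := exists_map_eq_diagonal P
  have hku := rotGroup_le_unitGroup hk
  have b_pos : ∀ i, 0 < b i := by rwa [← posDef_map_iff hku, hb, posDef_diagonal_iff] at hP
  refine ⟨k⁻¹ (diagonal (Pi.single 2 1)), (rankOne_single 2).map (inv_mem hku), ?_, ?_⟩
  · rw [trace_map (inv_mem hku), trace_apply]
    simp
  have k_apply : k (k⁻¹ (diagonal (Pi.single 2 1))) = diagonal (Pi.single 2 1) :=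
    k.apply_symm_apply _
  have ratio_eq : ratio P (diagonal 1) = 1 / b 2 := by
    rw [← ratio_map (unitGroup_le_orderGroup hku), hb, map_one_of_mem_unitGroup hku]
    refine ratio_diagonal b_pos 2 fun j => one_div_le_one_div_of_le (b_pos 2) ?_
    fin_cases j
    exacts [hb2.trans hb1, hb2, le_rfl]
  rw [ratio_eq, one_div, inv_inv, ← traceForm_map_map hku, hb, k_apply, traceForm_single_right,
    diagonal_diag]

end Ratio

section Retraction

variable {A : Type*} [NormedAddCommGroup A] [InnerProductSpace ℝ A] [SymmetricComposition A]

/-- The retraction `P + s Q + r R` moves `P` towards `Q` and `R` by the same distance. -/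
def retraction (l : ℝ) (P Q R : Herm3 A) : Herm3 A :=
  P + (l / ratio P Q) • Q + (l / ratio P R) • R

theorem retraction_comm (l : ℝ) (P Q R : Herm3 A) : retraction l P Q R = retraction l P R Q :=
  add_right_comm _ _ _

variable [Nontrivial A] [FiniteDimensional ℝ A] {P Q R : Herm3 A} {l : ℝ}

theorem le_retraction (hP : PosDef P) (hQ : PosDef Q) (hR : PosDef R) (hl : 0 ≤ l) :
    P ≤ retraction l P Q R := by
  rw [retraction, add_assoc]
  exact le_add_of_nonneg_right (add_nonneg (smul_nonneg (div_nonneg hl (ratio_pos hP hQ).le)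
    hQ.nonneg) (smul_nonneg (div_nonneg hl (ratio_pos hP hR).le) hR.nonneg))

theorem ratio_retraction_right_le (hP : PosDef P) (hQ : PosDef Q) (hR : PosDef R) (hl : 1 ≤ l) :
    ratio P (retraction l P Q R) ≤ 3 * l := by
  have le_l (X : Herm3 A) (hX : PosDef X) : (l / ratio P X) • X ≤ l • P := by
    have := smul_le_smul_of_nonneg_left (hP.le_ratio_smul X)
      (div_nonneg (zero_le_one.trans hl) (ratio_pos hP hX).le)
    rwa [smul_smul, div_mul_cancel₀ _ (ratio_pos hP hX).ne'] at this
  refine hP.ratio_le ?_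
  calc retraction l P Q R ≤ l • P + l • P + l • P :=
        add_le_add_three (by simpa using smul_le_smul_of_nonneg_right hl hP.nonneg)
          (le_l Q hQ) (le_l R hR)
    _ = (3 * l) • P := by module

theorem ratio_retraction_left_le (hP : PosDef P) (hQ : PosDef Q) (hR : PosDef R) (hl : 0 < l) :
    ratio (retraction l P Q R) Q ≤ ratio P Q / l := by
  have pq := ratio_pos hP hQ
  refine (hP.mono (le_retraction hP hQ hR hl.le)).ratio_le ?_
  rw [← inv_div, le_inv_smul_iff_of_pos (div_pos hl pq), retraction, add_right_comm]
  exact le_add_of_nonneg_left (add_nonneg hP.nonneg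
    (smul_nonneg (div_nonneg hl.le (ratio_pos hP hR).le) hR.nonneg))

theorem ratio_left_retraction_le (hP : PosDef P) (hQ : PosDef Q) (hR : PosDef R) (hl : 0 ≤ l)
    (h : l * ratio Q R ≤ ratio Q P * ratio P R) :
    ratio Q (retraction l P Q R) ≤ 3 * ratio Q P := by
  have pq := ratio_pos hP hQ
  have pr := ratio_pos hP hR
  have s_le : l / ratio P Q ≤ ratio Q P := by
    rw [div_le_iff₀ pq]
    refine le_of_mul_le_mul_right (h.trans ?_) (ratio_pos hQ hR)
    rw [mul_assoc]
    exact mul_le_mul_of_nonneg_left (ratio_triangle hP hQ hR) (ratio_pos hQ hP).le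
  have r_le : (l / ratio P R) • R ≤ ratio Q P • Q := by
    refine (smul_le_smul_of_nonneg_left (hQ.le_ratio_smul R) (div_nonneg hl pr.le)).trans ?_
    rw [smul_smul]
    refine smul_le_smul_of_nonneg_right ?_ hQ.nonneg
    rwa [div_mul_eq_mul_div, div_le_iff₀ pr]
  refine hQ.ratio_le ?_
  calc retraction l P Q R ≤ ratio Q P • Q + ratio Q P • Q + ratio Q P • Q :=
        add_le_add_three (hQ.le_ratio_smul P) (smul_le_smul_of_nonneg_right s_le hQ.nonneg) r_le
    _ = (3 * ratio Q P) • Q := by module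

end Retraction

end Herm3

/-! ## Near-equilateral triangles -/

namespace Herm3

section Near

variable {A : Type*} [NormedAddCommGroup A] [InnerProductSpace ℝ A] [SymmetricComposition A]

/-- `X` and `D` are equal up to the factor `K` for the order: the multiplicative form of being at
bounded distance. -/
def IsNear (K : ℝ) (X D : Herm3 A) : Prop := X ≤ K • D ∧ D ≤ K • X

theorem le_two_smul_diagonal {X : Herm3 A} {τ : ℝ} (hX : 0 ≤ X) (hτ : X ≤ τ • diagonal 1) :
    X ≤ (2 : ℝ) • diagonal ![X.diag 0, τ, τ] := by
  refine (le_pinch hX).trans (smul_le_smul_of_nonneg_left ?_ zero_le_two)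
  refine (add_le_add_right (block_mono hτ) _).trans_eq ?_
  rw [smul_diagonal, block_diagonal, corner, diagonal_add_diagonal]
  congr 1
  ext i
  fin_cases i <;> simp

theorem le_two_smul_diagonal_diag {X : Herm3 A} (hX : 0 ≤ X) (h : X.off 0 = 0) :
    X ≤ (2 : ℝ) • diagonal X.diag := by
  refine (le_pinch hX).trans_eq (congrArg _ ?_)
  ext i <;> fin_cases i <;> simp [corner, block, h]

variable [Nontrivial A] [FiniteDimensional ℝ A]

theorem diag_zero_mul_diag_zero_le {X N : Herm3 A} {τ : ℝ} (hX : 0 ≤ X)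
    (hτ : X ≤ τ • diagonal 1) (hN : 0 ≤ N) :
    X.diag 0 * N.diag 0 ≤ 2 * (traceForm X N + τ * (N.diag 1 + N.diag 2)) := by
  have h₁ := traceForm_le_traceForm (corner_le hN) hX
  have h₂ := traceForm_le_traceForm hτ (block_nonneg hN)
  rw [corner, traceForm_comm, traceForm_diagonal_right, map_smul, map_add] at h₁
  rw [map_smul, LinearMap.smul_apply, traceForm_one_left, traceForm_comm] at h₂
  simp only [LinearMap.smul_apply, LinearMap.add_apply, smul_eq_mul, Fin.sum_univ_three,
    trace_apply, block, traceForm_comm N X] at h₁ h₂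
  simp at h₁ h₂
  linarith

theorem traceForm_block_le {X N : Herm3 A} (hX : 0 ≤ X) (hN : 0 ≤ N) :
    traceForm (block X) N ≤ 2 * (traceForm X N + X.diag 0 * N.diag 0) := by
  have h := traceForm_le_traceForm (block_le hX) hN
  rw [map_smul, map_add, LinearMap.smul_apply, LinearMap.add_apply, smul_eq_mul, corner,
    traceForm_diagonal_left] at h
  simpa [Fin.sum_univ_three] using h

/-- A rank one `N` on which `R` is small also sees a small `diagonal b`, so it is concentrated in
the first coordinate unless `b 2` is bounded; then `R.diag 0` is small as well, and `R` is closer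
to `diagonal b` than assumed. -/
theorem apply_two_le_of_le_mul_ratio {C τ : ℝ} {b : Fin 3 → ℝ} {R N : Herm3 A} (hC : 1 ≤ C)
    (hb : 1 ≤ b) (hb21 : b 2 ≤ b 1) (hbτ : b 1 ≤ τ) (hbR : diagonal b ≤ R) (hR : R ≤ τ • diagonal 1)
    (hN : 0 ≤ N) (hN1 : trace N = 1) (hRN : traceForm R N ≤ C)
    (hτ : τ ≤ C * ratio (diagonal b) R) : b 2 ≤ 16 * C ^ 2 := by
  have hQ : PosDef (diagonal b : Herm3 A) :=
    posDef_diagonal_iff.2 fun i => zero_lt_one.trans_le (hb i)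
  have h2 : 0 < b 2 := zero_lt_one.trans_le (hb 2)
  have hτ0 : 0 < τ := h2.trans_le (hb21.trans hbτ)
  by_contra! hlt
  have two_le : 2 * C < b 2 := by nlinarith
  have hQN := (traceForm_le_traceForm hbR hN).trans hRN
  rw [traceForm_diagonal_left, Fin.sum_univ_three] at hQN
  rw [trace_apply, Fin.sum_univ_three] at hN1
  have n0 := diag_nonneg hN 0
  have n1 := diag_nonneg hN 1
  have tail_le : b 2 * (N.diag 1 + N.diag 2) ≤ C := by
    have := mul_nonneg (zero_le_one.trans (hb 0)) n0
    have := mul_le_mul_of_nonneg_right hb21 n1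
    linarith
  have half_le : 1 / 2 ≤ N.diag 0 := by nlinarith
  have hR0 : 0 ≤ R := hQ.nonneg.trans hbR
  have head_le : b 2 * R.diag 0 ≤ 8 * C * τ := by
    have h₁ := diag_zero_mul_diag_zero_le hR0 hR hN
    have h₂ : b 2 * (R.diag 0 * (1 / 2)) ≤ b 2 * (R.diag 0 * N.diag 0) := by
      gcongr
      exact diag_nonneg hR0 0
    have h₃ : b 2 * C ≤ τ * C := by
      gcongr
      exact hb21.trans hbτ
    nlinarith [mul_le_mul_of_nonneg_left tail_le hτ0.le, mul_le_mul_of_nonneg_left hRN h2.le,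
      mul_le_mul_of_nonneg_left h₁ h2.le]
  have ratio_le : ratio (diagonal b) R ≤ 16 * C * τ / b 2 := by
    refine hQ.ratio_le ((le_two_smul_diagonal hR0 hR).trans ?_)
    rw [smul_diagonal, smul_diagonal, diagonal_le_diagonal_iff, Pi.le_def]
    have hCτ : 0 ≤ C * τ := by positivity
    have hτb : 0 ≤ τ * b 2 := by positivity
    have le0 : C * τ * 1 ≤ C * τ * b 0 := mul_le_mul_of_nonneg_left (hb 0) hCτ
    have le1 : 1 * τ * b 2 ≤ C * τ * b 2 := by gcongr
    have le2 : C * τ * b 2 ≤ C * τ * b 1 := by gcongr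
    intro i
    rw [Pi.smul_apply, Pi.smul_apply, smul_eq_mul, smul_eq_mul, div_mul_eq_mul_div, le_div_iff₀ h2]
    fin_cases i <;> simp <;> linarith
  have := hτ.trans (mul_le_mul_of_nonneg_left ratio_le (zero_le_one.trans hC))
  rw [mul_div_assoc', le_div_iff₀ h2] at this
  nlinarith

theorem diag_two_le_of_traceForm_le {C τ : ℝ} {R N : Herm3 A} (hC : 1 ≤ C)
    (hoff : R.off 0 = 0) (hR21 : R.diag 2 ≤ R.diag 1) (hR : 0 ≤ R)
    (hRτ : R ≤ τ • diagonal 1) (hDR : diagonal ![τ, 1, 1] ≤ C • R)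
    (hN : 0 ≤ N) (hN1 : trace N = 1) (hRN : traceForm R N ≤ C) : R.diag 2 ≤ 8 * C ^ 2 := by
  have le_τ (i : Fin 3) : R.diag i ≤ τ := by simpa using diag_le_diag hRτ i
  have n0 := diag_nonneg hN 0
  have n1 := diag_nonneg hN 1
  have n2 := diag_nonneg hN 2
  rw [trace_apply, Fin.sum_univ_three] at hN1
  have head_le : τ * N.diag 0 ≤ C ^ 2 := by
    have h := traceForm_le_traceForm hDR hN
    rw [traceForm_diagonal_left, map_smul, LinearMap.smul_apply] at h
    simp [Fin.sum_univ_three] at h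
    nlinarith
  have block_le : R.diag 2 * (N.diag 1 + N.diag 2) ≤ 4 * C ^ 2 := by
    have h := traceForm_block_le hR hN
    have h₀ := mul_le_mul_of_nonneg_right (le_τ 0) n0
    have h₁ := mul_le_mul_of_nonneg_right hR21 n1
    have eq : traceForm (block R) N = R.diag 1 * N.diag 1 + R.diag 2 * N.diag 2 := by
      simp [traceForm_apply, block, hoff, Fin.sum_univ_three]
    nlinarith
  by_contra! hlt
  have := hlt.trans_le (le_τ 2)
  have : N.diag 0 ≤ 1 / 8 := by nlinarith
  nlinarith

theorem isNear_diagonal_of_off_zero_eq_zero {C τ : ℝ} {R N : Herm3 A} (hC : 1 < C)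
    (hoff : R.off 0 = 0) (hR21 : R.diag 2 ≤ R.diag 1) (h1R : diagonal 1 ≤ R)
    (hRτ : R ≤ τ • diagonal 1) (hDR : diagonal ![τ, 1, 1] ≤ C • R)
    (hN : 0 ≤ N) (hN1 : trace N = 1) (hRN : traceForm R N ≤ C)
    (hτ : τ ≤ C ^ 2 * ratio (diagonal ![τ, 1, 1]) R) :
    IsNear (16 * C ^ 3) R (diagonal ![τ, τ, 1]) := by
  have C_pos : 0 < C := zero_lt_one.trans hC
  have hR : 0 ≤ R := (diagonal_nonneg_iff.2 zero_le_one).trans h1R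
  have one_le (i : Fin 3) : 1 ≤ R.diag i := diag_le_diag h1R i
  have le_τ (i : Fin 3) : R.diag i ≤ τ := by simpa using diag_le_diag hRτ i
  have one_le_τ : 1 ≤ τ := (one_le 0).trans (le_τ 0)
  have sq_le : C ^ 2 ≤ C ^ 3 := pow_le_pow_right₀ hC.le (by norm_num)
  have le_sq : C ≤ C ^ 2 := by nlinarith
  have hD : PosDef (diagonal ![τ, 1, 1] : Herm3 A) := by
    simp [posDef_diagonal_iff, Fin.forall_fin_succ, zero_lt_one.trans_le one_le_τ]
  have τ_le : τ ≤ 2 * C ^ 2 * R.diag 1 := by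
    have : ratio (diagonal ![τ, 1, 1]) R ≤ 2 * R.diag 1 := by
      refine hD.ratio_le ((le_two_smul_diagonal_diag hR hoff).trans ?_)
      rw [smul_diagonal, smul_diagonal, diagonal_le_diagonal_iff]
      intro i
      fin_cases i <;> simp <;> nlinarith [one_le 1, le_τ 0, hR21]
    nlinarith
  have diag_two_le := diag_two_le_of_traceForm_le hC.le hoff hR21 hR hRτ hDR hN hN1 hRN
  constructor
  · refine (le_two_smul_diagonal_diag hR hoff).trans ?_
    rw [smul_diagonal, smul_diagonal, diagonal_le_diagonal_iff]
    intro i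
    fin_cases i <;> simp <;> nlinarith [le_τ 0, le_τ 1]
  · have block_le : block R ≤ C • R := by
      rw [← inv_smul_le_iff_of_pos C_pos]
      refine inv_smul_block_le hC ?_
      rw [inv_smul_le_iff_of_pos C_pos]
      refine le_trans ?_ hDR
      rw [corner, diagonal_le_diagonal_iff]
      intro i
      fin_cases i <;> simp [le_τ 0]
    have le_add : (diagonal ![τ, τ, 1] : Herm3 A) ≤
        diagonal ![τ, 1, 1] + (2 * C ^ 2) • block R := by
      have : block R = diagonal ![0, R.diag 1, R.diag 2] := by
        ext i <;> fin_cases i <;> simp [block, hoff]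
      rw [this, smul_diagonal, diagonal_add_diagonal, diagonal_le_diagonal_iff]
      intro i
      fin_cases i <;> simp <;> nlinarith [one_le 2]
    calc diagonal ![τ, τ, 1] ≤ diagonal ![τ, 1, 1] + (2 * C ^ 2) • block R := le_add
      _ ≤ C • R + (2 * C ^ 2) • C • R :=
        add_le_add hDR (smul_le_smul_of_nonneg_left block_le (by positivity))
      _ = (C + 2 * C ^ 3) • R := by module
      _ ≤ (16 * C ^ 3) • R := smul_le_smul_of_nonneg_right (by linarith) hR

theorem exists_traceForm_le {C : ℝ} {R : Herm3 A} (hR : PosDef R)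
    (h : 1 ≤ C * ratio R (diagonal 1)) :
    ∃ N : Herm3 A, 0 ≤ N ∧ trace N = 1 ∧ traceForm R N ≤ C := by
  obtain ⟨N, hN, hN1, hRN⟩ := hR.exists_rankOne_traceForm_eq
  exact ⟨N, hN.nonneg, hN1, hRN.trans_le ((inv_le_iff_one_le_mul₀ (ratio_pos hR posDef_one)).2 h)⟩

theorem middle_eigenvalue_le {C τ : ℝ} {Q R : Herm3 A} (hC : 1 ≤ C) (h1Q : diagonal 1 ≤ Q)
    (hQR : Q ≤ R) (hRτ : R ≤ τ • diagonal 1) (h₂ : τ ≤ C * ratio Q R)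
    (h₃ : 1 ≤ C * ratio R (diagonal 1)) {k : Herm3 A ≃ₗ[ℝ] Herm3 A} (hk : k ∈ rotGroup A)
    {b : Fin 3 → ℝ} (hb1 : b 1 ≤ b 0) (hb : k Q = diagonal b) : b 1 ≤ 16 * C ^ 2 := by
  have hl : cyc * cyc * k ∈ unitGroup A :=
    rotGroup_le_unitGroup (mul_mem (mul_mem cyc_mem_rotGroup cyc_mem_rotGroup) hk)
  have hlo := unitGroup_le_orderGroup hl
  set l := cyc * cyc * k
  have hlQ : l Q = diagonal fun i => b (i + 1 + 1) := by
    rw [← cyc_diagonal fun i => b (i + 1), ← cyc_diagonal b, ← hb]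
    rfl
  have one_le_b : diagonal 1 ≤ (diagonal fun i => b (i + 1 + 1) : Herm3 A) := by
    rwa [← hlQ, ← map_one_of_mem_unitGroup hl, hlo]
  have hlR : l R ≤ τ • diagonal 1 := (map_le_one_iff hl).2 hRτ
  have hlQR : l Q ≤ l R := (hlo _ _).2 hQR
  obtain ⟨N, hN, hN1, hRN⟩ := exists_traceForm_le (R := l R) (C := C)
    (posDef_one.mono (one_le_b.trans (hlQ.ge.trans hlQR)))
    (by rwa [← map_one_of_mem_unitGroup hl, ratio_map hlo])
  refine apply_two_le_of_le_mul_ratio (b := fun i => b (i + 1 + 1)) (τ := τ) hC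
    (diagonal_le_diagonal_iff.1 one_le_b) hb1 ?_ (hlQ ▸ hlQR) hlR hN hN1 hRN
    (by rwa [← hlQ, ratio_map hlo])
  simpa [hlQ] using diag_le_diag (hlQR.trans hlR) 1

theorem exists_map_near_diagonal {C τ : ℝ} {Q R : Herm3 A} (hC : 1 ≤ C)
    (h1Q : diagonal 1 ≤ Q) (hQR : Q ≤ R) (hRτ : R ≤ τ • diagonal 1)
    (h₁ : τ ≤ C * ratio (diagonal 1) Q) (h₂ : τ ≤ C * ratio Q R)
    (h₃ : 1 ≤ C * ratio R (diagonal 1)) :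
    ∃ k ∈ rotGroup A, diagonal ![τ, 1, 1] ≤ C • k Q ∧
      k Q ≤ (16 * C ^ 2) • diagonal ![τ, 1, 1] := by
  obtain ⟨k, hk, b, hb1, hb2, hb⟩ := exists_map_eq_diagonal Q
  have hku := rotGroup_le_unitGroup hk
  have hko := unitGroup_le_orderGroup hku
  have one_le_b : 1 ≤ b := by
    rwa [← diagonal_le_diagonal_iff (A := A), ← hb, ← map_one_of_mem_unitGroup hku, hko]
  have b_le : b 0 ≤ τ := by
    have := (map_le_one_iff hku).2 (hQR.trans hRτ)
    rw [hb, diagonal_le_smul_one_iff] at this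
    exact this 0
  have ratio_eq : ratio (diagonal 1) Q = b 0 := by
    rw [← ratio_map hko, hb, map_one_of_mem_unitGroup hku,
      ratio_one_diagonal 0 fun j => by fin_cases j <;> simp <;> linarith]
  have middle_le := middle_eigenvalue_le hC h1Q hQR hRτ h₂ h₃ hk hb1 hb
  have hb0 : 1 ≤ b 0 := one_le_b 0
  have hbtwo : 1 ≤ b 2 := one_le_b 2
  refine ⟨k, hk, ?_, ?_⟩ <;>
  · rw [hb, smul_diagonal, diagonal_le_diagonal_iff]
    intro i
    fin_cases i <;> simp <;> nlinarith

/-- A first rotation brings `Q` close to `diag(τ, 1, 1)`; a second one, which fixes that matrix,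
diagonalizes the lower right block of `R`. -/
theorem exists_isNear_equilateral {C τ : ℝ} {Q R : Herm3 A} (hC : 1 < C)
    (h1Q : diagonal 1 ≤ Q) (hQR : Q ≤ R) (hRτ : R ≤ τ • diagonal 1)
    (h₁ : τ ≤ C * ratio (diagonal 1) Q) (h₂ : τ ≤ C * ratio Q R)
    (h₃ : 1 ≤ C * ratio R (diagonal 1)) :
    ∃ k ∈ rotGroup A, IsNear (16 * C ^ 3) (k Q) (diagonal ![τ, 1, 1]) ∧
      IsNear (16 * C ^ 3) (k R) (diagonal ![τ, τ, 1]) := by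
  obtain ⟨k₀, hk₀, hDQ, hQD⟩ := exists_map_near_diagonal hC.le h1Q hQR hRτ h₁ h₂ h₃
  obtain ⟨u, c, s, hu, h, hoff, hR21⟩ := exists_rot_off_zero_eq_zero (k₀ R)
  have hk : rot u c s hu h * k₀ ∈ rotGroup A := mul_mem (rot_mem_rotGroup u c s hu h) hk₀
  have hr := unitGroup_le_orderGroup (rotGroup_le_unitGroup (rot_mem_rotGroup u c s hu h))
  have hku := rotGroup_le_unitGroup hk
  have hko := unitGroup_le_orderGroup hku
  have hrD : rot u c s hu h (diagonal ![τ, 1, 1]) = diagonal ![τ, 1, 1] :=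
    rot_diagonal (by simp) u c s hu h
  rw [← hr, map_smul, hrD] at hDQ hQD
  set k := rot u c s hu h * k₀
  change _ ≤ C • k Q at hDQ
  change k Q ≤ _ at hQD
  have hkR : diagonal 1 ≤ k R := by
    rw [← map_one_of_mem_unitGroup hku, hko]
    exact h1Q.trans hQR
  have hkRpos : PosDef (k R) := posDef_one.mono hkR
  have hDR : diagonal ![τ, 1, 1] ≤ C • k R :=
    hDQ.trans (smul_le_smul_of_nonneg_left ((hko _ _).2 hQR) (by linarith))
  have one_le_τ : 1 ≤ τ := by simpa using diag_le_diag ((h1Q.trans hQR).trans hRτ) 0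
  have hD : PosDef (diagonal ![τ, 1, 1] : Herm3 A) := by
    simp [posDef_diagonal_iff, Fin.forall_fin_succ, zero_lt_one.trans_le one_le_τ]
  have sq_le : C ^ 2 ≤ C ^ 3 := pow_le_pow_right₀ hC.le (by norm_num)
  have hQ : PosDef (k Q) := (posDef_map_iff hku).2 (posDef_one.mono h1Q)
  have ratio_le : τ ≤ C ^ 2 * ratio (diagonal ![τ, 1, 1]) (k R) := by
    have : ratio (k Q) (k R) ≤ C * ratio (diagonal ![τ, 1, 1]) (k R) :=
      (ratio_triangle hQ hD hkRpos).trans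
        (mul_le_mul_of_nonneg_right (hQ.ratio_le hDQ) (ratio_pos hD hkRpos).le)
    rw [ratio_map hko] at this
    nlinarith
  obtain ⟨N, hN, hN1, hRN⟩ := exists_traceForm_le (R := k R) (C := C) hkRpos
    (by rwa [← map_one_of_mem_unitGroup hku, ratio_map hko])
  refine ⟨k, hk, ⟨hQD.trans ?_, hDQ.trans ?_⟩,
    isNear_diagonal_of_off_zero_eq_zero hC hoff hR21 hkR ((map_le_one_iff hku).2 hRτ) hDR hN hN1
      hRN ratio_le⟩
  · exact smul_le_smul_of_nonneg_right (by linarith) hD.nonneg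
  · exact smul_le_smul_of_nonneg_right (by nlinarith) hQ.nonneg

theorem exists_isNear_equilateral_of_ratio_le {P Q R : Herm3 A} {C : ℝ} (hP : PosDef P)
    (hQ : PosDef Q) (hR : PosDef R) (h1 : det P = 1) (hC : 1 < C)
    (hQPR : ratio Q P * ratio P R ≤ C * ratio Q R) (hRQP : ratio R Q * ratio Q P ≤ C * ratio R P)
    (hPRQ : ratio P R * ratio R Q ≤ C * ratio P Q) :
    ∃ g ∈ genGroup A, ∃ τ q r : ℝ, 1 ≤ τ ∧ 0 < q ∧ 0 < r ∧ g P = diagonal 1 ∧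
      IsNear (16 * C ^ 3) (q • g Q) (diagonal ![τ, 1, 1]) ∧
      IsNear (16 * C ^ 3) (r • g R) (diagonal ![τ, τ, 1]) := by
  obtain ⟨g, hg, hgP⟩ := exists_map_eq_one hP h1
  have hgo := genGroup_le_orderGroup hg
  have q_pos := ratio_pos hQ hP
  have rq_pos := ratio_pos hR hQ
  set q := ratio Q P
  set r := q * ratio R Q with hr
  have r_pos : 0 < r := mul_pos q_pos rq_pos
  set τ := r * ratio P R with hτ
  have le₁ : diagonal 1 ≤ g (q • Q) := by
    rw [← hgP, hgo]
    exact hQ.le_ratio_smul P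
  have le₂ : g (q • Q) ≤ g (r • R) := by
    rw [hgo, hr, mul_smul]
    exact smul_le_smul_of_nonneg_left (hR.le_ratio_smul Q) q_pos.le
  have le₃ : g (r • R) ≤ τ • diagonal 1 := by
    rw [← hgP, ← map_smul, hgo, hτ, mul_smul r]
    exact smul_le_smul_of_nonneg_left (hP.le_ratio_smul R) r_pos.le
  have one_le_τ : 1 ≤ τ := by simpa using diag_le_diag ((le₁.trans le₂).trans le₃) 0
  have far₁ : τ ≤ C * ratio (diagonal 1) (g (q • Q)) := by
    rw [← hgP, ratio_map hgo, ratio_smul_right hP _ q_pos, hτ, hr]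
    linarith [mul_le_mul_of_nonneg_left hPRQ q_pos.le]
  have far₂ : τ ≤ C * ratio (g (q • Q)) (g (r • R)) := by
    rw [ratio_map hgo, ratio_smul_right (hQ.smul q_pos) _ r_pos, ratio_smul_left hQ _ q_pos, hτ, hr]
    have := mul_le_mul_of_nonneg_left hQPR rq_pos.le
    field_simp
    linarith
  have far₃ : 1 ≤ C * ratio (g (r • R)) (diagonal 1) := by
    rw [← hgP, ratio_map hgo, ratio_smul_left hR _ r_pos, hr]
    field_simp
    linarith
  obtain ⟨k, hk, nearQ, nearR⟩ := exists_isNear_equilateral hC le₁ le₂ le₃ far₁ far₂ far₃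
  rw [map_smul, map_smul] at nearQ nearR
  refine ⟨k * g, mul_mem (rotGroup_le_genGroup hk) hg, τ, q, r, one_le_τ, q_pos, r_pos, ?_,
    nearQ, nearR⟩
  rw [LinearEquiv.mul_apply, hgP, map_one_of_mem_unitGroup (rotGroup_le_unitGroup hk)]

end Near

section Swap

variable {A : Type*} [NormedAddCommGroup A] [InnerProductSpace ℝ A] [SymmetricComposition A]
  [Nontrivial A]

variable (A) in
theorem exists_swap :
    ∃ k ∈ rotGroup A, ∀ a b c : ℝ, k (diagonal ![a, b, c]) = diagonal ![c, b, a] := by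
  obtain ⟨u, hu, -⟩ := exists_eq_norm_smul (0 : A)
  refine ⟨cyc * rot u 0 1 hu (by norm_num),
    mul_mem cyc_mem_rotGroup (rot_mem_rotGroup u 0 1 hu _), fun a b c => ?_⟩
  rw [LinearEquiv.mul_apply]
  ext i <;> fin_cases i <;> simp [cyc_diag, cyc_off, rot_apply, rotFun]

end Swap

end Herm3

/-! ## Singular directions -/

namespace Herm3

section Spike

variable {A : Type*} [AddCommGroup A]

variable (A) in
/-- The points of a singular ray: `diag(τ, 1, 1)` for `φ = (1, 0, 0)` and `diag(1, τ, τ)` for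
`φ = (0, 1, 1)`. -/
def spike (φ : Fin 3 → ℝ) (τ : ℝ) : Herm3 A := diagonal (1 + (τ - 1) • φ)

theorem spike_eq [Module ℝ A] (φ : Fin 3 → ℝ) (τ : ℝ) :
    spike A φ τ = diagonal 1 + (τ - 1) • diagonal φ := by
  rw [spike, smul_diagonal, diagonal_add_diagonal]

end Spike

section Cycle

variable {A : Type*} [NormedAddCommGroup A] [InnerProductSpace ℝ A] [SymmetricComposition A]

/-- The product of the ratios around a triangle: its logarithm is the perimeter of the triangle for
the asymmetric distance `log ∘ ratio`. -/
def cycle (P Q R : Herm3 A) : ℝ := ratio P Q * ratio Q R * ratio R P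

theorem cycle_map {g : Herm3 A ≃ₗ[ℝ] Herm3 A} (hg : g ∈ orderGroup A) (P Q R : Herm3 A) :
    cycle (g P) (g Q) (g R) = cycle P Q R := by
  simp only [cycle, ratio_map hg]

theorem cycle_smul [Nontrivial A] [FiniteDimensional ℝ A] {P Q R : Herm3 A} (hP : PosDef P)
    (hQ : PosDef Q) (hR : PosDef R) {a b c : ℝ} (ha : 0 < a) (hb : 0 < b) (hc : 0 < c) :
    cycle (a • P) (b • Q) (c • R) = cycle P Q R := by
  simp only [cycle, ratio_smul_left hP _ ha, ratio_smul_left hQ _ hb, ratio_smul_left hR _ hc,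
    ratio_smul_right hP _ hb, ratio_smul_right hQ _ hc, ratio_smul_right hR _ ha]
  field_simp

theorem exists_smul_mem_orderGroup {c : ℝ} (hc : 0 < c) :
    ∃ S ∈ orderGroup A, ∀ X, S X = c • X := by
  refine ⟨dil (fun _ => √c) fun _ => (Real.sqrt_pos.2 hc).ne', dil_mem_orderGroup _ _, fun X => ?_⟩
  ext i
  · simp [dil_diag, Real.sq_sqrt hc.le]
  · simp [dil_off, Real.mul_self_sqrt hc.le]

end Cycle

section SingularDirection

variable {A : Type*} [NormedAddCommGroup A] [InnerProductSpace ℝ A] [SymmetricComposition A]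
  {φ : Fin 3 → ℝ} {σ τ n : ℝ}

theorem one_le_spike (hφ : φ = ![1, 0, 0] ∨ φ = ![0, 1, 1]) (hτ : 1 ≤ τ) :
    diagonal 1 ≤ spike A φ τ := by
  rw [spike, diagonal_le_diagonal_iff]
  obtain rfl | rfl := hφ <;> intro i <;> fin_cases i <;> simp [hτ]

theorem posDef_spike (hφ : φ = ![1, 0, 0] ∨ φ = ![0, 1, 1]) (hτ : 1 ≤ τ) :
    PosDef (spike A φ τ) :=
  posDef_one.mono (one_le_spike hφ hτ)

theorem one_add_smul_le_smul_one {e : Herm3 A} (he : e ≤ diagonal 1) (hσ : 1 ≤ σ) :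
    diagonal 1 + (σ - 1) • e ≤ σ • diagonal 1 :=
  calc diagonal 1 + (σ - 1) • e ≤ diagonal 1 + (σ - 1) • diagonal 1 :=
        add_le_add_right (smul_le_smul_of_nonneg_left he (sub_nonneg.2 hσ)) _
    _ = σ • diagonal 1 := by module

theorem eq_smul_single_of_le {E : Herm3 A} (h : 0 ≤ E) (hE : E ≤ diagonal (Pi.single 0 1)) :
    E = E.diag 0 • diagonal (Pi.single 0 1) := by
  have diag1 : E.diag 1 = 0 := le_antisymm (by simpa using diag_le_diag hE 1) (diag_nonneg h 1)
  have diag2 : E.diag 2 = 0 := le_antisymm (by simpa using diag_le_diag hE 2) (diag_nonneg h 2)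
  have off_zero (i : Fin 3) (hi : E.diag (i + 1) * E.diag (i + 2) = 0) : E.off i = 0 := by
    simpa [hi] using norm_off_sq_le h i
  ext i <;> fin_cases i
  · simp
  · simpa using diag1
  · simpa using diag2
  · simpa using off_zero 0 (by simp [diag1])
  · simpa using off_zero 1 (by simp [diag2])
  · simpa using off_zero 2 (by simp [diag1])

variable [Nontrivial A] [FiniteDimensional ℝ A] {L : Herm3 A ≃ₗ[ℝ] Herm3 A}

theorem exists_map_le_single (hL : L ∈ orderGroup A) (hL1 : L (diagonal 1) ≤ diagonal 1) :
    ∃ k ∈ rotGroup A, k (L (diagonal (Pi.single 0 1))) ≤ diagonal (Pi.single 0 1) := by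
  have e_nonneg : 0 ≤ L (diagonal (Pi.single 0 1)) :=
    (map_nonneg_iff hL).2 (diagonal_nonneg_iff.2 (Pi.single_nonneg.2 zero_le_one))
  have e_le : L (diagonal (Pi.single 0 1)) ≤ (1 : ℝ) • diagonal 1 := by
    rw [one_smul]
    refine ((hL _ _).2 ?_).trans hL1
    rw [diagonal_le_diagonal_iff]
    intro i
    fin_cases i <;> simp
  obtain ⟨k, hk, b, hb1, hb2, hb⟩ := exists_map_eq_diagonal (L (diagonal (Pi.single 0 1)))
  have hku := rotGroup_le_unitGroup hk
  have hko := unitGroup_le_orderGroup hku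
  have hkL : k * L ∈ orderGroup A := mul_mem hko hL
  rw [← map_nonneg_iff hko, hb, diagonal_nonneg_iff] at e_nonneg
  rw [← map_le_one_iff hku, hb, diagonal_le_smul_one_iff] at e_le
  have b_one : b 1 = 0 := by
    set E : Herm3 A := (k * L).symm (diagonal (Pi.single 1 (b 1)))
    have map_E : (k * L) E = diagonal (Pi.single 1 (b 1)) := (k * L).apply_symm_apply _
    have E_nonneg : 0 ≤ E := by
      rw [← map_nonneg_iff hkL, map_E, diagonal_nonneg_iff]
      exact Pi.single_nonneg.2 (e_nonneg 1)
    have E_le : E ≤ diagonal (Pi.single 0 1) := by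
      rw [← hkL, map_E, LinearEquiv.mul_apply, hb, diagonal_le_diagonal_iff]
      intro i
      fin_cases i
      · simpa using e_nonneg 0
      · simp
      · simpa using e_nonneg 2
    rw [eq_smul_single_of_le E_nonneg E_le, map_smul, LinearEquiv.mul_apply, hb,
      smul_diagonal] at map_E
    have at0 := congrArg (diag · 0) map_E
    have at1 := congrArg (diag · 1) map_E
    obtain h | h : E.diag 0 = 0 ∨ b 0 = 0 := by simpa using at0
    · simpa [h] using at1.symm
    · exact le_antisymm (hb1.trans h.le) (e_nonneg 1)
  refine ⟨k, hk, ?_⟩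
  rw [hb, diagonal_le_diagonal_iff]
  intro i
  fin_cases i
  · simpa using e_le 0
  · simp [b_one]
  · simpa [b_one] using hb2

theorem exists_map_le_of_complement (hL : L ∈ orderGroup A) (hL1 : L (diagonal 1) ≤ diagonal 1) :
    ∃ k ∈ rotGroup A, k (L (diagonal ![0, 1, 1])) ≤ diagonal ![0, 1, 1] := by
  obtain ⟨k, hk, b, hb1, hb2, hb⟩ := exists_map_eq_diagonal (L (diagonal ![0, 1, 1]))
  have hku := rotGroup_le_unitGroup hk
  have b_le : b 0 ≤ 1 := by
    have e_le : L (diagonal ![0, 1, 1]) ≤ (1 : ℝ) • diagonal 1 := by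
      rw [one_smul]
      refine ((hL _ _).2 ?_).trans hL1
      rw [diagonal_le_diagonal_iff]
      intro i
      fin_cases i <;> simp
    rw [← map_le_one_iff hku, hb, diagonal_le_smul_one_iff] at e_le
    exact e_le 0
  have b_two : b 2 ≤ 0 := by
    by_contra! hpos
    have : b 2 • diagonal 1 ≤ (diagonal ![0, 1, 1] : Herm3 A) := by
      rw [← hL, map_smul]
      refine (smul_le_smul_of_nonneg_left hL1 hpos.le).trans ?_
      rw [← one_le_map_iff hku, hb, smul_one_le_diagonal_iff]
      intro i
      fin_cases i <;> simp <;> linarith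
    exact hpos.not_ge (by simpa using diag_le_diag this 0)
  refine ⟨cyc * cyc * k, mul_mem (mul_mem cyc_mem_rotGroup cyc_mem_rotGroup) hk, ?_⟩
  rw [LinearEquiv.mul_apply, LinearEquiv.mul_apply, hb, cyc_diagonal, cyc_diagonal,
    diagonal_le_diagonal_iff]
  intro i
  fin_cases i
  · simpa using b_two
  · simpa using b_le
  · simpa using hb1.trans b_le

theorem exists_map_le_idempotent (hφ : φ = ![1, 0, 0] ∨ φ = ![0, 1, 1]) (hL : L ∈ orderGroup A)
    (hL1 : L (diagonal 1) ≤ diagonal 1) :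
    ∃ k ∈ rotGroup A, k (L (diagonal φ)) ≤ diagonal φ := by
  obtain rfl | rfl := hφ
  · have : ![1, 0, 0] = Pi.single (0 : Fin 3) (1 : ℝ) := by
      ext i
      fin_cases i <;> simp
    simpa only [this] using exists_map_le_single hL hL1
  · exact exists_map_le_of_complement hL hL1

theorem le_two_smul_diagonal_add (hφ : φ = ![1, 0, 0] ∨ φ = ![0, 1, 1]) {e : Herm3 A}
    (he : 0 ≤ e) (he1 : e ≤ diagonal 1) (htr : trace e = ∑ i, φ i) :
    e ≤ (2 : ℝ) • (diagonal φ + traceForm (diagonal φ) (diagonal 1 - e) • diagonal 1) := by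
  refine (le_pinch he).trans (smul_le_smul_of_nonneg_left ?_ zero_le_two)
  have e0_le : e.diag 0 ≤ 1 := diag_le_diag he1 0
  rw [traceForm_diagonal_left]
  obtain rfl | rfl := hφ <;> rw [trace_apply] at htr <;>
    simp only [Fin.sum_univ_three, sub_diag, diagonal_diag] at htr ⊢ <;>
    simp only [Nat.succ_eq_add_one, Nat.reduceAdd, Fin.isValue, Matrix.cons_val_zero, Pi.sub_apply,
      Pi.one_apply, one_mul, Matrix.cons_val_one, zero_mul, add_zero, zero_add,
      Matrix.cons_val] at htr ⊢
  · refine add_le_add ?_ ?_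
    · rw [corner, diagonal_le_diagonal_iff]
      intro i
      fin_cases i <;> simp [e0_le]
    · refine (le_trace_smul_one (block_nonneg he)).trans_eq ?_
      congr 1
      simp [trace_apply, block, Fin.sum_univ_three]
      linarith
  · rw [add_comm]
    refine add_le_add ?_ ?_
    · simpa [block_diagonal] using block_mono he1
    · rw [corner, smul_diagonal, diagonal_le_diagonal_iff]
      have := diag_nonneg he 0
      intro i
      fin_cases i <;> simp <;> linarith

theorem ratio_one_spike (hφ : φ = ![1, 0, 0] ∨ φ = ![0, 1, 1]) (hτ : 1 ≤ τ) :
    ratio (diagonal 1) (spike A φ τ) = τ := by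
  obtain rfl | rfl := hφ
  · exact (ratio_one_diagonal 0 fun i => by fin_cases i <;> simp [hτ]).trans (by simp)
  · exact (ratio_one_diagonal 1 fun i => by fin_cases i <;> simp [hτ]).trans (by simp)

theorem one_le_ratio_spike_one (hφ : φ = ![1, 0, 0] ∨ φ = ![0, 1, 1]) (hτ : 1 ≤ τ) :
    1 ≤ ratio (spike A φ τ) (diagonal 1) := by
  have h := (posDef_spike (A := A) hφ hτ).le_ratio_smul (diagonal 1)
  generalize ratio (spike A φ τ) (diagonal 1) = r at *
  rw [spike, smul_diagonal, diagonal_le_diagonal_iff] at h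
  obtain rfl | rfl := hφ
  · simpa [Matrix.vecHead, Matrix.vecTail] using h 1
  · simpa [Matrix.vecHead] using h 0

/-- Pairing the hypothesis with `1 - e` bounds the angle `⟨φ, 1 - e⟩` between the two
idempotents. -/
theorem angle_le_of_spike_le (hφ : φ = ![1, 0, 0] ∨ φ = ![0, 1, 1])
    {k : Herm3 A ≃ₗ[ℝ] Herm3 A} (hk : k ∈ unitGroup A) {e : Herm3 A} (he : k e = diagonal φ)
    (he1 : e ≤ diagonal 1) (hτ : 1 ≤ τ)
    (h : spike A φ τ ≤ n • (diagonal 1 + (σ - 1) • e)) :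
    1 ≤ n ∧ traceForm (diagonal φ) (diagonal 1 - e) ≤ 2 ∧
      τ * traceForm (diagonal φ) (diagonal 1 - e) ≤ 2 * n := by
  have φ_nonneg : 0 ≤ φ := by obtain rfl | rfl := hφ <;> intro i <;> fin_cases i <;> simp
  have trace_e : trace e = ∑ i, φ i := by rw [← trace_map hk, he, trace_apply, diagonal_diag]
  have pair_one : traceForm (diagonal 1) (diagonal 1 - e) = 3 - ∑ i, φ i := by
    rw [traceForm_one_left, map_sub, trace_e, trace_apply]
    simp
  have pair_e : traceForm e (diagonal 1 - e) = 0 := by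
    rw [← traceForm_map_map hk, map_sub, he, map_one_of_mem_unitGroup hk, traceForm_diagonal_left]
    obtain rfl | rfl := hφ <;> simp [Fin.sum_univ_three]
  have κ_nonneg := traceForm_nonneg (diagonal_nonneg_iff.2 φ_nonneg) (sub_nonneg.2 he1)
  have κ_le : traceForm (diagonal φ) (diagonal 1 - e) ≤ 3 - ∑ i, φ i := by
    rw [← pair_one]
    refine traceForm_le_traceForm (diagonal_le_diagonal_iff.2 ?_) (sub_nonneg.2 he1)
    obtain rfl | rfl := hφ <;> intro i <;> fin_cases i <;> simp
  have hn := traceForm_le_traceForm h (sub_nonneg.2 he1)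
  simp only [spike_eq, map_add, map_smul, LinearMap.add_apply, LinearMap.smul_apply, smul_eq_mul,
    pair_one, pair_e] at hn
  have m_bound : 1 ≤ 3 - ∑ i, φ i ∧ 3 - ∑ i, φ i ≤ 2 := by
    obtain rfl | rfl := hφ <;> simp [Fin.sum_univ_three] <;> norm_num
  generalize traceForm (diagonal φ) (diagonal 1 - e) = κ at *
  generalize 3 - ∑ i, φ i = m at *
  have one_le : 1 ≤ n := by nlinarith
  exact ⟨one_le, by linarith, by nlinarith⟩

theorem le_smul_spike_of_spike_le (hφ : φ = ![1, 0, 0] ∨ φ = ![0, 1, 1])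
    {k : Herm3 A ≃ₗ[ℝ] Herm3 A} (hk : k ∈ unitGroup A) {e : Herm3 A} (he : k e = diagonal φ)
    (hσ : 1 ≤ σ) (hτ : 1 ≤ τ) (h : spike A φ τ ≤ n • (diagonal 1 + (σ - 1) • e)) :
    diagonal 1 + (σ - 1) • e ≤ (6 * σ * n / τ) • spike A φ τ := by
  have φ_bound : 0 ≤ φ ∧ φ ≤ 1 := by
    obtain rfl | rfl := hφ <;> constructor <;> intro i <;> fin_cases i <;> simp
  have e_nonneg : 0 ≤ e := by
    rw [← map_nonneg_iff (unitGroup_le_orderGroup hk), he, diagonal_nonneg_iff]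
    exact φ_bound.1
  have e_le : e ≤ diagonal 1 := by
    rw [← unitGroup_le_orderGroup hk, he, map_one_of_mem_unitGroup hk, diagonal_le_diagonal_iff]
    exact φ_bound.2
  have trace_e : trace e = ∑ i, φ i := by rw [← trace_map hk, he, trace_apply, diagonal_diag]
  obtain ⟨one_le_n, κ_le_two, κ_le⟩ := angle_le_of_spike_le hφ hk he e_le hτ h
  have κ_nonneg :=
    traceForm_nonneg (diagonal_nonneg_iff.2 φ_bound.1) (sub_nonneg.2 e_le)
  have e_le_two := le_two_smul_diagonal_add hφ e_nonneg e_le trace_e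
  generalize traceForm (diagonal φ) (diagonal 1 - e) = κ at *
  have τ_le : τ ≤ n * σ := by
    have := h.trans (smul_le_smul_of_nonneg_left (one_add_smul_le_smul_one e_le hσ) (by linarith))
    rw [smul_smul] at this
    rw [← ratio_one_spike (A := A) hφ hτ]
    exact posDef_one.ratio_le this
  calc diagonal 1 + (σ - 1) • e
      ≤ diagonal 1 + (σ - 1) • ((2 : ℝ) • (diagonal φ + κ • diagonal 1)) :=
        add_le_add_right (smul_le_smul_of_nonneg_left e_le_two (sub_nonneg.2 hσ)) _
    _ = diagonal (1 + (σ - 1) • ((2 : ℝ) • (φ + κ • 1))) := by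
        simp only [smul_diagonal, diagonal_add_diagonal]
    _ ≤ (6 * σ * n / τ) • spike A φ τ := by
        rw [spike, smul_diagonal, diagonal_le_diagonal_iff]
        have off_bound : 1 + (σ - 1) * (2 * κ) ≤ 6 * σ * n / τ := by
          rw [le_div_iff₀ (by positivity)]
          nlinarith
        have on_bound : 1 + (σ - 1) * (2 * (1 + κ)) ≤ 6 * σ * n / τ * τ := by
          rw [div_mul_cancel₀ _ (by positivity)]
          nlinarith
        obtain rfl | rfl := hφ <;> intro i <;> fin_cases i <;>
          first
            | simpa [Matrix.vecHead, Matrix.vecTail] using off_bound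
            | simpa [Matrix.vecHead, Matrix.vecTail] using on_bound

theorem spike_map_le (hφ : φ = ![1, 0, 0] ∨ φ = ![0, 1, 1]) (hL : L ∈ orderGroup A)
    (hL1 : L (diagonal 1) ≤ diagonal 1) (hσ : 1 ≤ σ) (hτ : 1 ≤ τ) (hn : 0 ≤ n)
    (h : spike A φ τ ≤ n • L (spike A φ σ)) :
    L (spike A φ σ) ≤ (6 * σ * n / τ) • spike A φ τ := by
  obtain ⟨k, hk, hkL⟩ := exists_map_le_idempotent hφ hL hL1
  have hku := rotGroup_le_unitGroup hk
  have k_apply : k (k.symm (diagonal φ)) = diagonal φ := k.apply_symm_apply _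
  have L_φ_le : L (diagonal φ) ≤ k.symm (diagonal φ) := by
    rwa [← unitGroup_le_orderGroup hku, k_apply]
  have L_le : L (spike A φ σ) ≤ diagonal 1 + (σ - 1) • k.symm (diagonal φ) := by
    rw [spike_eq, map_add, map_smul]
    exact add_le_add hL1 (smul_le_smul_of_nonneg_left L_φ_le (sub_nonneg.2 hσ))
  exact L_le.trans (le_smul_spike_of_spike_le hφ hku k_apply hσ hτ
    (h.trans (smul_le_smul_of_nonneg_left L_le hn)))

theorem cycle_spike_le (hφ : φ = ![1, 0, 0] ∨ φ = ![0, 1, 1]) (hL : L ∈ orderGroup A)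
    (hL1 : L (diagonal 1) ≤ diagonal 1) {μ : ℝ} (hμ : 0 < μ)
    (hLμ : diagonal 1 ≤ μ • L (diagonal 1)) (hσ : 1 ≤ σ) (hτ : 1 ≤ τ)
    (hY : PosDef (L (spike A φ σ))) :
    cycle (spike A φ τ) (L (spike A φ σ)) (diagonal 1) ≤
      6 * μ ^ 2 * cycle (spike A φ τ) (diagonal 1) (L (spike A φ σ)) := by
  have hZ : PosDef (spike A φ τ) := posDef_spike hφ hτ
  have YZ_pos := ratio_pos hY hZ
  have ZY_le := hZ.ratio_le (spike_map_le hφ hL hL1 hσ hτ YZ_pos.le (hY.le_ratio_smul _))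
  have Y1_le : ratio (L (spike A φ σ)) (diagonal 1) ≤ μ := by
    refine hY.ratio_le (hLμ.trans (smul_le_smul_of_nonneg_left ?_ hμ.le))
    exact (hL _ _).2 (one_le_spike hφ hσ)
  have σ_le : σ ≤ ratio (diagonal 1) (L (spike A φ σ)) * μ := by
    rw [← ratio_one_spike (A := A) hφ hσ]
    refine posDef_one.ratio_le ?_
    rw [← hL, map_smul, mul_smul, ratio_one_spike hφ hσ]
    exact (posDef_one.le_ratio_smul _).trans
      (smul_le_smul_of_nonneg_left hLμ (ratio_pos posDef_one hY).le)
  have Z1_ge := one_le_ratio_spike_one (A := A) hφ hτ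
  have pos1 := ratio_pos posDef_one hY
  have pos3 := ratio_pos hY posDef_one
  rw [cycle, cycle, ratio_one_spike hφ hτ]
  generalize ratio (spike A φ τ) (diagonal 1) = z at *
  generalize ratio (diagonal 1) (L (spike A φ σ)) = y at *
  generalize ratio (L (spike A φ σ)) (spike A φ τ) = n at *
  calc ratio (spike A φ τ) (L (spike A φ σ)) * ratio (L (spike A φ σ)) (diagonal 1) * τ
      ≤ 6 * σ * n / τ * μ * τ := by gcongr
    _ = 6 * μ * n * σ := by field_simp
    _ ≤ 6 * μ * n * (y * μ) := by gcongr
    _ = 6 * μ ^ 2 * (1 * y * n) := by ring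
    _ ≤ 6 * μ ^ 2 * (z * y * n) := by gcongr

/-- The two singular directions are compared through the order contraction `m⁻¹ • L₁ ∘ L₂⁻¹`, where
`m = ratio V W`, which moves the identity by a bounded amount only. -/
theorem cycle_le (hφ : φ = ![1, 0, 0] ∨ φ = ![0, 1, 1]) {L₁ L₂ : Herm3 A ≃ₗ[ℝ] Herm3 A}
    (hL₁ : L₁ ∈ orderGroup A) (hL₂ : L₂ ∈ orderGroup A) {V Z W Y : Herm3 A}
    (hV : PosDef V) (hW : PosDef W)
    {c c' : ℝ} (hc : 0 < c) (hc' : 0 < c') (hσ : 1 ≤ σ) (hτ : 1 ≤ τ)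
    (map_V : L₁ V = diagonal 1) (map_Z : L₁ Z = c • spike A φ τ)
    (map_W : L₂ W = diagonal 1) (map_Y : L₂ Y = c' • spike A φ σ) :
    cycle Z Y V ≤ 6 * (ratio V W * ratio W V) ^ 2 * cycle Z V Y := by
  have m_pos := ratio_pos hV hW
  have m'_pos := ratio_pos hW hV
  generalize hm : ratio V W = m at *
  obtain ⟨S, hS, S_apply⟩ := exists_smul_mem_orderGroup (A := A) (inv_pos.2 m_pos)
  set L := S * L₁ * L₂⁻¹
  have hL : L ∈ orderGroup A := mul_mem (mul_mem hS hL₁) (inv_mem hL₂)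
  have L_apply (X : Herm3 A) : L (L₂ X) = m⁻¹ • L₁ X := by
    change S (L₁ (L₂.symm (L₂ X))) = _
    rw [S_apply, L₂.symm_apply_apply]
  have L_one : L (diagonal 1) = m⁻¹ • L₁ W := by rw [← map_W, L_apply]
  have L₁_Y : L₁ Y = (c' * m) • L (spike A φ σ) := by
    rw [mul_comm, mul_smul, ← map_smul, ← map_Y, L_apply, smul_inv_smul₀ m_pos.ne']
  have L_one_le : L (diagonal 1) ≤ diagonal 1 := by
    rw [L_one, inv_smul_le_iff_of_pos m_pos, ← map_V, ← map_smul, hL₁, ← hm]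
    exact hV.le_ratio_smul W
  have one_le : diagonal 1 ≤ (m * ratio W V) • L (diagonal 1) := by
    rw [L_one, mul_comm, mul_smul, smul_inv_smul₀ m_pos.ne', ← map_V, ← map_smul, hL₁]
    exact hW.le_ratio_smul V
  have hY : PosDef (L (spike A φ σ)) := by
    refine PosDef.mono ?_ ((hL _ _).2 (one_le_spike hφ hσ))
    exact ⟨(m * ratio W V)⁻¹, by positivity, (inv_smul_le_iff_of_pos (by positivity)).2 one_le⟩
  have hZ : PosDef (spike A φ τ) := posDef_spike hφ hτ
  have hc'm : 0 < c' * m := by positivity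
  have key := cycle_spike_le hφ hL L_one_le (by positivity) one_le hσ hτ hY
  rw [← cycle_smul hZ hY posDef_one hc hc'm one_pos, ← cycle_smul hZ posDef_one hY hc one_pos hc'm,
    one_smul, ← map_V, ← map_Z, ← L₁_Y, cycle_map hL₁, cycle_map hL₁] at key
  exact key

end SingularDirection

end Herm3

/-! ## Symmetric spaces modelled on the cone -/

open Herm3

/-- The spectrum of a point at position `(t, 0)` from the base point. -/
def shapeVec (t : ℝ) : Fin 3 → ℝ := Real.exp (-t / 3) • ![Real.exp t, 1, 1]

/-- The spectrum of a point at position `(0, t)` from the base point. -/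
def coshapeVec (t : ℝ) : Fin 3 → ℝ := Real.exp (-2 * t / 3) • ![Real.exp t, Real.exp t, 1]

theorem exp_sq (s : ℝ) : Real.exp s ^ 2 = Real.exp (2 * s) := by
  rw [pow_two, ← Real.exp_add, two_mul]

theorem shapeVec_sq (t : ℝ) :
    shapeVec t ^ 2 = Real.exp (-2 * t / 3) • ![Real.exp (2 * t), 1, 1] := by
  ext i
  fin_cases i <;> simp [shapeVec, mul_pow, exp_sq] <;> ring_nf

theorem coshapeVec_sq (t : ℝ) :
    coshapeVec t ^ 2 = Real.exp (-4 * t / 3) • ![Real.exp (2 * t), Real.exp (2 * t), 1] := by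
  ext i
  fin_cases i <;> simp [coshapeVec, mul_pow, exp_sq] <;> ring_nf

theorem shapeVec_pos (t : ℝ) (i : Fin 3) : 0 < shapeVec t i := by
  fin_cases i <;> simp [shapeVec, Real.exp_pos]

theorem prod_shapeVec (t : ℝ) : ∏ i, shapeVec t i = 1 := by
  simp only [shapeVec, Fin.prod_univ_three, Pi.smul_apply, smul_eq_mul, Matrix.cons_val_zero,
    Matrix.cons_val_one, Matrix.cons_val, mul_one, ← Real.exp_add, Real.exp_eq_one_iff]
  ring

theorem coshapeVec_eq_shapeVec_neg (t : ℝ) :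
    coshapeVec t = ![shapeVec (-t) 2, shapeVec (-t) 1, shapeVec (-t) 0] := by
  ext i
  fin_cases i <;> simp [shapeVec, coshapeVec, ← Real.exp_add] <;> ring

theorem coshapeVec_pos (t : ℝ) (i : Fin 3) : 0 < coshapeVec t i := by
  rw [coshapeVec_eq_shapeVec_neg]
  fin_cases i <;> exact shapeVec_pos _ _

theorem prod_coshapeVec (t : ℝ) : ∏ i, coshapeVec t i = 1 := by
  rw [← prod_shapeVec (-t), coshapeVec_eq_shapeVec_neg]
  simp only [Fin.prod_univ_three, Matrix.cons_val_zero, Matrix.cons_val_one, Matrix.cons_val]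
  ring

theorem diagonal_shapeVec_sq_eq_smul_spike (A : Type*) [AddCommGroup A] [Module ℝ A] (t : ℝ) :
    (diagonal (shapeVec t ^ 2) : Herm3 A) =
    Real.exp (-2 * t / 3) • spike A ![1, 0, 0] (Real.exp (2 * t)) := by
  rw [shapeVec_sq, spike, smul_diagonal]
  congr 2
  ext i
  fin_cases i <;> simp

theorem diagonal_shapeVec_sq_eq_smul_spike' (A : Type*) [AddCommGroup A] [Module ℝ A] (t : ℝ) :
    (diagonal (shapeVec t ^ 2) : Herm3 A) =
    Real.exp (4 * t / 3) • spike A ![0, 1, 1] (Real.exp (-2 * t)) := by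
  rw [shapeVec_sq, spike, smul_diagonal]
  congr 1
  ext i
  fin_cases i <;> simp [← Real.exp_add, Matrix.vecHead, Matrix.vecTail] <;> ring

/-- A space `X` whose points `x` are represented by the positive definite matrices `sq x` of
determinant one over `A`, with its distance and its pairs and triples of special shape. The matrix
`sq x` is the square of the one that represents `x` in the symmetric space, whence the factor `1/2`
in the distance and the squares of the spectra. -/
structure ConeModel (A : Type*) [NormedAddCommGroup A] [InnerProductSpace ℝ A]
    [SymmetricComposition A] (X : Type*) where
  sq : X → Herm3 A
  dist : X → X → ℝ
  Shape : ℝ → X → X → Prop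
  Equilateral : ℝ → X → X → X → Prop
  posDef_sq : ∀ x, (sq x).PosDef
  det_sq : ∀ x, (sq x).det = 1
  exists_sq : ∀ P : Herm3 A, P.PosDef → P.det = 1 → ∃ x, sq x = P
  dist_eq : ∀ x y, ∀ g ∈ genGroup A, ∀ b : Fin 3 → ℝ, (∀ i, 0 < b i) → b 1 ≤ b 0 → b 2 ≤ b 1 →
    g (sq x) = diagonal 1 → g (sq y) = diagonal b →
    dist x y = (Real.log (b 0) - Real.log (b 2)) / 2
  shape_spec : ∀ t x y, Shape t x y → ∃ L ∈ orderGroup A, L (sq x) = diagonal 1 ∧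
    L (sq y) = diagonal (shapeVec t ^ 2)
  equilateral_spec : ∀ t x y z, ∀ g ∈ genGroup A, g (sq x) = diagonal 1 →
    g (sq y) = diagonal (shapeVec t ^ 2) → g (sq z) = diagonal (coshapeVec t ^ 2) →
    Equilateral t x y z

namespace ConeModel

variable {A : Type*} [NormedAddCommGroup A] [InnerProductSpace ℝ A] [SymmetricComposition A]
  {X : Type*} (M : ConeModel A X)

/-- The logarithm of the least `c` with `sq y ≤ c • sq x`, an asymmetric distance. -/
def logRatio (x y : X) : ℝ := Real.log (ratio (M.sq x) (M.sq y))

/-- The excess of the path from `y` to `z` through `x`. -/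
def excess (x y z : X) : ℝ := M.logRatio y x + M.logRatio x z - M.logRatio y z

variable [Nontrivial A]

variable {M} in
theorem equilateral_neg {t : ℝ} {x y z : X} {g : Herm3 A ≃ₗ[ℝ] Herm3 A} (hg : g ∈ genGroup A)
    (hx : g (M.sq x) = diagonal 1) (hy : g (M.sq y) = diagonal (coshapeVec t ^ 2))
    (hz : g (M.sq z) = diagonal (shapeVec t ^ 2)) : M.Equilateral (-t) x y z := by
  obtain ⟨k, hk, swap⟩ := exists_swap A
  have swap' (b : Fin 3 → ℝ) : k (diagonal b) = diagonal ![b 2, b 1, b 0] := by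
    rw [← swap]
    congr 2
    ext i
    fin_cases i <;> rfl
  refine M.equilateral_spec (-t) _ _ _ (k * g) (mul_mem (rotGroup_le_genGroup hk) hg) ?_ ?_ ?_ <;>
    rw [LinearEquiv.mul_apply]
  · rw [hx, map_one_of_mem_unitGroup (rotGroup_le_unitGroup hk)]
  · rw [hy, swap', coshapeVec_eq_shapeVec_neg]
    congr 1
    ext i
    fin_cases i <;> simp
  · rw [hz, swap', coshapeVec_eq_shapeVec_neg, neg_neg]
    congr 1
    ext i
    fin_cases i <;> simp

variable [FiniteDimensional ℝ A]

section Distance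

theorem exp_logRatio (x y : X) : Real.exp (M.logRatio x y) = ratio (M.sq x) (M.sq y) :=
  Real.exp_log (ratio_pos (M.posDef_sq x) (M.posDef_sq y))

theorem logRatio_le_iff {x y : X} {r : ℝ} : M.logRatio x y ≤ r ↔ M.sq y ≤ Real.exp r • M.sq x :=
  (Real.log_le_iff_le_exp (ratio_pos (M.posDef_sq x) (M.posDef_sq y))).trans
    (ratio_le_iff (M.posDef_sq x))

theorem logRatio_triangle (x y z : X) : M.logRatio x z ≤ M.logRatio x y + M.logRatio y z := by
  rw [← Real.exp_le_exp, Real.exp_add]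
  simp only [exp_logRatio]
  exact ratio_triangle (M.posDef_sq x) (M.posDef_sq y) (M.posDef_sq z)

theorem logRatio_self (x : X) : M.logRatio x x = 0 := by
  refine le_antisymm (M.logRatio_le_iff.2 ?_) ?_
  · rw [Real.exp_zero, one_smul]
  · linarith [M.logRatio_triangle x x x]

theorem excess_nonneg (x y z : X) : 0 ≤ M.excess x y z := by
  unfold excess
  linarith [M.logRatio_triangle y x z]

theorem dist_eq_logRatio (x y : X) : M.dist x y = (M.logRatio x y + M.logRatio y x) / 2 := by
  obtain ⟨g, hg, b, h₁₀, h₂₁, hx, hy⟩ :=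
    exists_map_eq_one_diagonal (M.posDef_sq x) (M.det_sq x) (M.sq y)
  have hg' := genGroup_le_orderGroup hg
  have pos : ∀ i, 0 < b i := by
    refine posDef_diagonal_iff.1 (posDef_of_det_ne_zero (A := A) ?_ ?_) <;> rw [← hy]
    · exact (map_nonneg_iff hg').2 (M.posDef_sq y).nonneg
    · rw [genGroup_le_detGroup hg, M.det_sq]
      exact one_ne_zero
  have max : ∀ j, b j ≤ b 0 := Fin.forall_fin_succ.2 ⟨le_rfl, Fin.forall_fin_two.2
    ⟨h₁₀, h₂₁.trans h₁₀⟩⟩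
  have min : ∀ j, b 2 ≤ b j := Fin.forall_fin_succ.2 ⟨h₂₁.trans h₁₀, Fin.forall_fin_two.2
    ⟨h₂₁, le_rfl⟩⟩
  rw [M.dist_eq x y g hg b pos h₁₀ h₂₁ hx hy, logRatio, logRatio, ← ratio_map hg',
    ← ratio_map hg' (M.sq y), hx, hy, ratio_one_diagonal 0 max, ratio_diagonal pos 2]
  · simp only [Pi.one_apply, one_div, Real.log_inv]
    ring
  · intro j
    have := min j
    have h₂ := pos 2
    simp only [Pi.one_apply]
    gcongr

theorem dist_comm (x y : X) : M.dist x y = M.dist y x := by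
  rw [dist_eq_logRatio, dist_eq_logRatio, add_comm]

theorem dist_self (x : X) : M.dist x x = 0 := by simp [dist_eq_logRatio, logRatio_self]

theorem dist_triangle (x y z : X) : M.dist x z ≤ M.dist x y + M.dist y z := by
  simp only [dist_eq_logRatio]
  linarith [M.logRatio_triangle x y z, M.logRatio_triangle z y x]

theorem dist_nonneg (x y : X) : 0 ≤ M.dist x y := by
  linarith [M.dist_triangle x y x, M.dist_self x, M.dist_comm y x]

end Distance

section Retraction

theorem exists_smul_eq_sq {P : Herm3 A} (hP : PosDef P) : ∃ x, ∃ s : ℝ,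
    M.sq x = Real.exp s • P := by
  obtain ⟨c, hc, h⟩ := hP.exists_det_smul_eq_one
  obtain ⟨x, hx⟩ := M.exists_sq _ (hP.smul hc) h
  exact ⟨x, Real.log c, by rw [hx, Real.exp_log hc]⟩

theorem exists_retraction (x y z : X) {l : ℝ} (hl : 0 ≤ l) (hy : l ≤ M.excess x y z)
    (hz : l ≤ M.excess x z y) :
    ∃ x' s, M.logRatio x' x ≤ -s ∧ M.logRatio x x' ≤ l + Real.log 3 + s ∧
      M.logRatio x' y ≤ M.logRatio x y - l - s ∧
      M.logRatio y x' ≤ M.logRatio y x + Real.log 3 + s ∧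
      M.logRatio x' z ≤ M.logRatio x z - l - s ∧
      M.logRatio z x' ≤ M.logRatio z x + Real.log 3 + s := by
  have hx₀ := M.posDef_sq x
  have hy₀ := M.posDef_sq y
  have hz₀ := M.posDef_sq z
  have hl' := Real.exp_pos l
  have h3 : (3 : ℝ) = Real.exp (Real.log 3) := (Real.exp_log three_pos).symm
  set P := retraction (Real.exp l) (M.sq x) (M.sq y) (M.sq z)
  have le_P : M.sq x ≤ P := le_retraction hx₀ hy₀ hz₀ hl'.le
  have hP : PosDef P := hx₀.mono le_P
  obtain ⟨x', s, hx'⟩ := M.exists_smul_eq_sq hP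
  have left {w : X} {r : ℝ} (h : ratio P (M.sq w) ≤ Real.exp r) : M.logRatio x' w ≤ r - s := by
    rw [logRatio_le_iff, hx', smul_smul, ← Real.exp_add, sub_add_cancel]
    exact (ratio_le_iff hP).1 h
  have right {w : X} {r : ℝ} (h : ratio (M.sq w) P ≤ Real.exp r) : M.logRatio w x' ≤ r + s := by
    rw [logRatio_le_iff, hx', add_comm, Real.exp_add, mul_smul]
    exact smul_le_smul_of_nonneg_left ((ratio_le_iff (M.posDef_sq w)).1 h) (Real.exp_pos s).le
  have excess_spec {u v : X} (h : l ≤ M.excess x u v) : Real.exp l * ratio (M.sq u) (M.sq v) ≤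
      ratio (M.sq u) (M.sq x) * ratio (M.sq x) (M.sq v) := by
    simp only [← exp_logRatio, ← Real.exp_add, Real.exp_le_exp]
    unfold excess at h
    linarith
  refine ⟨x', s, (left (r := 0) ?_).trans_eq (zero_sub s), right ?_, left ?_, right ?_, left ?_,
    right ?_⟩
  · exact hP.ratio_le (by rwa [Real.exp_zero, one_smul])
  · rw [Real.exp_add, ← h3, mul_comm]
    exact ratio_retraction_right_le hx₀ hy₀ hz₀ (Real.one_le_exp hl)
  · rw [Real.exp_sub, exp_logRatio]
    exact ratio_retraction_left_le hx₀ hy₀ hz₀ hl'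
  · rw [Real.exp_add, ← h3, exp_logRatio, mul_comm]
    exact ratio_left_retraction_le hx₀ hy₀ hz₀ hl'.le (excess_spec hy)
  · rw [Real.exp_sub, exp_logRatio]
    simp only [P, retraction_comm _ _ (M.sq y)]
    exact ratio_retraction_left_le hx₀ hz₀ hy₀ hl'
  · rw [Real.exp_add, ← h3, exp_logRatio, mul_comm]
    simp only [P, retraction_comm _ _ (M.sq y)]
    exact ratio_left_retraction_le hx₀ hz₀ hy₀ hl'.le (excess_spec hz)

theorem exists_vertex_retraction (x y z : X) :
    ∃ x', M.dist x x' + M.dist x' y ≤ M.dist x y + Real.log 3 ∧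
      M.dist x x' + M.dist x' z ≤ M.dist x z + Real.log 3 ∧
      M.excess x' y z ≤ M.excess x y z - min (M.excess x y z) (M.excess x z y) + Real.log 3 ∧
      M.excess x' z y ≤ M.excess x z y - min (M.excess x y z) (M.excess x z y) + Real.log 3 ∧
      M.excess y z x' ≤ M.excess y z x + Real.log 3 ∧
      M.excess y x' z ≤ M.excess y x z + Real.log 3 ∧
      M.excess z x' y ≤ M.excess z x y + Real.log 3 ∧
      M.excess z y x' ≤ M.excess z y x + Real.log 3 := by
  have hl : 0 ≤ min (M.excess x y z) (M.excess x z y) :=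
    le_min (M.excess_nonneg _ _ _) (M.excess_nonneg _ _ _)
  obtain ⟨x', s, h⟩ := M.exists_retraction x y z hl (min_le_left _ _) (min_le_right _ _)
  have := M.logRatio_triangle y x' x
  have := M.logRatio_triangle z x' x
  have := M.logRatio_triangle x x' y
  have := M.logRatio_triangle x x' z
  generalize min (M.excess x y z) (M.excess x z y) = l at *
  refine ⟨x', ?_⟩
  simp only [dist_eq_logRatio, excess]
  refine ⟨?_, ?_, ?_, ?_, ?_, ?_, ?_, ?_⟩ <;> linarith

theorem exists_reduced_triangle (x y z : X) :
    ∃ x' y' z', M.dist x x' + M.dist x' y' + M.dist y' y ≤ M.dist x y + 2 * Real.log 3 ∧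
      M.dist y y' + M.dist y' z' + M.dist z' z ≤ M.dist y z + 2 * Real.log 3 ∧
      M.dist z z' + M.dist z' x' + M.dist x' x ≤ M.dist z x + 2 * Real.log 3 ∧
      (M.excess x' y' z' ≤ 3 * Real.log 3 ∨ M.excess x' z' y' ≤ 3 * Real.log 3) ∧
      (M.excess y' z' x' ≤ 3 * Real.log 3 ∨ M.excess y' x' z' ≤ 3 * Real.log 3) ∧
      (M.excess z' x' y' ≤ 3 * Real.log 3 ∨ M.excess z' y' x' ≤ 3 * Real.log 3) := by
  have h3 : 0 < Real.log 3 := Real.log_pos (by norm_num)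
  obtain ⟨x', xy, xz, hx, hx', -⟩ := M.exists_vertex_retraction x y z
  obtain ⟨y', yz, yx, hy, hy', hy''⟩ := M.exists_vertex_retraction y z x'
  obtain ⟨z', zx, zy, hz, hz', hz''⟩ := M.exists_vertex_retraction z x' y'
  have of_min {e e' a b : ℝ} (h : e ≤ a - min a b + Real.log 3)
      (h' : e' ≤ b - min a b + Real.log 3) : e ≤ Real.log 3 ∨ e' ≤ Real.log 3 := by
    rcases min_choice a b with hm | hm <;> rw [hm] at h h'
    · left; linarith
    · right; linarith
  refine ⟨x', y', z', ?_, ?_, ?_, (of_min hx hx').imp ?_ ?_, (of_min hy hy').imp ?_ ?_,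
    (of_min hz hz').imp ?_ ?_⟩
  · linarith [M.dist_comm y' y, M.dist_comm x' y', M.dist_comm x' y]
  · linarith [M.dist_comm z' z, M.dist_comm z y', M.dist_comm z' y']
  · linarith [M.dist_comm x' x, M.dist_comm x z, M.dist_comm x' z]
  all_goals intro h; linarith

end Retraction

section Equilateral

theorem dist_le_log {L : Herm3 A ≃ₗ[ℝ] Herm3 A} (hL : L ∈ orderGroup A) {x y : X} {D : Herm3 A}
    {K c c' : ℝ} (hK : 0 < K) (hc : 0 < c) (hc' : 0 < c') (hx : IsNear K (c • L (M.sq x)) D)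
    (hy : L (M.sq y) = c' • D) : M.dist x y ≤ Real.log K := by
  have h₁ : M.logRatio x y ≤ Real.log (c' * K * c) := by
    rw [logRatio_le_iff, Real.exp_log (by positivity), ← hL, map_smul, hy, mul_assoc, mul_smul,
      mul_smul]
    exact smul_le_smul_of_nonneg_left hx.2 hc'.le
  have h₂ : M.logRatio y x ≤ Real.log (c⁻¹ * K * c'⁻¹) := by
    rw [logRatio_le_iff, Real.exp_log (by positivity), ← hL, map_smul, hy, smul_smul,
      inv_mul_cancel_right₀ hc'.ne', mul_smul, ← inv_smul_smul₀ hc.ne' (L (M.sq x))]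
    exact smul_le_smul_of_nonneg_left hx.1 (inv_nonneg.2 hc.le)
  rw [Real.log_mul (by positivity) hc.ne', Real.log_mul hc'.ne' hK.ne'] at h₁
  rw [Real.log_mul (by positivity) (by positivity), Real.log_mul (by positivity) hK.ne',
    Real.log_inv, Real.log_inv] at h₂
  rw [dist_eq_logRatio]
  linarith

theorem exists_map_sq_eq {g : Herm3 A ≃ₗ[ℝ] Herm3 A} (hg : g ∈ genGroup A) {b : Fin 3 → ℝ}
    (hb : ∀ i, 0 < b i) (h1 : ∏ i, b i = 1) : ∃ x, g (M.sq x) = diagonal b := by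
  have hd : det (g.symm (diagonal b)) = 1 := by
    rw [← genGroup_le_detGroup hg, g.apply_symm_apply, det_diagonal, h1]
  have hp : PosDef (g.symm (diagonal b)) := by
    refine posDef_of_det_ne_zero ?_ (hd.trans_ne one_ne_zero)
    rw [← map_nonneg_iff (genGroup_le_orderGroup hg), g.apply_symm_apply, diagonal_nonneg_iff]
    exact fun i => (hb i).le
  obtain ⟨x, hx⟩ := M.exists_sq _ hp hd
  exact ⟨x, by rw [hx, g.apply_symm_apply]⟩

theorem exists_near_of_excess_le {C : ℝ} (hC : 0 < C) (x y z : X) (hx : M.excess x y z ≤ C)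
    (hy : M.excess y z x ≤ C) (hz : M.excess z x y ≤ C) :
    ∃ t, ∃ g ∈ genGroup A, ∃ y' z', g (M.sq x) = diagonal 1 ∧
      g (M.sq y') = diagonal (shapeVec t ^ 2) ∧ g (M.sq z') = diagonal (coshapeVec t ^ 2) ∧
      M.dist y y' ≤ Real.log (16 * Real.exp C ^ 3) ∧
      M.dist z z' ≤ Real.log (16 * Real.exp C ^ 3) := by
  have mul_le {u v w : X} (h : M.excess u v w ≤ C) : ratio (M.sq v) (M.sq u) *
      ratio (M.sq u) (M.sq w) ≤ Real.exp C * ratio (M.sq v) (M.sq w) := by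
    simp only [← exp_logRatio, ← Real.exp_add, Real.exp_le_exp]
    unfold excess at h
    linarith
  obtain ⟨g, hg, τ, q, r, hτ, hq, hr, map_x, near_y, near_z⟩ :=
    exists_isNear_equilateral_of_ratio_le (M.posDef_sq x) (M.posDef_sq y) (M.posDef_sq z)
      (M.det_sq x) (Real.one_lt_exp_iff.2 hC) (mul_le hx) (mul_le hy) (mul_le hz)
  have hg' := genGroup_le_orderGroup hg
  obtain ⟨t, rfl⟩ : ∃ t, τ = Real.exp (2 * t) :=
    ⟨Real.log τ / 2, by rw [mul_div_cancel₀ _ two_ne_zero, Real.exp_log (by linarith)]⟩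
  obtain ⟨y', hy'⟩ := M.exists_map_sq_eq hg (b := shapeVec t ^ 2)
    (fun i => pow_pos (shapeVec_pos t i) 2) (by simp [Finset.prod_pow, prod_shapeVec])
  obtain ⟨z', hz'⟩ := M.exists_map_sq_eq hg (b := coshapeVec t ^ 2)
    (fun i => pow_pos (coshapeVec_pos t i) 2) (by simp [Finset.prod_pow, prod_coshapeVec])
  refine ⟨t, g, hg, y', z', map_x, hy', hz',
    M.dist_le_log hg' (by positivity) hq (Real.exp_pos (-2 * t / 3)) near_y ?_,
    M.dist_le_log hg' (by positivity) hr (Real.exp_pos (-4 * t / 3)) near_z ?_⟩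
  · rw [hy', shapeVec_sq, smul_diagonal]
  · rw [hz', coshapeVec_sq, smul_diagonal]

theorem equilateral_zero (x : X) : M.Equilateral 0 x x x := by
  obtain ⟨g, hg, hx⟩ := exists_map_eq_one (M.posDef_sq x) (M.det_sq x)
  have e : (![1, 1, 1] : Fin 3 → ℝ) = 1 := by ext i; fin_cases i <;> rfl
  refine M.equilateral_spec 0 x x x g hg hx ?_ ?_ <;> simp [hx, e, shapeVec, coshapeVec]

theorem exists_equilateral_near (x y z : X) {C : ℝ} (hC : 0 < C)
    (hx : M.excess x y z ≤ C ∨ M.excess x z y ≤ C) (hy : M.excess y z x ≤ C ∨ M.excess y x z ≤ C)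
    (hz : M.excess z x y ≤ C ∨ M.excess z y x ≤ C) :
    ∃ x' y' z', (∃ t, M.Equilateral t x' y' z') ∧
      M.dist x x' ≤ Real.log (16 * Real.exp C ^ 3) ∧
      M.dist y y' ≤ Real.log (16 * Real.exp C ^ 3) ∧
      M.dist z z' ≤ Real.log (16 * Real.exp C ^ 3) := by
  have hK : 3 * C ≤ Real.log (16 * Real.exp C ^ 3) := by
    rw [Real.log_mul (by norm_num) (by positivity), Real.log_pow, Real.log_exp]
    have : 0 ≤ Real.log 16 := Real.log_nonneg (by norm_num)
    push_cast
    linarith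
  have hx₀ : M.dist x x ≤ Real.log (16 * Real.exp C ^ 3) := by rw [dist_self]; linarith
  have := M.logRatio_triangle x y z
  have := M.logRatio_triangle x z y
  have := M.logRatio_triangle y x z
  have := M.logRatio_triangle y z x
  have := M.logRatio_triangle z x y
  have := M.logRatio_triangle z y x
  rcases hx with hx | hx <;> rcases hy with hy | hy <;> rcases hz with hz | hz
  case inl.inl.inl =>
    obtain ⟨t, g, hg, y', z', hx, hy, hz, dy, dz⟩ := M.exists_near_of_excess_le hC x y z hx hy hz
    exact ⟨x, y', z', ⟨t, M.equilateral_spec t _ _ _ g hg hx hy hz⟩, hx₀, dy, dz⟩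
  case inr.inr.inr =>
    obtain ⟨t, g, hg, z', y', hx, hz, hy, dz, dy⟩ := M.exists_near_of_excess_le hC x z y hx hz hy
    exact ⟨x, y', z', ⟨-t, equilateral_neg hg hx hy hz⟩, hx₀, dy, dz⟩
  -- Two small excesses of opposite orientations bound the diameter of the triangle.
  all_goals
    refine ⟨x, x, x, ⟨0, M.equilateral_zero x⟩, hx₀, ?_, ?_⟩ <;>
      refine le_trans ?_ hK <;> unfold excess at hx hy hz <;> rw [dist_eq_logRatio] <;> linarith

theorem dist_add_dist_add_dist_le {u u₁ u' v v₁ v' : X} {K δ : ℝ} (hu : M.dist u₁ u' ≤ K)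
    (hv : M.dist v₁ v' ≤ K) (h : M.dist u u₁ + M.dist u₁ v₁ + M.dist v₁ v ≤ M.dist u v + δ) :
    M.dist u u' + M.dist u' v' + M.dist v' v ≤ M.dist u v + (δ + 4 * K) := by
  have := M.dist_triangle u u₁ u'
  have := M.dist_triangle u' u₁ v'
  have := M.dist_triangle u₁ v₁ v'
  have := M.dist_triangle v' v₁ v
  linarith [M.dist_comm u' u₁, M.dist_comm v' v₁]

theorem exists_equilateral_retraction :
    ∃ δ : ℝ, 0 < δ ∧ ∀ x y z, ∃ x' y' z', (∃ t, M.Equilateral t x' y' z') ∧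
      M.dist x x' + M.dist x' y' + M.dist y' y ≤ M.dist x y + δ ∧
      M.dist y y' + M.dist y' z' + M.dist z' z ≤ M.dist y z + δ ∧
      M.dist z z' + M.dist z' x' + M.dist x' x ≤ M.dist z x + δ := by
  have : 0 < Real.log 3 := Real.log_pos (by norm_num)
  set K := Real.log (16 * Real.exp (3 * Real.log 3) ^ 3)
  have hK : 0 ≤ K := Real.log_nonneg
    (one_le_mul_of_one_le_of_one_le (by norm_num) (one_le_pow₀ (Real.one_le_exp (by positivity))))
  refine ⟨2 * Real.log 3 + 4 * K, by positivity, fun x y z => ?_⟩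
  obtain ⟨x₁, y₁, z₁, xy, yz, zx, hx, hy, hz⟩ := M.exists_reduced_triangle x y z
  obtain ⟨x', y', z', ht, dx, dy, dz⟩ :=
    M.exists_equilateral_near x₁ y₁ z₁ (by positivity) hx hy hz
  exact ⟨x', y', z', ht, M.dist_add_dist_add_dist_le dx dy xy,
    M.dist_add_dist_add_dist_le dy dz yz, M.dist_add_dist_add_dist_le dz dx zx⟩

end Equilateral

section Shape

theorem cycle_le_of_shape {s t : ℝ} (hst : 0 ≤ s * t) {z v w y : X} (hz : M.Shape t v z)
    (hy : M.Shape s w y) :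
    cycle (M.sq z) (M.sq y) (M.sq v) ≤ 6 * (ratio (M.sq v) (M.sq w) * ratio (M.sq w) (M.sq v)) ^ 2 *
      cycle (M.sq z) (M.sq v) (M.sq y) := by
  obtain ⟨L₁, hL₁, hV, hZ⟩ := M.shape_spec t v z hz
  obtain ⟨L₂, hL₂, hW, hY⟩ := M.shape_spec s w y hy
  rcases mul_nonneg_iff.1 hst with ⟨hs, ht⟩ | ⟨hs, ht⟩
  · rw [diagonal_shapeVec_sq_eq_smul_spike] at hZ hY
    exact cycle_le (Or.inl rfl) hL₁ hL₂ (M.posDef_sq v) (M.posDef_sq w) (Real.exp_pos _)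
      (Real.exp_pos _) (Real.one_le_exp (by linarith)) (Real.one_le_exp (by linarith)) hV hZ hW hY
  · rw [diagonal_shapeVec_sq_eq_smul_spike'] at hZ hY
    exact cycle_le (Or.inr rfl) hL₁ hL₂ (M.posDef_sq v) (M.posDef_sq w) (Real.exp_pos _)
      (Real.exp_pos _) (Real.one_le_exp (by linarith)) (Real.one_le_exp (by linarith)) hV hZ hW hY

theorem excess_le_excess_of_shape {s t : ℝ} (hst : 0 ≤ s * t) {z v w y : X} (hz : M.Shape t v z)
    (hy : M.Shape s w y) :
    M.excess v y z ≤ M.excess v z y + Real.log 6 + 4 * M.dist v w := by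
  have h6 : (6 : ℝ) = Real.exp (Real.log 6) := (Real.exp_log (by norm_num)).symm
  have key := M.cycle_le_of_shape hst hz hy
  rw [h6] at key
  simp only [cycle, ← exp_logRatio, ← Real.exp_add, exp_sq, Real.exp_le_exp] at key
  rw [dist_eq_logRatio]
  unfold excess
  linarith

theorem exists_retraction_of_shape {s t δ₀ : ℝ} (hst : 0 ≤ s * t) {z v w y : X}
    (hvw : M.dist v w < δ₀) (hz : M.Shape t v z) (hy : M.Shape s w y) :
    ∃ u, M.dist z u + M.dist u v ≤ M.dist z v + (Real.log 3 + Real.log 6 + 4 * δ₀) ∧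
      M.dist v u + M.dist u y ≤ M.dist v y + (Real.log 3 + Real.log 6 + 4 * δ₀) ∧
      M.dist y u + M.dist u z ≤ M.dist y z + (Real.log 3 + Real.log 6 + 4 * δ₀) := by
  have h6 : 0 < Real.log 6 := Real.log_pos (by norm_num)
  have hd := M.dist_nonneg v w
  have le₁ := M.excess_le_excess_of_shape hst hz hy
  have le₂ : M.excess v z y ≤ M.excess v y z + Real.log 6 + 8 * M.dist v w := by
    have := M.excess_le_excess_of_shape (by rwa [mul_comm]) hy hz
    rw [M.dist_comm w v] at this
    rw [dist_eq_logRatio] at this ⊢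
    unfold excess at this ⊢
    linarith [M.logRatio_triangle z w v, M.logRatio_triangle v w y, M.logRatio_triangle y v w,
      M.logRatio_triangle w v z]
  obtain ⟨u, uz, uy, hu, hu', -⟩ := M.exists_vertex_retraction v z y
  refine ⟨u, ?_, ?_, ?_⟩
  · linarith [M.dist_comm z u, M.dist_comm u v, M.dist_comm z v]
  · linarith
  · have : M.excess u z y + M.excess u y z ≤ 2 * Real.log 3 + Real.log 6 + 8 * M.dist v w := by
      rcases min_choice (M.excess v z y) (M.excess v y z) with h | h <;> rw [h] at hu hu' <;>
        linarith
    simp only [dist_eq_logRatio] at this hvw ⊢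
    unfold excess at this
    linarith

end Shape

end ConeModel

/-! ## The octonionic space -/

namespace Herm3

variable {A : Type*} [NormedAddCommGroup A] [InnerProductSpace ℝ A] [SymmetricComposition A]

/-- The Jordan square `X ⋆ X`, in the form given by the Cayley–Hamilton identity. -/
def square (X : Herm3 A) : Herm3 A :=
  adjugate X + trace X • X - trace (adjugate X) • diagonal 1

theorem square_map {g : Herm3 A ≃ₗ[ℝ] Herm3 A} (hg : g ∈ unitGroup A) (X : Herm3 A) :
    square (g X) = g (square X) := by
  simp only [square, map_sub, map_add, map_smul, adjugate_map hg, trace_map hg,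
    map_one_of_mem_unitGroup hg]

theorem square_diagonal (b : Fin 3 → ℝ) : square (diagonal b : Herm3 A) = diagonal (b ^ 2) := by
  ext i
  · fin_cases i <;> simp [square, adjugate, trace_apply, Fin.sum_univ_three] <;> ring
  · fin_cases i <;> simp [square, adjugate]

theorem forall_le_iff_of_map {h : Herm3 A ≃ₗ[ℝ] Herm3 A} (hh : h ∈ unitGroup A)
    {a b : Fin 3 → ℝ} (hab : h (diagonal a) = diagonal b) (c : ℝ) :
    (∀ i, a i ≤ c) ↔ ∀ i, b i ≤ c := by
  rw [← diagonal_le_smul_one_iff (A := A), ← map_le_one_iff hh, hab, diagonal_le_smul_one_iff]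

theorem forall_ge_iff_of_map {h : Herm3 A ≃ₗ[ℝ] Herm3 A} (hh : h ∈ unitGroup A)
    {a b : Fin 3 → ℝ} (hab : h (diagonal a) = diagonal b) (c : ℝ) :
    (∀ i, c ≤ a i) ↔ ∀ i, c ≤ b i := by
  rw [← smul_one_le_diagonal_iff (A := A), ← one_le_map_iff hh, hab, smul_one_le_diagonal_iff]

variable [Nontrivial A] [FiniteDimensional ℝ A]

theorem det_square (X : Herm3 A) : det (square X) = det X ^ 2 := by
  obtain ⟨k, hk, b, -, -, hb⟩ := exists_map_eq_diagonal X
  have hku := rotGroup_le_unitGroup hk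
  rw [← hku.1 (square X), ← hku.1 X, ← square_map hku, hb, square_diagonal, det_diagonal,
    det_diagonal, ← Finset.prod_pow]
  rfl

theorem PosDef.square {X : Herm3 A} (h : X.PosDef) : X.square.PosDef := by
  obtain ⟨k, hk, b, -, -, hb⟩ := exists_map_eq_diagonal X
  have hku := rotGroup_le_unitGroup hk
  rw [← posDef_map_iff hku, hb, posDef_diagonal_iff] at h
  rw [← posDef_map_iff hku, ← square_map hku, hb, square_diagonal, posDef_diagonal_iff]
  exact fun i => pow_pos (h i) 2

theorem PosDef.exists_square_eq {P : Herm3 A} (h : P.PosDef) :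
    ∃ X : Herm3 A, X.PosDef ∧ X.square = P := by
  obtain ⟨k, hk, b, -, -, hb⟩ := exists_map_eq_diagonal P
  have hku := rotGroup_le_unitGroup hk
  have sqrt_map : k (k⁻¹ (diagonal fun i => √(b i))) = diagonal fun i => √(b i) :=
    k.apply_symm_apply _
  rw [← posDef_map_iff hku, hb, posDef_diagonal_iff] at h
  refine ⟨k⁻¹ (diagonal fun i => √(b i)), ?_, k.injective ?_⟩
  · rw [← posDef_map_iff hku, sqrt_map, posDef_diagonal_iff]
    exact fun i => Real.sqrt_pos.2 (h i)
  · rw [← square_map hku, sqrt_map, square_diagonal, hb]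
    congr 1
    ext i
    exact Real.sq_sqrt (h i).le

theorem mem_orderGroup_of_map_eq_one {g : Herm3 A ≃ₗ[ℝ] Herm3 A} (hg : g ∈ detGroup A)
    {P : Herm3 A} (hP : P.PosDef) (h1 : g P = diagonal 1) : g ∈ orderGroup A := by
  have det_P : det P = 1 := by simp [← hg P, h1, det_diagonal]
  obtain ⟨h, hh, hhP⟩ := exists_map_eq_one hP det_P
  have unit : g * h⁻¹ ∈ unitGroup A := by
    have det_mem : g * h⁻¹ ∈ detGroup A := mul_mem hg (inv_mem (genGroup_le_detGroup hh))
    refine ⟨det_mem, ?_⟩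
    change (g * h⁻¹) (diagonal 1) = diagonal 1
    rw [← hhP, LinearEquiv.mul_apply, show h⁻¹ (h P) = P from h.symm_apply_apply P, h1, hhP]
  have := mul_mem (unitGroup_le_orderGroup unit) (genGroup_le_orderGroup hh)
  rwa [inv_mul_cancel_right] at this

end Herm3

theorem ciSup_eq_sqrt {ι : Type*} [Finite ι] [Nonempty ι] {a : ι → ℝ} (ha : ∀ i, 0 ≤ a i) {s : ℝ}
    (h : ∀ c, (∀ i, a i ^ 2 ≤ c) ↔ s ≤ c) : ⨆ i, a i = √s := by
  refine eq_of_forall_ge_iff fun c => ?_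
  rw [ciSup_le_iff (Set.finite_range a).bddAbove]
  rcases le_or_gt 0 c with hc | hc
  · simp_rw [Real.sqrt_le_left hc, ← h, sq_le_sq₀ (ha _) hc]
  · obtain ⟨i⟩ := ‹Nonempty ι›
    exact iff_of_false (fun h => (hc.trans_le (ha i)).not_ge (h i))
      (hc.trans_le (Real.sqrt_nonneg s)).not_ge

theorem ciSup_inv_eq_inv_sqrt {ι : Type*} [Finite ι] [Nonempty ι] {a : ι → ℝ}
    (ha : ∀ i, 0 < a i) {s : ℝ} (hs : 0 < s) (h : ∀ c, (∀ i, c ≤ a i ^ 2) ↔ c ≤ s) :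
    ⨆ i, (a i)⁻¹ = (√s)⁻¹ := by
  rw [← Real.sqrt_inv]
  refine ciSup_eq_sqrt (fun i => (inv_pos.2 (ha i)).le) fun c => ?_
  rcases lt_or_ge 0 c with hc | hc
  · simp_rw [inv_pow, inv_le_comm₀ (pow_pos (ha _) 2) hc, h, inv_le_comm₀ hs hc]
  · obtain ⟨i⟩ := ‹Nonempty ι›
    exact iff_of_false
      (fun h => (hc.trans_lt (pow_pos (inv_pos.2 (ha i)) 2)).not_ge (h i))
      (hc.trans_lt (inv_pos.2 hs)).not_ge

namespace Octonion

/-- The real part of `x * star y`. -/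
instance : Inner ℝ Octonion := ⟨fun x y => ⟪x.fst, y.fst⟫_ℝ + ⟪x.snd, y.snd⟫_ℝ⟩

theorem inner_def (x y : Octonion) : ⟪x, y⟫_ℝ = ⟪x.fst, y.fst⟫_ℝ + ⟪x.snd, y.snd⟫_ℝ := rfl

/-- The Euclidean structure of the octonions. -/
@[reducible] def innerCore : InnerProductSpace.Core ℝ Octonion where
  conj_inner_symm x y := by simp [inner_def, real_inner_comm]
  re_inner_nonneg x := by
    simp only [inner_def, real_inner_self_eq_norm_sq, RCLike.re_to_real]; positivity
  add_left x y z := by simp only [inner_def, add_fst, add_snd, inner_add_left]; ring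
  smul_left x y r := by
    simp only [inner_def, smul_fst, smul_snd, real_inner_smul_left, conj_trivial]; ring
  definite x h := by
    rw [inner_def, add_eq_zero_iff_of_nonneg real_inner_self_nonneg real_inner_self_nonneg,
      inner_self_eq_zero, inner_self_eq_zero] at h
    exact Octonion.ext h.1 h.2

instance : NormedAddCommGroup Octonion := innerCore.toNormedAddCommGroup

instance : InnerProductSpace ℝ Octonion := InnerProductSpace.ofCore innerCore.toCore

theorem norm_sq_eq (x : Octonion) : ‖x‖ ^ 2 =
    x.fst.re ^ 2 + x.fst.imI ^ 2 + x.fst.imJ ^ 2 + x.fst.imK ^ 2 +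
      (x.snd.re ^ 2 + x.snd.imI ^ 2 + x.snd.imJ ^ 2 + x.snd.imK ^ 2) := by
  rw [← real_inner_self_eq_norm_sq]
  change ⟪x.fst, x.fst⟫_ℝ + ⟪x.snd, x.snd⟫_ℝ = _
  rw [Quaternion.inner_self, Quaternion.inner_self, Quaternion.normSq_def', Quaternion.normSq_def']

instance : StarModule ℝ Octonion := ⟨fun r x => by ext1 <;> simp⟩

instance : IsScalarTower ℝ Octonion Octonion :=
  ⟨fun r x y => by ext1 <;> simp [smul_sub, smul_add]⟩

instance : SMulCommClass ℝ Octonion Octonion :=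
  ⟨fun r x y => by ext1 <;> simp [smul_sub, smul_add]⟩

theorem inner_star_mul_left (x y z : Octonion) : ⟪star (x * y), z⟫_ℝ = re (x * y * z) := by
  change ⟪(star (x * y)).fst, z.fst⟫_ℝ + ⟪(star (x * y)).snd, z.snd⟫_ℝ = _
  simp only [Quaternion.inner_def, re, star_fst, star_snd, mul_fst, mul_snd, Quaternion.re_sub,
    Quaternion.re_mul, Quaternion.re_star, Quaternion.imI_star, Quaternion.imJ_star,
    Quaternion.imK_star, Quaternion.imI_sub, Quaternion.imJ_sub, Quaternion.imK_sub,
    Quaternion.imI_mul, Quaternion.imJ_mul, Quaternion.imK_mul, Quaternion.re_add,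
    Quaternion.imI_add, Quaternion.imJ_add, Quaternion.imK_add, Quaternion.re_neg,
    Quaternion.imI_neg, Quaternion.imJ_neg, Quaternion.imK_neg]
  ring

theorem inner_star_mul_right (x y z : Octonion) : ⟪x, star (y * z)⟫_ℝ = re (x * y * z) := by
  rw [← real_inner_comm]
  change ⟪(star (y * z)).fst, x.fst⟫_ℝ + ⟪(star (y * z)).snd, x.snd⟫_ℝ = _
  simp only [Quaternion.inner_def, re, star_fst, star_snd, mul_fst, mul_snd, Quaternion.re_sub,
    Quaternion.re_mul, Quaternion.re_star, Quaternion.imI_star, Quaternion.imJ_star,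
    Quaternion.imK_star, Quaternion.imI_sub, Quaternion.imJ_sub, Quaternion.imK_sub,
    Quaternion.imI_mul, Quaternion.imJ_mul, Quaternion.imK_mul, Quaternion.re_add,
    Quaternion.imI_add, Quaternion.imJ_add, Quaternion.imK_add, Quaternion.re_neg,
    Quaternion.imI_neg, Quaternion.imJ_neg, Quaternion.imK_neg]
  ring

theorem star_mul_mul_cancel (x y : Octonion) : star x * (x * y) = ‖x‖ ^ 2 • y := by
  rw [norm_sq_eq]
  ext <;> simp <;> ring

theorem mul_mul_star_cancel (x y : Octonion) : y * x * star x = ‖x‖ ^ 2 • y := by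
  rw [norm_sq_eq]
  ext <;> simp <;> ring

instance : SymmetricComposition Octonion where
  mul := LinearMap.mk₂ ℝ (fun x y => star (x * y)) (fun x y z => by rw [add_mul, star_add])
    (fun r x y => by rw [smul_mul_assoc, star_smul, star_trivial])
    (fun x y z => by rw [mul_add, star_add])
    (fun r x y => by rw [mul_smul_comm, star_smul, star_trivial])
  inner_mul x y z := (inner_star_mul_left x y z).trans (inner_star_mul_right x y z).symm
  mul_mul_cancel_left x y := by
    change star (star (x * y) * x) = _
    rw [star_mul, star_star, star_mul_mul_cancel]
  mul_mul_cancel_right x y := by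
    change star (x * star (y * x)) = _
    rw [star_mul, star_star, mul_mul_star_cancel]

instance : Nontrivial Octonion := ⟨⟨0, 1, fun h => zero_ne_one (congrArg (fun x => x.fst.re) h)⟩⟩

instance : FiniteDimensional ℝ Octonion :=
  FiniteDimensional.of_injective (V₂ := Quaternion ℝ × Quaternion ℝ)
    { toFun := fun x : Octonion => (x.fst, x.snd), map_add' := fun _ _ => rfl,
      map_smul' := fun _ _ => rfl } toProd_injective

theorem mul_def (x y : Octonion) : SymmetricComposition.mul x y = star (x * y) := rfl

theorem norm_sq_eq_normSq (x : Octonion) : ‖x‖ ^ 2 = normSq x := by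
  simp [norm_sq_eq, normSq, re]
  ring

theorem re_mul_star_self (x : Octonion) : re (x * star x) = ‖x‖ ^ 2 :=
  (norm_sq_eq_normSq x).symm

theorem re_star_mul_self (x : Octonion) : re (star x * x) = ‖x‖ ^ 2 := by
  simp [norm_sq_eq, re]
  ring

@[simp] theorem re_add (x y : Octonion) : re (x + y) = re x + re y := rfl

@[simp] theorem re_smul (r : ℝ) (x : Octonion) : re (r • x) = r * re x := rfl

@[simp] theorem re_ofReal (r : ℝ) : re (ofReal r) = r := rfl

@[simp] theorem star_ofReal (r : ℝ) : star (ofReal r) = ofReal r := by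
  ext1 <;> simp [ofReal]

theorem ofReal_eq_smul_one (r : ℝ) : ofReal r = r • (1 : Octonion) :=
  Octonion.ext (Algebra.algebraMap_eq_smul_one (A := Quaternion ℝ) r) (smul_zero r).symm

theorem ofReal_mul (r : ℝ) (x : Octonion) : ofReal r * x = r • x := by
  rw [ofReal_eq_smul_one, smul_mul_assoc, one_mul]

theorem mul_ofReal (r : ℝ) (x : Octonion) : x * ofReal r = r • x := by
  rw [ofReal_eq_smul_one, mul_smul_comm, mul_one]

theorem ofReal_re {x : Octonion} (h : star x = x) : ofReal (re x) = x :=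
  haveI : IsAddTorsionFree (Quaternion ℝ) := .of_module_rat _
  Octonion.ext (Quaternion.star_eq_self.1 (congrArg Octonion.fst h)).symm
    (neg_eq_self.1 (congrArg Octonion.snd h)).symm

end Octonion

namespace Albert

open Octonion

theorem star_apply (M : Albert) (i j : Fin 3) : star (M.1 i j) = M.1 j i :=
  congrFun (congrFun M.2 j) i

/-- The exceptional Jordan algebra in coordinates. -/
def toHerm : Albert ≃ₗ[ℝ] Herm3 Octonion where
  toFun M := ⟨![(M.1 0 0).re, (M.1 1 1).re, (M.1 2 2).re], ![M.1 1 2, M.1 2 0, M.1 0 1]⟩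
  map_add' M N := by ext1 <;> ext1 i <;> fin_cases i <;> rfl
  map_smul' r M := by ext1 <;> ext1 i <;> fin_cases i <;> rfl
  invFun X := ⟨!![ofReal (X.diag 0), X.off 2, star (X.off 1);
      star (X.off 2), ofReal (X.diag 1), X.off 0;
      X.off 1, star (X.off 0), ofReal (X.diag 2)], by
    change Matrix.conjTranspose _ = _
    ext1 i j
    rw [Matrix.conjTranspose_apply]
    fin_cases i <;> fin_cases j <;> simp⟩
  left_inv M := by
    apply Subtype.ext
    ext1 i j
    fin_cases i <;> fin_cases j <;> simp [star_apply, ofReal_re (star_apply M _ _)]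
  right_inv X := by ext1 <;> ext1 i <;> fin_cases i <;> simp

theorem toHerm_apply (M : Albert) : toHerm M =
    ⟨![(M.1 0 0).re, (M.1 1 1).re, (M.1 2 2).re], ![M.1 1 2, M.1 2 0, M.1 0 1]⟩ := rfl

theorem toHerm_symm_val (X : Herm3 Octonion) : (toHerm.symm X).1 =
    !![ofReal (X.diag 0), X.off 2, star (X.off 1); star (X.off 2), ofReal (X.diag 1), X.off 0;
      X.off 1, star (X.off 0), ofReal (X.diag 2)] := rfl

theorem toHerm_diag (a : Fin 3 → ℝ) : toHerm (Albert.diag a) = diagonal a := by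
  ext i <;> fin_cases i <;> simp [toHerm_apply, Albert.diag]

theorem det_toHerm (M : Albert) : (toHerm M).det = Albert.det M := by
  simp only [Herm3.det, Albert.det, toHerm_apply, Fin.prod_univ_three, Fin.sum_univ_three,
    Matrix.cons_val_zero, Matrix.cons_val_one, Matrix.cons_val, norm_sq_eq_normSq,
    Octonion.mul_def, inner_star_mul_left]

theorem jmul_self_val (M : Albert) : (jmul M M).1 = M.1 * M.1 := by
  change (1 / 2 : ℝ) • (M.1 * M.1 + M.1 * M.1) = _
  module

theorem toHerm_jmul_self_diag (X : Herm3 Octonion) (i : Fin 3) :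
    (toHerm (jmul (toHerm.symm X) (toHerm.symm X))).diag i = X.square.diag i := by
  rw [toHerm_apply, jmul_self_val, toHerm_symm_val]
  fin_cases i <;>
    simp [Matrix.mul_apply, Fin.sum_univ_three, square, adjugate, trace_apply, re_mul_star_self,
      re_star_mul_self, Octonion.ofReal_mul] <;> ring

theorem toHerm_jmul_self_off (X : Herm3 Octonion) (i : Fin 3) :
    (toHerm (jmul (toHerm.symm X) (toHerm.symm X))).off i = X.square.off i := by
  rw [toHerm_apply, jmul_self_val, toHerm_symm_val]
  fin_cases i <;>
    simp [Matrix.mul_apply, Fin.sum_univ_three, square, adjugate, trace_apply,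
      Octonion.ofReal_mul, mul_ofReal, Octonion.mul_def] <;> module

theorem toHerm_jmul_self (M : Albert) : toHerm (jmul M M) = (toHerm M).square := by
  obtain ⟨X, rfl⟩ := toHerm.symm.surjective M
  rw [LinearEquiv.apply_symm_apply]
  exact Herm3.ext (funext (toHerm_jmul_self_diag X)) (funext (toHerm_jmul_self_off X))

/-- The linear automorphisms of the exceptional Jordan algebra in coordinates. -/
def toHermAut : (Albert ≃ₗ[ℝ] Albert) ≃ (Herm3 Octonion ≃ₗ[ℝ] Herm3 Octonion) where
  toFun g := toHerm.symm ≪≫ₗ g ≪≫ₗ toHerm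
  invFun g := toHerm ≪≫ₗ g ≪≫ₗ toHerm.symm
  left_inv g := by ext1; simp
  right_inv g := by ext1; simp

theorem toHermAut_toHerm (g : Albert ≃ₗ[ℝ] Albert) (M : Albert) :
    toHermAut g (toHerm M) = toHerm (g M) := by
  simp [toHermAut]

theorem toHermAut_mem_detGroup_iff {g : Albert ≃ₗ[ℝ] Albert} :
    toHermAut g ∈ detGroup Octonion ↔ g ∈ E6 := by
  refine toHerm.surjective.forall.trans (forall_congr' fun M => ?_)
  rw [toHermAut_toHerm, det_toHerm, det_toHerm]

theorem toHermAut_mem_unitGroup_iff {g : Albert ≃ₗ[ℝ] Albert} :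
    toHermAut g ∈ unitGroup Octonion ↔ g ∈ F4 := by
  refine and_congr toHermAut_mem_detGroup_iff ?_
  change toHermAut g (diagonal 1) = diagonal 1 ↔ _
  rw [← toHerm_diag, toHermAut_toHerm, toHerm.injective.eq_iff]

theorem positive_iff {M : Albert} : Positive M ↔ (toHerm M).PosDef := by
  constructor
  · rintro ⟨k, hk, a, ha, h⟩
    rw [← posDef_map_iff (toHermAut_mem_unitGroup_iff.2 hk), toHermAut_toHerm, h, toHerm_diag,
      posDef_diagonal_iff]
    exact ha
  · intro hM
    obtain ⟨k', hk', b, -, -, hb⟩ := exists_map_eq_diagonal (toHerm M)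
    obtain ⟨k, rfl⟩ := toHermAut.surjective k'
    have hk := rotGroup_le_unitGroup hk'
    rw [← posDef_map_iff hk, hb, posDef_diagonal_iff] at hM
    rw [toHermAut_toHerm, ← toHerm_diag] at hb
    exact ⟨k, toHermAut_mem_unitGroup_iff.1 hk, b, hM, toHerm.injective hb⟩

end Albert

namespace XO

open Albert

/-- The square of a point, in coordinates. -/
def sq (M : XO) : Herm3 Octonion := (toHerm M.1).square

theorem posDef_toHerm (M : XO) : (toHerm M.1).PosDef := positive_iff.1 M.2.2

theorem det_toHerm (M : XO) : (toHerm M.1).det = 1 := (Albert.det_toHerm M.1).trans M.2.1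

theorem exists_toHerm_eq {X : Herm3 Octonion} (hX : X.PosDef) (h1 : X.det = 1) :
    ∃ M : XO, toHerm M.1 = X := by
  obtain ⟨M, rfl⟩ := toHerm.surjective X
  exact ⟨⟨M, (Albert.det_toHerm M).symm.trans h1, positive_iff.2 hX⟩, rfl⟩

theorem posDef_sq (M : XO) : M.sq.PosDef := M.posDef_toHerm.square

theorem det_sq (M : XO) : M.sq.det = 1 := by rw [sq, det_square, M.det_toHerm, one_pow]

theorem exists_sq_eq {P : Herm3 Octonion} (hP : P.PosDef) (h1 : P.det = 1) :
    ∃ M : XO, M.sq = P := by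
  obtain ⟨X, hX, rfl⟩ := hP.exists_square_eq
  rw [det_square, pow_eq_one_iff_of_nonneg hX.det_pos.le two_ne_zero] at h1
  obtain ⟨M, rfl⟩ := exists_toHerm_eq hX h1
  exact ⟨M, rfl⟩

theorem exists_isDiag {a : Fin 3 → ℝ} (ha : ∀ i, 0 < a i) (h1 : ∏ i, a i = 1) :
    ∃ M : XO, IsDiagO M a := by
  obtain ⟨M, hM⟩ := exists_toHerm_eq (posDef_diagonal_iff.2 ha) ((det_diagonal a).trans h1)
  exact ⟨M, toHerm.injective (hM.trans (toHerm_diag a).symm)⟩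

theorem exists_isDiag_one : ∃ I : XO, IsDiagO I 1 :=
  exists_isDiag (fun _ => one_pos) (by simp)

theorem sq_of_isDiag {M : XO} {a : Fin 3 → ℝ} (h : IsDiagO M a) : M.sq = diagonal (a ^ 2) := by
  rw [sq, h, toHerm_diag, square_diagonal]

theorem sq_of_isDiag_one {M : XO} (h : IsDiagO M 1) : M.sq = diagonal 1 := by
  rw [sq_of_isDiag h, one_pow]

theorem pos_of_isDiag {M : XO} {a : Fin 3 → ℝ} (h : IsDiagO M a) (i : Fin 3) : 0 < a i := by
  have hM := M.posDef_toHerm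
  rw [h, toHerm_diag, posDef_diagonal_iff] at hM
  exact hM i

theorem actsO_iff {g : E6} {M N : XO} : ActsO g M N ↔ toHermAut g.1 M.sq = N.sq := by
  rw [sq, sq, ← toHerm_jmul_self, ← toHerm_jmul_self, toHermAut_toHerm, toHerm.injective.eq_iff]
  exact eq_comm

theorem exists_toHermAut_eq {g : Herm3 Octonion ≃ₗ[ℝ] Herm3 Octonion}
    (hg : g ∈ detGroup Octonion) : ∃ g' : E6, toHermAut g'.1 = g := by
  obtain ⟨g', rfl⟩ := toHermAut.surjective g
  exact ⟨⟨g', toHermAut_mem_detGroup_iff.1 hg⟩, rfl⟩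

theorem log_iSup_add_log_iSup_inv {h : Herm3 Octonion ≃ₗ[ℝ] Herm3 Octonion}
    (hh : h ∈ unitGroup Octonion) {a b : Fin 3 → ℝ} (ha : ∀ i, 0 < a i) (hb : ∀ i, 0 < b i)
    (h10 : b 1 ≤ b 0) (h21 : b 2 ≤ b 1) (hab : h (diagonal (a ^ 2)) = diagonal b) :
    Real.log (⨆ i, a i) + Real.log (⨆ i, (a i)⁻¹) = (Real.log (b 0) - Real.log (b 2)) / 2 := by
  have sup : ⨆ i, a i = √(b 0) := ciSup_eq_sqrt (fun i => (ha i).le) fun c => by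
    refine (forall_le_iff_of_map hh hab c).trans ⟨fun h => h 0, fun h i => ?_⟩
    fin_cases i
    exacts [h, h10.trans h, h21.trans (h10.trans h)]
  have inf : ⨆ i, (a i)⁻¹ = (√(b 2))⁻¹ := ciSup_inv_eq_inv_sqrt ha (hb 2) fun c => by
    refine (forall_ge_iff_of_map hh hab c).trans ⟨fun h => h 2, fun h i => ?_⟩
    fin_cases i
    exacts [h.trans (h21.trans h10), h.trans h21, h]
  rw [sup, inf, Real.log_inv, Real.log_sqrt (hb 0).le, Real.log_sqrt (hb 2).le]
  ring

/-- The set of values whose infimum defines `distO`. -/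
def distValues (x y : XO) : Set ℝ :=
  {r | ∃ (g : E6) (I D : XO) (a : Fin 3 → ℝ), IsDiagO I 1 ∧ IsDiagO D a ∧
    ActsO g I x ∧ ActsO g D y ∧ r = Real.log (⨆ i, a i) + Real.log (⨆ i, (a i)⁻¹)}

theorem distValues_nonempty {x y : XO} {g : Herm3 Octonion ≃ₗ[ℝ] Herm3 Octonion}
    (hg : g ∈ detGroup Octonion) {b : Fin 3 → ℝ} (hb : ∀ i, 0 < b i)
    (hx : g x.sq = diagonal 1) (hy : g y.sq = diagonal b) : (distValues x y).Nonempty := by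
  obtain ⟨g', hg'⟩ := exists_toHermAut_eq (inv_mem hg)
  have inv_map {X Y : Herm3 Octonion} (h : g X = Y) : toHermAut g'.1 Y = X := by
    rw [hg', ← h]
    exact g.symm_apply_apply X
  have prod_b : ∏ i, b i = 1 := by rw [← det_diagonal (A := Octonion), ← hy, hg, det_sq]
  obtain ⟨I, hI⟩ := exists_isDiag_one
  obtain ⟨D, hD⟩ := exists_isDiag (fun i => Real.sqrt_pos.2 (hb i)) (by
    rw [← Real.sqrt_prod _ fun i _ => (hb i).le, prod_b, Real.sqrt_one])
  have sq_D : D.sq = diagonal b := by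
    rw [sq_of_isDiag hD]
    exact congrArg diagonal (funext fun i => Real.sq_sqrt (hb i).le)
  refine ⟨_, g', I, D, _, hI, hD, actsO_iff.2 ?_, actsO_iff.2 ?_, rfl⟩
  · rw [sq_of_isDiag_one hI, inv_map hx]
  · rw [sq_D, inv_map hy]

theorem eq_of_mem_distValues {x y : XO} {g : Herm3 Octonion ≃ₗ[ℝ] Herm3 Octonion}
    (hg : g ∈ detGroup Octonion) {b : Fin 3 → ℝ} (hb : ∀ i, 0 < b i) (h10 : b 1 ≤ b 0)
    (h21 : b 2 ≤ b 1) (hx : g x.sq = diagonal 1) (hy : g y.sq = diagonal b) {r : ℝ}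
    (hr : r ∈ distValues x y) : r = (Real.log (b 0) - Real.log (b 2)) / 2 := by
  obtain ⟨g', I, D, a, hI, hD, hIx, hDy, rfl⟩ := hr
  rw [actsO_iff, sq_of_isDiag_one hI] at hIx
  rw [actsO_iff, sq_of_isDiag hD] at hDy
  have det_mem : g * toHermAut g'.1 ∈ detGroup Octonion :=
    mul_mem hg (toHermAut_mem_detGroup_iff.2 g'.2)
  have unit_mem : g * toHermAut g'.1 ∈ unitGroup Octonion := by
    refine ⟨det_mem, ?_⟩
    change (g * toHermAut g'.1) (diagonal 1) = diagonal 1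
    rw [LinearEquiv.mul_apply, hIx, hx]
  exact log_iSup_add_log_iSup_inv unit_mem (pos_of_isDiag hD) hb h10 h21
    (by rw [LinearEquiv.mul_apply, hDy, hy])

theorem dist_eq {x y : XO} {g : Herm3 Octonion ≃ₗ[ℝ] Herm3 Octonion} (hg : g ∈ detGroup Octonion)
    {b : Fin 3 → ℝ} (hb : ∀ i, 0 < b i) (h10 : b 1 ≤ b 0) (h21 : b 2 ≤ b 1)
    (hx : g x.sq = diagonal 1) (hy : g y.sq = diagonal b) :
    distO x y = (Real.log (b 0) - Real.log (b 2)) / 2 := by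
  have singleton := Set.eq_singleton_iff_nonempty_unique_mem.2
    ⟨distValues_nonempty hg hb hx hy, fun _ => eq_of_mem_distValues hg hb h10 h21 hx hy⟩
  change sInf (distValues x y) = _
  rw [singleton, csInf_singleton]

theorem exists_mem_orderGroup_of_hasShape {t : ℝ} {x y : XO} (h : HasShape (K := .O) t x y) :
    ∃ L ∈ orderGroup Octonion, L x.sq = diagonal 1 ∧ L y.sq = diagonal (shapeVec t ^ 2) := by
  obtain ⟨g, p, q, hx, hy, hp, hq⟩ := h
  have map_x := (actsO_iff.1 hx).trans (sq_of_isDiag_one hp)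
  have det_mem := toHermAut_mem_detGroup_iff.2 g.2
  exact ⟨_, mem_orderGroup_of_map_eq_one det_mem x.posDef_sq map_x, map_x,
    (actsO_iff.1 hy).trans (sq_of_isDiag hq)⟩

theorem isEquilateral_of_map {t : ℝ} {x y z : XO} {g : Herm3 Octonion ≃ₗ[ℝ] Herm3 Octonion}
    (hg : g ∈ detGroup Octonion) (hx : g x.sq = diagonal 1)
    (hy : g y.sq = diagonal (shapeVec t ^ 2)) (hz : g z.sq = diagonal (coshapeVec t ^ 2)) :
    IsEquilateral (K := .O) t x y z := by
  obtain ⟨g, rfl⟩ := exists_toHermAut_eq hg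
  obtain ⟨p, hp⟩ := exists_isDiag_one
  obtain ⟨q, hq⟩ := exists_isDiag (shapeVec_pos t) (prod_shapeVec t)
  obtain ⟨r, hr⟩ := exists_isDiag (coshapeVec_pos t) (prod_coshapeVec t)
  exact ⟨g, p, q, r, actsO_iff.2 (hx.trans (sq_of_isDiag_one hp).symm),
    actsO_iff.2 (hy.trans (sq_of_isDiag hq).symm), actsO_iff.2 (hz.trans (sq_of_isDiag hr).symm),
    hp, hq, hr⟩

/-- The octonionic symmetric space as a slice of the cone of squares. -/
def model : ConeModel Octonion XO where
  sq := sq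
  dist := distO
  Shape t x y := HasShape (K := .O) t x y
  Equilateral t x y z := IsEquilateral (K := .O) t x y z
  posDef_sq := posDef_sq
  det_sq := det_sq
  exists_sq _ := exists_sq_eq
  dist_eq _ _ _ hg _ hb h10 h21 hx hy := dist_eq (genGroup_le_detGroup hg) hb h10 h21 hx hy
  shape_spec _ _ _ := exists_mem_orderGroup_of_hasShape
  equilateral_spec _ _ _ _ _ hg := isEquilateral_of_map (genGroup_le_detGroup hg)

end XO

/-! ## The quaternionic space -/

namespace QuatMatrix

theorem norm_sq_eq (x : ℍ[ℝ]) : ‖x‖ ^ 2 = x.re ^ 2 + x.imI ^ 2 + x.imJ ^ 2 + x.imK ^ 2 := by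
  rw [sq, ← Quaternion.normSq_eq_norm_mul_self, Quaternion.normSq_def']

theorem mul_star_self (x : ℍ[ℝ]) : x * star x = ((‖x‖ ^ 2 : ℝ) : ℍ[ℝ]) := by
  rw [Quaternion.self_mul_star, Quaternion.normSq_eq_norm_mul_self, sq]

theorem star_mul_self (x : ℍ[ℝ]) : star x * x = ((‖x‖ ^ 2 : ℝ) : ℍ[ℝ]) := by
  rw [Quaternion.star_mul_self, Quaternion.normSq_eq_norm_mul_self, sq]

theorem mul_star_mul (u x : ℍ[ℝ]) : u * star x * u = (2 * ⟪u, x⟫_ℝ) • u - ‖u‖ ^ 2 • x := by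
  rw [norm_sq_eq, Quaternion.inner_def]
  ext <;> simp <;> ring

instance : SymmetricComposition ℍ[ℝ] where
  mul := LinearMap.mk₂ ℝ (fun x y => star (x * y)) (fun x y z => by rw [add_mul, star_add])
    (fun r x y => by rw [smul_mul_assoc, Quaternion.star_smul])
    (fun x y z => by rw [mul_add, star_add])
    (fun r x y => by rw [mul_smul_comm, Quaternion.star_smul])
  inner_mul x y z := by
    change ⟪star (x * y), z⟫_ℝ = ⟪x, star (y * z)⟫_ℝ
    simp only [Quaternion.inner_def, star_mul, star_star, Quaternion.re_mul, Quaternion.re_star,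
      Quaternion.imI_star, Quaternion.imJ_star, Quaternion.imK_star, Quaternion.imI_mul,
      Quaternion.imJ_mul, Quaternion.imK_mul]
    ring
  mul_mul_cancel_left x y := by
    change star (star (x * y) * x) = _
    rw [star_mul, star_star, ← mul_assoc, star_mul_self, Quaternion.coe_mul_eq_smul]
  mul_mul_cancel_right x y := by
    change star (x * star (y * x)) = _
    rw [star_mul, star_star, mul_assoc, mul_star_self, Quaternion.mul_coe_eq_smul]

theorem mul_def (x y : ℍ[ℝ]) : SymmetricComposition.mul x y = star (x * y) := rfl

/-- The component `z` of the quaternion `z + w j`. -/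
def fstComplex : ℍ[ℝ] →ₗ[ℝ] ℂ where
  toFun q := ⟨q.re, q.imI⟩
  map_add' _ _ := rfl
  map_smul' r q := by apply Complex.ext <;> simp

/-- The component `w` of the quaternion `z + w j`. -/
def sndComplex : ℍ[ℝ] →ₗ[ℝ] ℂ where
  toFun q := ⟨q.imJ, q.imK⟩
  map_add' _ _ := rfl
  map_smul' r q := by apply Complex.ext <;> simp

theorem fstComplex_apply (q : ℍ[ℝ]) : fstComplex q = ⟨q.re, q.imI⟩ := rfl

theorem sndComplex_apply (q : ℍ[ℝ]) : sndComplex q = ⟨q.imJ, q.imK⟩ := rfl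

theorem fstComplex_mul (x y : ℍ[ℝ]) : fstComplex (x * y) =
    fstComplex x * fstComplex y - sndComplex x * star (sndComplex y) := by
  apply Complex.ext <;> simp [fstComplex_apply, sndComplex_apply] <;> ring

theorem sndComplex_mul (x y : ℍ[ℝ]) : sndComplex (x * y) =
    fstComplex x * sndComplex y + sndComplex x * star (fstComplex y) := by
  apply Complex.ext <;> simp [fstComplex_apply, sndComplex_apply] <;> ring

@[simp] theorem fstComplex_star (x : ℍ[ℝ]) : fstComplex (star x) = star (fstComplex x) := by
  apply Complex.ext <;> simp [fstComplex_apply]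

@[simp] theorem sndComplex_star (x : ℍ[ℝ]) : sndComplex (star x) = -sndComplex x := by
  apply Complex.ext <;> simp [sndComplex_apply]

@[simp] theorem fstComplex_coe (r : ℝ) : fstComplex (r : ℍ[ℝ]) = r := by
  apply Complex.ext <;> simp [fstComplex_apply]

@[simp] theorem sndComplex_coe (r : ℝ) : sndComplex (r : ℍ[ℝ]) = 0 := by
  apply Complex.ext <;> simp [sndComplex_apply]

theorem ext_complex {x y : ℍ[ℝ]} (hf : fstComplex x = fstComplex y)
    (hs : sndComplex x = sndComplex y) : x = y := by
  rw [fstComplex_apply, fstComplex_apply, Complex.mk.injEq] at hf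
  rw [sndComplex_apply, sndComplex_apply, Complex.mk.injEq] at hs
  exact QuaternionAlgebra.ext hf.1 hf.2 hs.1 hs.2

variable {n : Type*}

/-- The complex blocks of a quaternionic matrix `Z + W j`. -/
def complexBlocks (M : Matrix n n ℍ[ℝ]) : Matrix (n ⊕ n) (n ⊕ n) ℂ :=
  .fromBlocks (M.map fstComplex) (M.map sndComplex)
    (M.map fun q => -star (sndComplex q)) (M.map fun q => star (fstComplex q))

theorem complexBlocks_injective : Function.Injective (complexBlocks (n := n)) := by
  intro M N h
  rw [complexBlocks, complexBlocks, Matrix.fromBlocks_inj] at h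
  ext1 i j
  exact ext_complex (congrFun (congrFun h.1 i) j) (congrFun (congrFun h.2.1 i) j)

theorem complexBlocks_add (M N : Matrix n n ℍ[ℝ]) :
    complexBlocks (M + N) = complexBlocks M + complexBlocks N := by
  simp only [complexBlocks, Matrix.fromBlocks_add]
  congr 1 <;> ext1 i j <;> simp [add_comm]

theorem complexBlocks_conjTranspose (M : Matrix n n ℍ[ℝ]) :
    complexBlocks M.conjTranspose = (complexBlocks M).conjTranspose := by
  simp only [complexBlocks, Matrix.fromBlocks_conjTranspose]
  congr 1 <;> ext1 i j <;> simp

theorem complexBlocks_map_coe (M : Matrix n n ℝ) : complexBlocks (M.map fun r => (r : ℍ[ℝ])) =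
    .fromBlocks (M.map Complex.ofRealHom) 0 0 (M.map Complex.ofRealHom) := by
  rw [complexBlocks]
  congr 1 <;> ext1 i j <;> simp

theorem complexBlocks_diagonal [DecidableEq n] (a : n → ℝ) :
    complexBlocks (Matrix.diagonal fun i => (a i : ℍ[ℝ])) =
      .fromBlocks (Matrix.diagonal fun i => (a i : ℂ)) 0 0
        (Matrix.diagonal fun i => (a i : ℂ)) := by
  rw [complexBlocks]
  congr 1 <;> ext1 i j <;> by_cases h : i = j <;> simp [h]

variable [Fintype n]

theorem complexBlocks_mul (M N : Matrix n n ℍ[ℝ]) :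
    complexBlocks (M * N) = complexBlocks M * complexBlocks N := by
  simp only [complexBlocks, Matrix.fromBlocks_multiply]
  congr 1 <;> ext1 i j <;>
    simp only [Matrix.map_apply, Matrix.add_apply, Matrix.mul_apply, map_sum, fstComplex_mul,
      sndComplex_mul, star_sum, ← Finset.sum_add_distrib, ← Finset.sum_neg_distrib] <;>
    refine Finset.sum_congr rfl fun k _ => ?_ <;>
    (try simp only [star_sub, star_add, star_mul, star_star]) <;> ring

variable [DecidableEq n]

/-- The identification of quaternionic `n × n` matrices with the complex `2n × 2n` matrices `M`
such that `J M J⁻¹ = M̄`. -/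
def toComplex : Matrix n n ℍ[ℝ] →⋆ₐ[ℝ] Matrix (n ⊕ n) (n ⊕ n) ℂ where
  toFun := complexBlocks
  map_one' := by simpa using complexBlocks_diagonal (n := n) 1
  map_mul' := complexBlocks_mul
  map_zero' := by simpa using complexBlocks_diagonal (n := n) 0
  map_add' := complexBlocks_add
  commutes' r := by
    rw [Matrix.algebraMap_eq_diagonal, Matrix.algebraMap_eq_diagonal]
    refine (complexBlocks_diagonal (n := n) fun _ => r).trans ?_
    rw [Matrix.fromBlocks_diagonal]
    congr 1
    ext i
    cases i <;> rfl
  map_star' := complexBlocks_conjTranspose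

theorem toComplex_injective : Function.Injective (toComplex (n := n)) := complexBlocks_injective

theorem toComplex_diagonal (a : n → ℝ) :
    toComplex (Matrix.diagonal fun i => (a i : ℍ[ℝ])) =
      .fromBlocks (Matrix.diagonal fun i => (a i : ℂ)) 0 0
        (Matrix.diagonal fun i => (a i : ℂ)) := complexBlocks_diagonal a

theorem toComplex_isHermitian_iff {M : Matrix n n ℍ[ℝ]} :
    (toComplex M).IsHermitian ↔ M.IsHermitian := by
  rw [Matrix.IsHermitian, Matrix.IsHermitian, ← Matrix.star_eq_conjTranspose, ← map_star,
    toComplex_injective.eq_iff, Matrix.star_eq_conjTranspose]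

theorem J_mul_toComplex (M : Matrix n n ℍ[ℝ]) :
    Matrix.J n ℂ * toComplex M * (Matrix.J n ℂ)⁻¹ = (toComplex M).map star := by
  change Matrix.J n ℂ * complexBlocks M * (Matrix.J n ℂ)⁻¹ = (complexBlocks M).map star
  rw [Matrix.J_inv, Matrix.J, complexBlocks, Matrix.fromBlocks_neg, Matrix.fromBlocks_multiply,
    Matrix.fromBlocks_multiply, Matrix.fromBlocks_map]
  congr 1 <;> ext1 i j <;> simp

theorem exists_toComplex_eq {G : Matrix (n ⊕ n) (n ⊕ n) ℂ}
    (h : Matrix.J n ℂ * G * (Matrix.J n ℂ)⁻¹ = G.map star) : ∃ M, toComplex M = G := by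
  obtain ⟨A, B, C, D, rfl⟩ : ∃ A B C D, G = Matrix.fromBlocks A B C D :=
    ⟨_, _, _, _, (Matrix.fromBlocks_toBlocks G).symm⟩
  rw [Matrix.J_inv, Matrix.J, Matrix.fromBlocks_neg, Matrix.fromBlocks_multiply,
    Matrix.fromBlocks_multiply, Matrix.fromBlocks_map, Matrix.fromBlocks_inj] at h
  have hD : D = A.map star := by simpa using h.1
  have hC : C = -B.map star := by simpa [neg_eq_iff_eq_neg] using h.2.1
  refine ⟨.of fun i j => ⟨(A i j).re, (A i j).im, (B i j).re, (B i j).im⟩, ?_⟩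
  rw [hC, hD]
  rfl

theorem J_mul_inv {G : Matrix (n ⊕ n) (n ⊕ n) ℂ} (hd : IsUnit G.det)
    (h : Matrix.J n ℂ * G * (Matrix.J n ℂ)⁻¹ = G.map star) :
    Matrix.J n ℂ * G⁻¹ * (Matrix.J n ℂ)⁻¹ = G⁻¹.map star := by
  have right_inv : G.map star * G⁻¹.map star = 1 := by
    change G.map (starRingEnd ℂ) * G⁻¹.map (starRingEnd ℂ) = 1
    rw [← Matrix.map_mul, Matrix.mul_nonsing_inv _ hd, Matrix.map_one _ (map_zero _) (map_one _)]
  rw [← Matrix.inv_eq_right_inv right_inv, ← h, Matrix.mul_inv_rev, Matrix.mul_inv_rev,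
    Matrix.nonsing_inv_nonsing_inv _ (Matrix.isUnit_det_J _ _), Matrix.mul_assoc]

theorem isUnit_of_isUnit_det_toComplex {T : Matrix n n ℍ[ℝ]} (h : IsUnit (toComplex T).det) :
    IsUnit T := by
  obtain ⟨S, hS⟩ := exists_toComplex_eq (J_mul_inv h (J_mul_toComplex T))
  refine ⟨⟨T, S, toComplex_injective ?_, toComplex_injective ?_⟩, rfl⟩
  · rw [map_mul, hS, Matrix.mul_nonsing_inv _ h, map_one]
  · rw [map_mul, hS, Matrix.nonsing_inv_mul _ h, map_one]

variable (n) in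
/-- The group `SLₙ(ℍ)`. -/
def specialLinear : Subgroup (Matrix n n ℍ[ℝ])ˣ :=
  ((Matrix.detMonoidHom.comp (MonoidHomClass.toMonoidHom (toComplex (n := n)))).comp
    (Units.coeHom _)).ker

theorem mem_specialLinear_iff {T : (Matrix n n ℍ[ℝ])ˣ} :
    T ∈ specialLinear n ↔ (toComplex T.1).det = 1 := Iff.rfl

theorem exists_mem_specialLinear {T : Matrix n n ℍ[ℝ]} (h : (toComplex T).det = 1) :
    ∃ U ∈ specialLinear n, U.1 = T := by
  obtain ⟨U, rfl⟩ := isUnit_of_isUnit_det_toComplex (h ▸ isUnit_one)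
  exact ⟨U, h, rfl⟩

theorem det_toComplex_map_coe (M : Matrix n n ℝ) :
    (toComplex (M.map fun r => (r : ℍ[ℝ]))).det = (M.det : ℂ) ^ 2 := by
  change (complexBlocks _).det = Complex.ofRealHom M.det ^ 2
  rw [complexBlocks_map_coe, Matrix.det_fromBlocks_zero₂₁, sq, RingHom.map_det]
  rfl

theorem det_toComplex_diagonal (a : n → ℝ) :
    (toComplex (Matrix.diagonal fun i => (a i : ℍ[ℝ]))).det = ((∏ i, a i : ℝ) : ℂ) ^ 2 := by
  rw [toComplex_diagonal, Matrix.det_fromBlocks_zero₂₁, Matrix.det_diagonal, sq,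
    Complex.ofReal_prod]

end QuatMatrix

namespace Herm3

open QuatMatrix

/-- The Hermitian quaternionic matrix with given coordinates. -/
def toMatrix : Herm3 ℍ[ℝ] →ₗ[ℝ] Matrix (Fin 3) (Fin 3) ℍ[ℝ] where
  toFun X := !![(X.diag 0 : ℍ[ℝ]), X.off 2, star (X.off 1);
    star (X.off 2), (X.diag 1 : ℍ[ℝ]), X.off 0; X.off 1, star (X.off 0), (X.diag 2 : ℍ[ℝ])]
  map_add' X Y := by ext1 i j; fin_cases i <;> fin_cases j <;> simp
  map_smul' r X := by
    ext1 i j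
    fin_cases i <;> fin_cases j <;> simp [Quaternion.coe_mul_eq_smul]

theorem toMatrix_apply (X : Herm3 ℍ[ℝ]) : toMatrix X =
    !![(X.diag 0 : ℍ[ℝ]), X.off 2, star (X.off 1);
      star (X.off 2), (X.diag 1 : ℍ[ℝ]), X.off 0;
      X.off 1, star (X.off 0), (X.diag 2 : ℍ[ℝ])] := rfl

/-- The coordinates of a Hermitian quaternionic matrix. -/
def ofMatrix : Matrix (Fin 3) (Fin 3) ℍ[ℝ] →ₗ[ℝ] Herm3 ℍ[ℝ] where
  toFun M := ⟨![(M 0 0).re, (M 1 1).re, (M 2 2).re], ![M 1 2, M 2 0, M 0 1]⟩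
  map_add' M N := by ext1 <;> ext1 i <;> fin_cases i <;> rfl
  map_smul' r M := by ext1 <;> ext1 i <;> fin_cases i <;> rfl

theorem ofMatrix_apply (M : Matrix (Fin 3) (Fin 3) ℍ[ℝ]) :
    ofMatrix M = ⟨![(M 0 0).re, (M 1 1).re, (M 2 2).re], ![M 1 2, M 2 0, M 0 1]⟩ := rfl

theorem isHermitian_toMatrix (X : Herm3 ℍ[ℝ]) : (toMatrix X).IsHermitian := by
  ext1 i j
  rw [Matrix.conjTranspose_apply, toMatrix_apply]
  fin_cases i <;> fin_cases j <;> simp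

theorem toMatrix_ofMatrix {M : Matrix (Fin 3) (Fin 3) ℍ[ℝ]} (h : M.IsHermitian) :
    toMatrix (ofMatrix M) = M := by
  have coe_re (i) : ((M i i).re : ℍ[ℝ]) = M i i := (Quaternion.star_eq_self.1 (h.apply i i)).symm
  ext1 i j
  fin_cases i <;> fin_cases j <;> simp [toMatrix_apply, ofMatrix_apply, h.apply, coe_re]

theorem ofMatrix_toMatrix (X : Herm3 ℍ[ℝ]) : ofMatrix (toMatrix X) = X := by
  ext1 <;> ext1 i <;> fin_cases i <;> simp [toMatrix_apply, ofMatrix_apply]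

theorem toMatrix_injective : Function.Injective toMatrix :=
  Function.LeftInverse.injective ofMatrix_toMatrix

theorem toMatrix_diagonal (a : Fin 3 → ℝ) :
    toMatrix (diagonal a) = Matrix.diagonal fun i => (a i : ℍ[ℝ]) := by
  ext1 i j
  fin_cases i <;> fin_cases j <;> simp [toMatrix_apply]

theorem toMatrix_one : toMatrix (diagonal 1) = 1 := by
  rw [toMatrix_diagonal]
  simp

/-- The action `X ↦ T X T*` of quaternionic matrices on Hermitian ones, in coordinates. -/
def conjHom : Matrix (Fin 3) (Fin 3) ℍ[ℝ] →* Module.End ℝ (Herm3 ℍ[ℝ]) where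
  toFun T := ofMatrix ∘ₗ LinearMap.mulLeft ℝ T ∘ₗ LinearMap.mulRight ℝ (star T) ∘ₗ toMatrix
  map_one' := by ext1 X; simp [ofMatrix_toMatrix]
  map_mul' T S := by
    ext1 X
    have herm := Matrix.isHermitian_mul_mul_conjTranspose S (isHermitian_toMatrix X)
    rw [Matrix.mul_assoc] at herm
    simp only [LinearMap.comp_apply, LinearMap.mulRight_apply, LinearMap.mulLeft_apply,
      Module.End.mul_apply, star_mul, Matrix.star_eq_conjTranspose, toMatrix_ofMatrix herm,
      Matrix.mul_assoc]

theorem toMatrix_conjHom (T : Matrix (Fin 3) (Fin 3) ℍ[ℝ]) (X : Herm3 ℍ[ℝ]) :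
    toMatrix (conjHom T X) = T * toMatrix X * star T := by
  have herm := Matrix.isHermitian_mul_mul_conjTranspose T (isHermitian_toMatrix X)
  rw [Matrix.mul_assoc] at herm
  exact (toMatrix_ofMatrix herm).trans (Matrix.mul_assoc _ _ _).symm

/-- The action of `GL₃(ℍ)` on the Jordan algebra of Hermitian quaternionic matrices. -/
def conjAut : (Matrix (Fin 3) (Fin 3) ℍ[ℝ])ˣ →* (Herm3 ℍ[ℝ] ≃ₗ[ℝ] Herm3 ℍ[ℝ]) :=
  (LinearMap.GeneralLinearGroup.generalLinearEquiv ℝ _).toMonoidHom.comp (Units.map conjHom)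

theorem toMatrix_conjAut (T : (Matrix (Fin 3) (Fin 3) ℍ[ℝ])ˣ) (X : Herm3 ℍ[ℝ]) :
    toMatrix (conjAut T X) = T.1 * toMatrix X * star T.1 := toMatrix_conjHom T.1 X

theorem mem_map_conjAut {g : Herm3 ℍ[ℝ] ≃ₗ[ℝ] Herm3 ℍ[ℝ]} {T : Matrix (Fin 3) (Fin 3) ℍ[ℝ]}
    (hT : (toComplex T).det = 1) (h : ∀ X, ofMatrix (T * toMatrix X * T.conjTranspose) = g X) :
    g ∈ (specialLinear (Fin 3)).map conjAut := by
  obtain ⟨S, hS, rfl⟩ := exists_mem_specialLinear hT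
  have conj_eq : conjAut S = g := LinearEquiv.ext fun X => by
    rw [← h, ← Matrix.star_eq_conjTranspose, ← toMatrix_conjAut, ofMatrix_toMatrix]
  exact Subgroup.mem_map.2 ⟨S, hS, conj_eq⟩

theorem cyc_mem_map_conjAut : cyc ∈ (specialLinear (Fin 3)).map conjAut := by
  have entries : (!![0, 1, 0; 0, 0, 1; 1, 0, 0] : Matrix (Fin 3) (Fin 3) ℝ).map
      (fun r => (r : ℍ[ℝ])) = !![0, 1, 0; 0, 0, 1; 1, 0, 0] := by
    ext1 i j
    fin_cases i <;> fin_cases j <;> simp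
  refine mem_map_conjAut (T := !![0, 1, 0; 0, 0, 1; 1, 0, 0]) ?_ fun X => ?_
  · rw [← entries, det_toComplex_map_coe, Matrix.det_fin_three]
    simp
  · simp only [ofMatrix_apply, Matrix.mul_apply, Fin.sum_univ_three, Matrix.conjTranspose_apply]
    ext1 <;> ext1 i <;> fin_cases i <;> simp [toMatrix_apply]

theorem dil_mem_map_conjAut {a : Fin 3 → ℝ} (ha : ∀ i, a i ≠ 0) (h1 : ∏ i, a i = 1) :
    dil a ha ∈ (specialLinear (Fin 3)).map conjAut := by
  refine mem_map_conjAut (T := Matrix.diagonal fun i => (a i : ℍ[ℝ])) ?_ fun X => ?_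
  · rw [det_toComplex_diagonal, h1]
    simp
  · rw [Matrix.diagonal_conjTranspose]
    ext1 <;> ext1 i <;> fin_cases i <;>
      simp [ofMatrix_apply, toMatrix_apply, Quaternion.coe_mul_eq_smul,
        Quaternion.mul_coe_eq_smul, smul_smul] <;> ring_nf

/-- The rotation of the last two coordinates of `ℍ³` by a unit quaternion. -/
def rotMatrix (u : ℍ[ℝ]) (c s : ℝ) : Matrix (Fin 3) (Fin 3) ℍ[ℝ] :=
  !![1, 0, 0; 0, (c : ℍ[ℝ]), s • u; 0, -(s • star u), (c : ℍ[ℝ])]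

theorem det_toComplex_rotMatrix_one {c s : ℝ} (h : c ^ 2 + s ^ 2 = 1) :
    (toComplex (rotMatrix 1 c s)).det = 1 := by
  have entries : rotMatrix 1 c s = (!![1, 0, 0; 0, c, s; 0, -s, c] : Matrix (Fin 3) (Fin 3) ℝ).map
      fun r => (r : ℍ[ℝ]) := by
    ext1 i j
    fin_cases i <;> fin_cases j <;> simp [rotMatrix, ← Quaternion.coe_mul_eq_smul]
  have det_real : (!![1, 0, 0; 0, c, s; 0, -s, c] : Matrix (Fin 3) (Fin 3) ℝ).det = 1 := by
    simpa [Matrix.det_fin_three, ← sq] using h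
  rw [entries, det_toComplex_map_coe, det_real, Complex.ofReal_one, one_pow]

theorem det_toComplex_rotMatrix {u : ℍ[ℝ]} {c s : ℝ} (hu : ‖u‖ = 1) (h : c ^ 2 + s ^ 2 = 1) :
    (toComplex (rotMatrix u c s)).det = 1 := by
  have u_mul_star : u * star u = 1 := by rw [mul_star_self, hu]; simp
  have inv_diag : Matrix.diagonal ![1, u, 1] * Matrix.diagonal ![1, star u, 1] = 1 := by
    rw [Matrix.diagonal_mul_diagonal, ← Matrix.diagonal_one]
    congr 1
    ext1 i
    fin_cases i <;> simp [u_mul_star]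
  have conj_rot : rotMatrix u c s = Matrix.diagonal ![1, u, 1] * rotMatrix 1 c s *
      Matrix.diagonal ![1, star u, 1] := by
    have smul_one : c • (1 : ℍ[ℝ]) = c := by rw [← Quaternion.coe_mul_eq_smul, mul_one]
    ext1 i j
    fin_cases i <;> fin_cases j <;>
      simp [rotMatrix, Quaternion.mul_coe_eq_smul, u_mul_star, smul_one]
  rw [conj_rot, map_mul, map_mul, Matrix.det_mul, Matrix.det_mul, det_toComplex_rotMatrix_one h,
    mul_one, ← Matrix.det_mul, ← map_mul, inv_diag, map_one, Matrix.det_one]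

theorem ofMatrix_rotMatrix_conj_diag {u : ℍ[ℝ]} {c s : ℝ} (hu : ‖u‖ = 1) (X : Herm3 ℍ[ℝ]) (i) :
    (ofMatrix (rotMatrix u c s * toMatrix X * (rotMatrix u c s).conjTranspose)).diag i =
      (rotFun u c s X).diag i := by
  have hu' := norm_sq_eq u
  rw [hu] at hu'
  simp only [ofMatrix_apply, Matrix.mul_apply, Fin.sum_univ_three, Matrix.conjTranspose_apply]
  fin_cases i <;> simp [rotMatrix, toMatrix_apply, rotFun, Quaternion.inner_def] <;> grind

theorem ofMatrix_rotMatrix_conj_off {u : ℍ[ℝ]} {c s : ℝ} (hu : ‖u‖ = 1) (h : c ^ 2 + s ^ 2 = 1)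
    (X : Herm3 ℍ[ℝ]) (i) :
    (ofMatrix (rotMatrix u c s * toMatrix X * (rotMatrix u c s).conjTranspose)).off i =
      (rotFun u c s X).off i := by
  have reflection := mul_star_mul u (X.off 0)
  rw [hu] at reflection
  simp only [ofMatrix_apply, Matrix.mul_apply, Fin.sum_univ_three, Matrix.conjTranspose_apply]
  fin_cases i
  · simp [rotMatrix, toMatrix_apply, rotFun, add_mul, reflection, Quaternion.coe_mul_eq_smul,
      Quaternion.mul_coe_eq_smul]
    linear_combination (norm := module) h • X.off 0
  · simp [rotMatrix, toMatrix_apply, rotFun, QuatMatrix.mul_def, Quaternion.coe_mul_eq_smul,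
      Quaternion.mul_coe_eq_smul]
    abel
  · simp [rotMatrix, toMatrix_apply, rotFun, QuatMatrix.mul_def, Quaternion.coe_mul_eq_smul,
      Quaternion.mul_coe_eq_smul]

theorem rot_mem_map_conjAut (u : ℍ[ℝ]) (c s : ℝ) (hu : ‖u‖ = 1) (h : c ^ 2 + s ^ 2 = 1) :
    rot u c s hu h ∈ (specialLinear (Fin 3)).map conjAut :=
  mem_map_conjAut (det_toComplex_rotMatrix hu h) fun X => Herm3.ext
    (funext (ofMatrix_rotMatrix_conj_diag hu X)) (funext (ofMatrix_rotMatrix_conj_off hu h X))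

theorem genGroup_le_map_conjAut : genGroup ℍ[ℝ] ≤ (specialLinear (Fin 3)).map conjAut := by
  refine sup_le (Subgroup.closure_le _ |>.2 ?_) (Subgroup.closure_le _ |>.2 ?_)
  · rintro _ (rfl | ⟨u, c, s, hu, h, rfl⟩)
    exacts [cyc_mem_map_conjAut, rot_mem_map_conjAut u c s hu h]
  · rintro _ ⟨a, ha, h1, rfl⟩
    exact dil_mem_map_conjAut ha h1

end Herm3

namespace Herm3

open QuatMatrix

theorem star_mul_self_of_mem_unitGroup {T : (Matrix (Fin 3) (Fin 3) ℍ[ℝ])ˣ}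
    (hT : conjAut T ∈ unitGroup ℍ[ℝ]) : star T.1 * T.1 = 1 := by
  have map_one := congrArg toMatrix (map_one_of_mem_unitGroup hT)
  rw [toMatrix_conjAut, toMatrix_one, mul_one] at map_one
  calc star T.1 * T.1 = T⁻¹.1 * (T.1 * star T.1) * T.1 := by rw [T.inv_mul_cancel_left]
    _ = 1 := by rw [map_one, mul_one, T.inv_mul]

theorem exists_eq_conjAut_diagonal (X : Herm3 ℍ[ℝ]) : ∃ T ∈ specialLinear (Fin 3),
    conjAut T ∈ unitGroup ℍ[ℝ] ∧ ∃ b, X = conjAut T (diagonal b) := by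
  obtain ⟨k, hk, b, -, -, hb⟩ := exists_map_eq_diagonal X
  obtain ⟨T, hT, hTk⟩ := genGroup_le_map_conjAut (inv_mem (rotGroup_le_genGroup hk))
  refine ⟨T, hT, hTk ▸ inv_mem (rotGroup_le_unitGroup hk), b, ?_⟩
  rw [hTk, ← hb]
  exact (k.symm_apply_apply X).symm

theorem toMatrix_square (X : Herm3 ℍ[ℝ]) : toMatrix X.square = toMatrix X * toMatrix X := by
  obtain ⟨T, -, hT, b, rfl⟩ := exists_eq_conjAut_diagonal X
  have diagonal_sq : toMatrix (diagonal (b ^ 2)) =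
      toMatrix (diagonal b) * toMatrix (diagonal b) := by
    simp only [toMatrix_diagonal, Matrix.diagonal_mul_diagonal, sq, Pi.mul_apply,
      Quaternion.coe_mul]
  rw [square_map hT, square_diagonal, toMatrix_conjAut, toMatrix_conjAut]
  calc T.1 * toMatrix (diagonal (b ^ 2)) * star T.1
      = T.1 * (toMatrix (diagonal b) * 1 * toMatrix (diagonal b)) * star T.1 := by
        rw [diagonal_sq, mul_one]
    _ = T.1 * toMatrix (diagonal b) * star T.1 * (T.1 * toMatrix (diagonal b) * star T.1) := by
        simp only [← star_mul_self_of_mem_unitGroup hT, mul_assoc]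

/-- The complex Hermitian matrix of an element of the Jordan algebra. -/
def toComplexMatrix : Herm3 ℍ[ℝ] →ₗ[ℝ] Matrix (Fin 3 ⊕ Fin 3) (Fin 3 ⊕ Fin 3) ℂ :=
  toComplex.toAlgHom.toLinearMap ∘ₗ toMatrix

theorem toComplexMatrix_apply (X : Herm3 ℍ[ℝ]) : toComplexMatrix X = toComplex (toMatrix X) := rfl

theorem toComplexMatrix_injective : Function.Injective toComplexMatrix :=
  toComplex_injective.comp toMatrix_injective

theorem exists_toComplexMatrix_eq {G : Matrix (Fin 3 ⊕ Fin 3) (Fin 3 ⊕ Fin 3) ℂ}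
    (h : Matrix.J (Fin 3) ℂ * G * (Matrix.J (Fin 3) ℂ)⁻¹ = G.map star) (hG : G.IsHermitian) :
    ∃ X, toComplexMatrix X = G := by
  obtain ⟨M, rfl⟩ := exists_toComplex_eq h
  exact ⟨ofMatrix M, by
    rw [toComplexMatrix_apply, toMatrix_ofMatrix (toComplex_isHermitian_iff.1 hG)]⟩

theorem toComplexMatrix_diagonal (a : Fin 3 → ℝ) : toComplexMatrix (diagonal a) =
    Matrix.diagonal (Sum.elim (fun i => (a i : ℂ)) fun i => (a i : ℂ)) := by
  rw [toComplexMatrix_apply, toMatrix_diagonal, toComplex_diagonal, Matrix.fromBlocks_diagonal]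

theorem toComplexMatrix_one : toComplexMatrix (diagonal 1) = 1 := by
  rw [toComplexMatrix_apply, toMatrix_one, map_one]

theorem toComplexMatrix_square (X : Herm3 ℍ[ℝ]) :
    toComplexMatrix X.square = toComplexMatrix X * toComplexMatrix X := by
  simp only [toComplexMatrix_apply, toMatrix_square, map_mul]

theorem toComplexMatrix_conjAut (T : (Matrix (Fin 3) (Fin 3) ℍ[ℝ])ˣ) (X : Herm3 ℍ[ℝ]) :
    toComplexMatrix (conjAut T X) =
      toComplex T.1 * toComplexMatrix X * star (toComplex T.1) := by
  simp only [toComplexMatrix_apply, toMatrix_conjAut, map_mul, map_star]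

theorem isUnit_toComplex (T : (Matrix (Fin 3) (Fin 3) ℍ[ℝ])ˣ) : IsUnit (toComplex T.1) :=
  T.isUnit.map toComplex

theorem posSemidef_toComplexMatrix_iff {X : Herm3 ℍ[ℝ]} :
    (toComplexMatrix X).PosSemidef ↔ 0 ≤ X := by
  obtain ⟨T, -, hT, b, rfl⟩ := exists_eq_conjAut_diagonal X
  rw [map_nonneg_iff (unitGroup_le_orderGroup hT), diagonal_nonneg_iff, toComplexMatrix_conjAut,
    Matrix.IsUnit.posSemidef_star_right_conjugate_iff (isUnit_toComplex T),
    toComplexMatrix_diagonal, Matrix.posSemidef_diagonal_iff]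
  simp [Pi.le_def]

theorem posDef_toComplexMatrix_iff {X : Herm3 ℍ[ℝ]} :
    (toComplexMatrix X).PosDef ↔ X.PosDef := by
  obtain ⟨T, -, hT, b, rfl⟩ := exists_eq_conjAut_diagonal X
  rw [posDef_map_iff hT, posDef_diagonal_iff, toComplexMatrix_conjAut,
    Matrix.IsUnit.posDef_star_right_conjugate_iff (isUnit_toComplex T),
    toComplexMatrix_diagonal, Matrix.posDef_diagonal_iff]
  simp

theorem det_toComplexMatrix (X : Herm3 ℍ[ℝ]) : (toComplexMatrix X).det = (X.det : ℂ) ^ 2 := by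
  obtain ⟨T, hT, hunit, b, rfl⟩ := exists_eq_conjAut_diagonal X
  rw [toComplexMatrix_conjAut, Matrix.det_mul, Matrix.det_mul, Matrix.star_eq_conjTranspose,
    Matrix.det_conjTranspose, mem_specialLinear_iff.1 hT, star_one, one_mul, mul_one,
    toComplexMatrix_apply, toMatrix_diagonal, det_toComplex_diagonal, hunit.1, det_diagonal]

theorem conjAut_mem_orderGroup (T : (Matrix (Fin 3) (Fin 3) ℍ[ℝ])ˣ) :
    conjAut T ∈ orderGroup ℍ[ℝ] := by
  have mono (T) : Monotone (conjAut T) := fun X Y hXY => by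
    rw [← sub_nonneg, ← posSemidef_toComplexMatrix_iff] at hXY ⊢
    rwa [← map_sub, toComplexMatrix_conjAut,
      Matrix.IsUnit.posSemidef_star_right_conjugate_iff (isUnit_toComplex T)]
  exact mem_orderGroup_of_monotone (mono T) (map_inv conjAut T ▸ mono T⁻¹)

end Herm3

namespace XH

open QuatMatrix

theorem exists_toComplexMatrix_eq (x : XH) : ∃ X, toComplexMatrix X = x.1 :=
  Herm3.exists_toComplexMatrix_eq x.2.1.1 x.2.2.1

/-- The point `x` as an element of the Jordan algebra. -/
def toHerm (x : XH) : Herm3 ℍ[ℝ] := x.exists_toComplexMatrix_eq.choose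

theorem toComplexMatrix_toHerm (x : XH) : toComplexMatrix x.toHerm = x.1 :=
  x.exists_toComplexMatrix_eq.choose_spec

theorem posDef_toHerm (x : XH) : x.toHerm.PosDef := by
  rw [← posDef_toComplexMatrix_iff, toComplexMatrix_toHerm]
  exact x.2.2

theorem exists_toHerm_eq {X : Herm3 ℍ[ℝ]} (hX : X.PosDef) (h1 : X.det = 1) :
    ∃ x : XH, x.toHerm = X :=
  ⟨⟨toComplexMatrix X, ⟨J_mul_toComplex _, by simp [det_toComplexMatrix, h1]⟩,
    posDef_toComplexMatrix_iff.2 hX⟩, toComplexMatrix_injective (toComplexMatrix_toHerm _)⟩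

/-- The square of a point, on which `SL₃(ℍ)` acts linearly. -/
def sq (x : XH) : Herm3 ℍ[ℝ] := x.toHerm.square

theorem toComplexMatrix_sq (x : XH) : toComplexMatrix x.sq = x.1 * x.1 := by
  rw [sq, toComplexMatrix_square, toComplexMatrix_toHerm]

theorem posDef_sq (x : XH) : x.sq.PosDef := x.posDef_toHerm.square

theorem det_sq (x : XH) : x.sq.det = 1 := by
  have det_cast := det_toComplexMatrix x.toHerm
  rw [toComplexMatrix_toHerm, x.2.1.2] at det_cast
  rw [sq, det_square]
  exact_mod_cast det_cast.symm

theorem exists_sq_eq {P : Herm3 ℍ[ℝ]} (hP : P.PosDef) (h1 : P.det = 1) : ∃ x : XH, x.sq = P := by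
  obtain ⟨X, hX, rfl⟩ := hP.exists_square_eq
  rw [det_square, pow_eq_one_iff_of_nonneg hX.det_pos.le two_ne_zero] at h1
  obtain ⟨x, rfl⟩ := exists_toHerm_eq hX h1
  exact ⟨x, rfl⟩

theorem isDiagH_iff {x : XH} {a : Fin 3 → ℝ} : IsDiagH x a ↔ x.toHerm = diagonal a := by
  rw [IsDiagH, Matrix.fromBlocks_diagonal, ← toComplexMatrix_diagonal, ← toComplexMatrix_toHerm,
    toComplexMatrix_injective.eq_iff]

theorem exists_isDiag {a : Fin 3 → ℝ} (ha : ∀ i, 0 < a i) (h1 : ∏ i, a i = 1) :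
    ∃ x : XH, IsDiagH x a := by
  simp only [isDiagH_iff]
  exact exists_toHerm_eq (posDef_diagonal_iff.2 ha) ((det_diagonal a).trans h1)

theorem exists_isDiag_one : ∃ x : XH, IsDiagH x 1 :=
  exists_isDiag (fun _ => one_pos) (by simp)

theorem sq_of_isDiag {x : XH} {a : Fin 3 → ℝ} (h : IsDiagH x a) : x.sq = diagonal (a ^ 2) := by
  rw [sq, isDiagH_iff.1 h, square_diagonal]

theorem sq_of_isDiag_one {x : XH} (h : IsDiagH x 1) : x.sq = diagonal 1 := by
  rw [sq_of_isDiag h, one_pow]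

theorem actsH_iff {g : SL3H} {T : (Matrix (Fin 3) (Fin 3) ℍ[ℝ])ˣ} (hT : toComplex T.1 = g.1)
    {x y : XH} : ActsH g x y ↔ conjAut T x.sq = y.sq := by
  rw [← toComplexMatrix_injective.eq_iff, toComplexMatrix_conjAut, toComplexMatrix_sq,
    toComplexMatrix_sq, hT]
  exact eq_comm

theorem exists_toComplex_eq (g : SL3H) : ∃ T : (Matrix (Fin 3) (Fin 3) ℍ[ℝ])ˣ,
    toComplex T.1 = g.1 := by
  obtain ⟨T, hT⟩ := QuatMatrix.exists_toComplex_eq g.2.1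
  obtain ⟨U, -, rfl⟩ := exists_mem_specialLinear ((congrArg Matrix.det hT).trans g.2.2)
  exact ⟨U, hT⟩

section OperatorNorm

open scoped Matrix.Norms.L2Operator

variable {M U V : Matrix (Fin 3 ⊕ Fin 3) (Fin 3 ⊕ Fin 3) ℂ} {b : Fin 3 → ℝ}

theorem opNorm_sq (M : Matrix (Fin 3 ⊕ Fin 3) (Fin 3 ⊕ Fin 3) ℂ) :
    opNorm M ^ 2 = opNorm (M * star M) :=
  (_root_.sq ‖M‖).trans CStarRing.norm_self_mul_star.symm

theorem opNorm_inv_sq (M : Matrix (Fin 3 ⊕ Fin 3) (Fin 3 ⊕ Fin 3) ℂ) :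
    opNorm M⁻¹ ^ 2 = opNorm (M * star M)⁻¹ := by
  rw [Matrix.mul_inv_rev, Matrix.star_eq_conjTranspose, ← Matrix.conjTranspose_nonsing_inv]
  exact (_root_.sq ‖M⁻¹‖).trans CStarRing.norm_star_mul_self.symm

theorem opNorm_inv_mul (hU : U * star U = 1) : opNorm (U⁻¹ * M) = opNorm M := by
  rw [Matrix.inv_eq_right_inv hU]
  exact CStarRing.norm_mem_unitary_mul M ⟨by simpa using hU, by simpa using mul_eq_one_comm.1 hU⟩

theorem opNorm_mul_right (hU : U * star U = 1) : opNorm (M * U) = opNorm M :=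
  CStarRing.norm_mul_mem_unitary M ⟨mul_eq_one_comm.1 hU, hU⟩

theorem opNorm_toComplexMatrix_diagonal (hb : ∀ i, 0 ≤ b i) {j : Fin 3} (hj : ∀ i, b i ≤ b j) :
    opNorm (toComplexMatrix (diagonal b)) = b j := by
  change ‖toComplexMatrix (diagonal b)‖ = b j
  rw [toComplexMatrix_diagonal, Matrix.l2_opNorm_diagonal]
  refine le_antisymm ((pi_norm_le_iff_of_nonneg (hb j)).2 ?_) ?_
  · rintro (i | i) <;> simpa [abs_of_nonneg (hb i)] using hj i
  · have le_norm := norm_le_pi_norm (Sum.elim (fun i => (b i : ℂ)) fun i => (b i : ℂ)) (.inl j)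
    simpa [abs_of_nonneg (hb j)] using le_norm

theorem toComplexMatrix_diagonal_inv (hb : ∀ i, b i ≠ 0) :
    (toComplexMatrix (diagonal b))⁻¹ = toComplexMatrix (diagonal b⁻¹) := by
  refine Matrix.inv_eq_right_inv ?_
  rw [toComplexMatrix_diagonal, toComplexMatrix_diagonal, Matrix.diagonal_mul_diagonal,
    ← Matrix.diagonal_one]
  congr 1
  ext1 i
  cases i <;> simp [hb]

theorem log_opNorm_add_log_opNorm (hU : U * star U = 1) (hb : ∀ i, 0 < b i) (h10 : b 1 ≤ b 0)
    (h21 : b 2 ≤ b 1) (hV : V * star V = toComplexMatrix (diagonal b)) :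
    Real.log (opNorm (U⁻¹ * V)) + Real.log (opNorm (V⁻¹ * U)) =
      (Real.log (b 0) - Real.log (b 2)) / 2 := by
  have max_b (i) : b i ≤ b 0 := by fin_cases i; exacts [le_rfl, h10, h21.trans h10]
  have min_b (i) : b 2 ≤ b i := by fin_cases i; exacts [h21.trans h10, h21, le_rfl]
  have norm_V : opNorm (U⁻¹ * V) ^ 2 = b 0 := by
    rw [opNorm_inv_mul hU, opNorm_sq, hV]
    exact opNorm_toComplexMatrix_diagonal (fun i => (hb i).le) max_b
  have norm_inv_V : opNorm (V⁻¹ * U) ^ 2 = (b 2)⁻¹ := by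
    rw [opNorm_mul_right hU, opNorm_inv_sq, hV, toComplexMatrix_diagonal_inv fun i => (hb i).ne']
    exact opNorm_toComplexMatrix_diagonal (fun i => (inv_pos.2 (hb i)).le)
      fun i => inv_anti₀ (hb 2) (min_b i)
  have log_sq (r : ℝ) : Real.log r = Real.log (r ^ 2) / 2 := by
    rw [Real.log_pow]
    ring
  rw [log_sq, log_sq (opNorm (V⁻¹ * U)), norm_V, norm_inv_V, Real.log_inv]
  ring

end OperatorNorm

theorem dist_eq {x y : XH} {g : Herm3 ℍ[ℝ] ≃ₗ[ℝ] Herm3 ℍ[ℝ]} (hg : g ∈ genGroup ℍ[ℝ])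
    {b : Fin 3 → ℝ} (hb : ∀ i, 0 < b i) (h10 : b 1 ≤ b 0) (h21 : b 2 ≤ b 1)
    (hx : g x.sq = diagonal 1) (hy : g y.sq = diagonal b) :
    distH x y = (Real.log (b 0) - Real.log (b 2)) / 2 := by
  obtain ⟨T, -, rfl⟩ := genGroup_le_map_conjAut hg
  have isUnit_det := (Matrix.isUnit_iff_isUnit_det _).1 (isUnit_toComplex T)
  have mul_star (z : XH) : toComplex T.1 * z.1 * star (toComplex T.1 * z.1) =
      toComplexMatrix (conjAut T z.sq) := by
    rw [toComplexMatrix_conjAut, toComplexMatrix_sq, star_mul, Matrix.star_eq_conjTranspose z.1,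
      z.2.2.1]
    simp only [mul_assoc]
  have inv_mul (z w : XH) : (toComplex T.1 * z.1)⁻¹ * (toComplex T.1 * w.1) = z.1⁻¹ * w.1 := by
    rw [Matrix.mul_inv_rev, mul_assoc, Matrix.nonsing_inv_mul_cancel_left _ _ isUnit_det]
  rw [distH, ← inv_mul, ← inv_mul y]
  exact log_opNorm_add_log_opNorm (by rw [mul_star, hx, toComplexMatrix_one]) hb h10 h21
    (by rw [mul_star, hy])

theorem exists_mem_orderGroup_of_hasShape {t : ℝ} {x y : XH} (h : HasShape (K := .H) t x y) :
    ∃ L ∈ orderGroup ℍ[ℝ], L x.sq = diagonal 1 ∧ L y.sq = diagonal (shapeVec t ^ 2) := by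
  obtain ⟨g, p, q, hx, hy, hp, hq⟩ := h
  obtain ⟨T, hT⟩ := exists_toComplex_eq g
  exact ⟨_, conjAut_mem_orderGroup T, ((actsH_iff hT).1 hx).trans (sq_of_isDiag_one hp),
    ((actsH_iff hT).1 hy).trans (sq_of_isDiag hq)⟩

theorem isEquilateral_of_map {t : ℝ} {x y z : XH} {g : Herm3 ℍ[ℝ] ≃ₗ[ℝ] Herm3 ℍ[ℝ]}
    (hg : g ∈ genGroup ℍ[ℝ]) (hx : g x.sq = diagonal 1)
    (hy : g y.sq = diagonal (shapeVec t ^ 2)) (hz : g z.sq = diagonal (coshapeVec t ^ 2)) :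
    IsEquilateral (K := .H) t x y z := by
  obtain ⟨T, hT, rfl⟩ := genGroup_le_map_conjAut hg
  have acts_iff {v w} := actsH_iff (x := v) (y := w)
    (g := ⟨toComplex T.1, J_mul_toComplex _, mem_specialLinear_iff.1 hT⟩) rfl
  obtain ⟨p, hp⟩ := exists_isDiag_one
  obtain ⟨q, hq⟩ := exists_isDiag (shapeVec_pos t) (prod_shapeVec t)
  obtain ⟨r, hr⟩ := exists_isDiag (coshapeVec_pos t) (prod_coshapeVec t)
  exact ⟨_, p, q, r, acts_iff.2 (hx.trans (sq_of_isDiag_one hp).symm),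
    acts_iff.2 (hy.trans (sq_of_isDiag hq).symm), acts_iff.2 (hz.trans (sq_of_isDiag hr).symm),
    hp, hq, hr⟩

/-- The quaternionic symmetric space as a slice of the cone of positive definite matrices. -/
def model : ConeModel ℍ[ℝ] XH where
  sq := sq
  dist := distH
  Shape t x y := HasShape (K := .H) t x y
  Equilateral t x y z := IsEquilateral (K := .H) t x y z
  posDef_sq := posDef_sq
  det_sq := det_sq
  exists_sq _ := exists_sq_eq
  dist_eq _ _ _ hg _ hb h10 h21 hx hy := dist_eq hg hb h10 h21 hx hy
  shape_spec _ _ _ := exists_mem_orderGroup_of_hasShape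
  equilateral_spec _ _ _ _ _ hg := isEquilateral_of_map hg

end XH

section Paths

variable {K : DivAlg} {δ δ' : ℝ}

theorem isDeltaPath_three {x y z : SpaceK K} :
    IsDeltaPath δ ![x, y, z] ↔ distK x y + distK y z ≤ distK x z + δ := by
  rw [IsDeltaPath, Fin.sum_univ_two]
  rfl

theorem isDeltaPath_four {x y z w : SpaceK K} :
    IsDeltaPath δ ![x, y, z, w] ↔ distK x y + distK y z + distK z w ≤ distK x w + δ := by
  rw [IsDeltaPath, Fin.sum_univ_three]
  rfl

theorem IsDeltaPath.mono {n : ℕ} {p : Fin (n + 1) → SpaceK K} (hp : IsDeltaPath δ p)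
    (h : δ ≤ δ') : IsDeltaPath δ' p :=
  le_trans hp (add_le_add_right h _)

theorem IsRetractable.mono {x y z : SpaceK K} (hxyz : IsRetractable δ x y z) (h : δ ≤ δ') :
    IsRetractable δ' x y z := by
  obtain ⟨u, hxy, hyz, hzx⟩ := hxyz
  exact ⟨u, hxy.mono h, hyz.mono h, hzx.mono h⟩

end Paths

theorem exists_equilateral_isDeltaPath (K : DivAlg) :
    ∃ δ : ℝ, 0 < δ ∧ ∀ x y z : SpaceK K, ∃ x' y' z' : SpaceK K,
      (∃ t : ℝ, IsEquilateral t x' y' z') ∧ IsDeltaPath δ ![x, x', y', y] ∧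
        IsDeltaPath δ ![y, y', z', z] ∧ IsDeltaPath δ ![z, z', x', x] := by
  simp only [isDeltaPath_four]
  cases K with
  | H => exact XH.model.exists_equilateral_retraction
  | O => exact XO.model.exists_equilateral_retraction

theorem isRetractable_of_hasShape {K : DivAlg} {s t δ₀ : ℝ} (hst : 0 ≤ s * t)
    {z v w y : SpaceK K} (hvw : distK v w < δ₀) (hz : HasShape t v z) (hy : HasShape s w y) :
    IsRetractable (Real.log 3 + Real.log 6 + 4 * δ₀) z v y := by
  simp only [IsRetractable, isDeltaPath_three]
  cases K with
  | H => exact XH.model.exists_retraction_of_shape hst hvw hz hy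
  | O => exact XO.model.exists_retraction_of_shape hst hvw hz hy

end

theorem lemma3p2 (K : DivAlg) (δ₀ : ℝ) (hδ₀ : 0 < δ₀) :
    ∃ δ : ℝ, 0 < δ ∧
      (∀ x y z : SpaceK K, ∃ x' y' z' : SpaceK K, (∃ t : ℝ, IsEquilateral t x' y' z') ∧
        IsDeltaPath δ ![x, x', y', y] ∧ IsDeltaPath δ ![y, y', z', z] ∧
        IsDeltaPath δ ![z, z', x', x]) ∧
      (∀ (s t : ℝ), 0 ≤ s * t → ∀ z v w y : SpaceK K, distK v w < δ₀ →
        HasShape t v z → HasShape s w y → IsRetractable δ z v y) := by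
  obtain ⟨δ, hδ, exists_equilateral⟩ := exists_equilateral_isDeltaPath K
  refine ⟨max δ (Real.log 3 + Real.log 6 + 4 * δ₀), lt_max_of_lt_left hδ, fun x y z => ?_,
    fun s t hst z v w y hvw hz hy =>
      (isRetractable_of_hasShape hst hvw hz hy).mono (le_max_right _ _)⟩
  obtain ⟨x', y', z', hequi, hxy, hyz, hzx⟩ := exists_equilateral x y z
  exact ⟨x', y', z', hequi, hxy.mono (le_max_left _ _), hyz.mono (le_max_left _ _),
    hzx.mono (le_max_left _ _)⟩
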